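/- For $z$ in the upper half plane let $q=e^{2\pi i z}$, let $E_2,E_4,E_6$ be the Eisenstein series for $\mathrm{SL}_2(\mathbb Z)$ with constant term $1$, let $\Delta=(E_4^3-E_6^2)/1728$, let $\Theta_{01}(z)=\sum_{n\in\mathbb Z}(-1)^n e^{\pi i n^2 z}$ and $\Theta_{10}(z)=\sum_{n\in\mathbb Z}e^{\pi i (n+1/2)^2 z}$, and put $$\varphi=\frac{(25E_4^4-49E_6^2E_4)+48E_6E_4^2E_2+(-49E_4^3+25E_6^2)E_2^2}{\Delta^2},\qquad \psi_I=\frac{7\Theta_{01}^{20}\Theta_{10}^8+7\Theta_{01}^{24}\Theta_{10}^4+2\Theta_{01}^{28}}{\Delta^2}.$$ There are unique real-analytic functions $a,b:\mathbb R\to\mathbb C$ such that for all $r>2$ $$a(r)=-4\sin(\pi r^2/2)^2\int_0^{i\infty}\varphi(-1/z)\,z^{10}e^{\pi i r^2z}\,dz,\qquad b(r)=-4\sin(\pi r^2/2)^2\int_0^{i\infty}\psi_I(z)\,e^{\pi i r^2z}\,dz .$$ Let $$f(r)=-\frac{\pi i}{113218560}\,a(r)-\frac{i}{262080\pi}\,b(r),$$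 and let $\widehat f(r)=\int_{\mathbb R^{24}}f(|x|)e^{-2\pi i\langle x,y\rangle}\,dx$ for any $y\in\mathbb R^{24}$ with $|y|=|r|$ be its radial Fourier transform in $\mathbb R^{24}$. Then: 1. $f(0)=\widehat f(0)=1$; $f$ and $\widehat f$ are analytic at $0$, and the coefficients of $r^2$ in their Taylor series at $0$ are $-14347/5460$ and $-205/156$, respectively. 2. $\widehat f$ has a double root (a zero of order exactly $2$) at $\sqrt{2k}$ for every integer $k\ge2$, and $f$ has a double root at $\sqrt{2k}$ for every integer $k\ge3$; at $2$, $f$ has a simple root, with $f'(2)=-1/16380$. 3. $f(\sqrt2)=1/156$ and $f'(\sqrt2)=-146\sqrt2/4095$, while $\widehat f(\sqrt2)=1/156$ and $\widehat f'(\sqrt2)=-5\sqrt2/117$. -/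

import Mathlib

open scoped Real Topology UpperHalfPlane FourierTransform

noncomputable section

namespace Leech

/-- The weakly holomorphic quasimodular form `φ` of weight `-8` and depth `2` for `SL₂(ℤ)`.
The Eisenstein series `E2`, `E₄`, `E₆` have constant term `1`, and Mathlib's discriminant is
`Δ = (E₄³ - E₆²) / 1728` (`ModularForm.discriminant_eq_E₄_cube_sub_E₆_sq`). -/
def phi (z : ℍ) : ℂ :=
  ((25 * ModularForm.E₄ z ^ 4 - 49 * ModularForm.E₆ z ^ 2 * ModularForm.E₄ z)
    + 48 * ModularForm.E₆ z * ModularForm.E₄ z ^ 2 * EisensteinSeries.E2 z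
    + (-49 * ModularForm.E₄ z ^ 3 + 25 * ModularForm.E₆ z ^ 2) * EisensteinSeries.E2 z ^ 2)
    / ModularForm.discriminant z ^ 2

/-- The theta function `Θ₀₁`. -/
def theta01 (z : ℍ) : ℂ :=
  ∑' n : ℤ, (-1 : ℂ) ^ n * Complex.exp (π * Complex.I * (n : ℂ) ^ 2 * z)

/-- The theta function `Θ₁₀`. -/
def theta10 (z : ℍ) : ℂ :=
  ∑' n : ℤ, Complex.exp (π * Complex.I * ((n : ℂ) + 1 / 2) ^ 2 * z)

/-- The weakly holomorphic modular form `ψ_I` of weight `-10` for `Γ(2)`. -/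
def psiI (z : ℍ) : ℂ :=
  (7 * theta01 z ^ 20 * theta10 z ^ 8 + 7 * theta01 z ^ 24 * theta10 z ^ 4
    + 2 * theta01 z ^ 28) / ModularForm.discriminant z ^ 2

/-- The contour integral `∫_0^{i∞} g(z) dz` along the positive imaginary axis `z = it`. -/
def imagAxisIntegral (g : ℂ → ℂ) : ℂ :=
  ∫ t in Set.Ioi (0 : ℝ), g (Complex.I * t) * Complex.I

/-- `-4 sin(πr²/2)² ∫_0^{i∞} φ(-1/z) z¹⁰ e^{πir²z} dz`, used for `r > 2`.
On the upper half plane `UpperHalfPlane.ofComplex` is the identity. -/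
def aIntegral (r : ℝ) : ℂ :=
  -4 * (Real.sin (π * r ^ 2 / 2) : ℂ) ^ 2 *
    imagAxisIntegral (fun z => phi (UpperHalfPlane.ofComplex (-1 / z)) * z ^ 10 *
      Complex.exp (π * Complex.I * (r : ℂ) ^ 2 * z))

/-- `-4 sin(πr²/2)² ∫_0^{i∞} ψ_I(z) e^{πir²z} dz`, used for `r > 2`. -/
def bIntegral (r : ℝ) : ℂ :=
  -4 * (Real.sin (π * r ^ 2 / 2) : ℂ) ^ 2 *
    imagAxisIntegral (fun z => psiI (UpperHalfPlane.ofComplex z) *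
      Complex.exp (π * Complex.I * (r : ℂ) ^ 2 * z))

/-- `g` is the analytic continuation to all of `ℝ` of the restriction of `h` to `(2, ∞)`.
(Real-analytic on `ℝ` is the same as being the restriction of a holomorphic function on a
neighborhood of `ℝ` in `ℂ`.) -/
structure IsAnalyticContinuation (h g : ℝ → ℂ) : Prop where
  analytic : AnalyticOnNhd ℝ g Set.univ
  eq_of_two_lt : ∀ r : ℝ, 2 < r → g r = h r

/-- The auxiliary function `f = -πi/113218560 a - i/(262080π) b`. -/
def auxFunction (a b : ℝ → ℂ) (r : ℝ) : ℂ :=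
  -(π * Complex.I / 113218560) * a r - Complex.I / (262080 * π) * b r

/-- The 24-dimensional Fourier transform of the radial function `x ↦ g(|x|)`, as a function of
the radius `r = |y|`: it is evaluated at `y = (r, 0, …, 0)`, which has norm `|r|`. -/
def radialFourier (g : ℝ → ℂ) (r : ℝ) : ℂ :=
  𝓕 (fun x : EuclideanSpace ℝ (Fin 24) => g ‖x‖) (EuclideanSpace.single 0 r)

/-- The choice of the point on the sphere of radius `r` does not matter. -/
theorem fourier_eq_radialFourier (g : ℝ → ℂ) (y : EuclideanSpace ℝ (Fin 24)) :
    𝓕 (fun x : EuclideanSpace ℝ (Fin 24) => g ‖x‖) y = radialFourier g ‖y‖ := by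
  set w : EuclideanSpace ℝ (Fin 24) := EuclideanSpace.single 0 ‖y‖ with hw
  have hn : ‖y‖ = ‖w‖ := by simp [hw]
  have h := Submodule.reflection_sub hn
  have h2 := Real.fourier_comp_linearIsometry (Submodule.reflection (ℝ ∙ (y - w))ᗮ)
    (fun x : EuclideanSpace ℝ (Fin 24) => g ‖x‖) y
  rw [h] at h2
  rw [radialFourier, ← hw, ← h2]
  simp only [Function.comp_def, LinearIsometryEquiv.norm_map]

end Leech

end

/-! Put ρ = r². For ρ > 4 both defining integrals have the form -4 sin(πρ/2)² ∫ k(z) e^{πiρz} dz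
over the imaginary axis, and -4 sin(πρ/2)² = e^{πiρ} + e^{-πiρ} - 2. Absorbing these exponentials
moves the axis to real parts 1, -1 and 0, and Cauchy's theorem bends the two outer rays so that they
pass through i. From i to i∞ the three kernels merge into the second difference k(z+1) + k(z-1) -
2k(z), a multiple of a decaying form g (φ for `a`, `psiS` for `b`). What remains, `contourIntegral`,
involves only g: two arcs of the unit circle between ±1 and i, the segment from 0 to i, and the ray
from i to i∞. It is analytic at every ρ ≥ 0, so it is the continuation (`IsKernel.contour_eq`,
`IsKernel.contour_analytic`). It is also a superposition of Gaussians. In dimension 24 the Fourier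
transform turns e^{πi|x|²ζ} into ζ^{-12} e^{πi|y|²(-1/ζ)}, and ζ ↦ -1/ζ exchanges the two arcs and
exchanges the segment with the ray. Hence `a` and `b` are eigenfunctions with eigenvalues 1 and -1
(`IsKernel.fourier_contour`), and the transform of f is f with the sign of `b` reversed. The
function `magic δ` treats both cases, δ = 1 and δ = -1.

Values and derivatives: at z = it the kernel is c₄e^{4πt} + (c₂ + d₂t)e^{2πt} + c₀ + d₀t plus a
decaying remainder, with coefficients read off the q-expansions. Its Laplace transform therefore
continues with explicit poles at ρ = 4, 2, 0 (`HasPolar.eq_laplaceCont`). Against the double zeros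
of sin², a double-pole coefficient becomes a value and a simple-pole coefficient a derivative.

Exact multiplicities: at the other even integers ρ = 2n the order is two as soon as ∫ K(t) e^{-2πnt}
dt ≠ 0, which follows from a constant sign of the kernel K. Writing A and B for minus the numerators
of φ and `psiS` on the imaginary axis, this amounts to 0 ≤ A/B ≤ 432/π². The ratio is monotone: B
solves a second-order modular differential equation, A solves the same equation with a nonnegative
inhomogeneous term, and so their Wronskian has a sign (`wronskian_nonneg`, `ratio_antitone`). The
two bounds are the limits at the two ends of the axis. -/

noncomputable section
namespace Leech

open UpperHalfPlane hiding I
open Complex ModularForm ModularGroup Derivative SlashInvariantForm Filter CongruenceSubgroup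
open scoped MatrixGroups Manifold ModularForm

/-! ### Level one: vanishing criterion, generators S and T, Eisenstein series -/

/-- A holomorphic function of weight `k < 12` for `SL₂(ℤ)` that vanishes at `i∞` is zero. -/
theorem levelOne_eq_zero {k : ℤ} (hk : k < 12) {f : ℍ → ℂ} (hf : MDiff f)
    (hS : f ∣[k] S = f) (hT : f ∣[k] T = f) (h0 : IsZeroAtImInfty f) : f = 0 := by
  let F : CuspForm 𝒮ℒ k :=
    { toFun := f
      slash_action_eq' := by
        rintro A ⟨A, rfl⟩
        exact slash_action_generators_SL2Z hS hT A
      holo' := hf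
      zero_at_cusps' := by
        intro c hc
        rw [Subgroup.IsArithmetic.isCusp_iff_isCusp_SL2Z] at hc
        rw [OnePoint.isZeroAt_iff_forall_SL2Z hc]
        intro γ _
        rw [slash_action_generators_SL2Z hS hT]
        exact h0 }
  have : F = 0 := rank_zero_iff_forall_zero.mp (CuspForm.rank_eq_zero_of_weight_lt_twelve hk) F
  exact congrArg DFunLike.coe this

theorem slash_S_apply (k : ℤ) (f : ℍ → ℂ) (z : ℍ) :
    (f ∣[k] S) z = f (S • z) * (z : ℂ) ^ (-k) := by
  rw [SL_slash_apply, denom_S]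

theorem slash_T_apply (k : ℤ) (f : ℍ → ℂ) (z : ℍ) : (f ∣[k] T) z = f (T • z) := by
  have h : denom (T : GL (Fin 2) ℝ) z = 1 := by
    rw [ModularGroup.denom_apply]; simp [T]
  rw [SL_slash_apply, h, one_zpow, mul_one]

theorem apply_S_of_slash {k : ℕ} {f g : ℍ → ℂ} (h : f ∣[(k : ℤ)] S = g) (z : ℍ) :
    f (S • z) = (z : ℂ) ^ k * g z := by
  have h := congrFun h z
  have hz := z.ne_zero
  rw [slash_S_apply, zpow_neg, zpow_natCast] at h
  rw [← h]
  field_simp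

theorem slash_S_of_apply {k : ℕ} {f g : ℍ → ℂ} (h : ∀ z : ℍ, f (S • z) = (z : ℂ) ^ k * g z) :
    f ∣[(k : ℤ)] S = g := by
  ext z
  have hz := z.ne_zero
  rw [slash_S_apply, h, zpow_neg, zpow_natCast]
  field_simp

theorem slash_T_of_apply {k : ℤ} {f g : ℍ → ℂ} (h : ∀ z : ℍ, f (T • z) = g z) :
    f ∣[k] T = g := by
  ext z
  rw [slash_T_apply, h]

theorem coe_S_smul (z : ℍ) : ((S • z : ℍ) : ℂ) = -1 / z := by
  rw [UpperHalfPlane.modular_S_smul]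
  simp [neg_div, inv_neg]

theorem coe_T_smul (z : ℍ) : ((T • z : ℍ) : ℂ) = z + 1 := by
  rw [UpperHalfPlane.modular_T_smul]
  simp [add_comm]

/-- The normalized derivative of a bounded periodic holomorphic function vanishes at `i∞`. -/
theorem normalizedDeriv_isZeroAtImInfty {h : ℝ} (hh : 0 < h) {f : ℍ → ℂ} (hf : MDiff f)
    (hper : Function.Periodic (f ∘ ofComplex) h) (hb : IsBoundedAtImInfty f) :
    IsZeroAtImInfty (D f) := by
  set F := cuspFunction h f
  -- Since f = F(q) with q = e^{2πiz/h}, the normalized derivative is F'(q)·q/h; F' is continuous at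
  -- 0 and q tends to 0.
  have hF : ∀ z : ℍ, D f z = (2 * π * I)⁻¹ *
      (deriv F (Function.Periodic.qParam h z) * (2 * π * I / h * Function.Periodic.qParam h z)) := by
    intro z
    have h1 : f ∘ ofComplex =ᶠ[𝓝 (z : ℂ)] fun w => F (Function.Periodic.qParam h w) := by
      filter_upwards [isOpen_upperHalfPlaneSet.mem_nhds z.im_pos] with w hw
      have := eq_cuspFunction (f := f) ⟨w, hw⟩ hh.ne' hper
      simp only [Function.comp_apply, ofComplex_apply_of_im_pos hw]
      exact this.symm
    have h2 : HasDerivAt (Function.Periodic.qParam h)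
        (2 * π * I / h * Function.Periodic.qParam h z) (z : ℂ) := by
      have : HasDerivAt (fun w : ℂ => 2 * π * I * w / h) (2 * π * I / h) (z : ℂ) := by
        simpa using ((hasDerivAt_id (z : ℂ)).const_mul (2 * π * I)).div_const (h : ℂ)
      have := this.cexp
      rw [mul_comm (cexp _)] at this
      exact this
    have h3 := (differentiableAt_cuspFunction hh hper hf hb
      (Function.Periodic.norm_qParam_lt_one hh z.im_pos)).hasDerivAt
    rw [normalizedDerivOfComplex, h1.deriv_eq]
    congr 1
    exact (h3.comp (z : ℂ) h2).deriv
  have hq := qParam_tendsto_atImInfty hh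
  have hd : ContinuousAt (deriv F) 0 :=
    (analyticAt_cuspFunction_zero hh hper hf hb).deriv.continuousAt
  have h4 : Tendsto (fun z : ℍ => (2 * π * I)⁻¹ *
      (deriv F (Function.Periodic.qParam h z) * (2 * π * I / h * Function.Periodic.qParam h z)))
      atImInfty (𝓝 ((2 * π * I)⁻¹ * (deriv F 0 * (2 * π * I / h * 0)))) :=
    ((hd.tendsto.comp hq).mul (hq.const_mul _)).const_mul _
  simp only [mul_zero] at h4
  exact h4.congr fun z => (hF z).symm

theorem periodic_comp_ofComplex_of_T {f : ℍ → ℂ} (n : ℕ) (hf : ∀ z : ℍ, f (T ^ n • z) = f z) :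
    Function.Periodic (f ∘ ofComplex) ((n : ℝ) : ℂ) := by
  intro w
  by_cases hw : 0 < im w
  · have hw' : 0 < im (w + ((n : ℝ) : ℂ)) := by simpa using hw
    simp only [Function.comp_apply, ofComplex_apply_of_im_pos hw, ofComplex_apply_of_im_pos hw']
    rw [← hf ⟨w, hw⟩]
    congr 1
    ext
    have := UpperHalfPlane.modular_T_zpow_smul ⟨w, hw⟩ n
    rw [zpow_natCast] at this
    rw [this]
    simp [add_comm]
  · have hw' : ¬ 0 < im (w + ((n : ℝ) : ℂ)) := by simpa using hw
    simp only [Function.comp_apply]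
    rw [ofComplex_apply_of_im_nonpos (not_lt.mp hw), ofComplex_apply_of_im_nonpos (not_lt.mp hw')]

theorem periodic_of_slash_T {f : ℍ → ℂ} {k : ℤ} (hf : f ∣[k] T = f) :
    Function.Periodic (f ∘ ofComplex) ((1 : ℝ) : ℂ) := by
  have := periodic_comp_ofComplex_of_T (f := f) 1 fun z => by
    rw [pow_one, ← slash_T_apply k f, hf]
  simpa using this

local notation "E₂" => EisensteinSeries.E2

theorem E4_slash (γ : SL(2, ℤ)) : (E₄ : ℍ → ℂ) ∣[(4 : ℤ)] γ = E₄ :=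
  SlashInvariantForm.slash_action_eqn E₄ _ ⟨γ, rfl⟩

theorem E6_slash (γ : SL(2, ℤ)) : (E₆ : ℍ → ℂ) ∣[(6 : ℤ)] γ = E₆ :=
  SlashInvariantForm.slash_action_eqn E₆ _ ⟨γ, rfl⟩

theorem E2_slash_T : E₂ ∣[(2 : ℤ)] T = E₂ := by
  rw [EisensteinSeries.E2_slash_action, EisensteinSeries.D2_T]; simp

theorem E2_S (z : ℍ) : E₂ (S • z) = (z : ℂ) ^ 2 * E₂ z + 6 / (π * I) * z := by
  rw [apply_S_of_slash (k := 2) (EisensteinSeries.E2_slash_action S) z, Pi.sub_apply, Pi.smul_apply,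
    EisensteinSeries.D2_S, riemannZeta_two, smul_eq_mul]
  have hz := z.ne_zero
  have hpi : (π : ℂ) ≠ 0 := by exact_mod_cast Real.pi_ne_zero
  field_simp
  linear_combination (-6 : ℂ) * I_sq

theorem E4_S (z : ℍ) : E₄ (S • z) = (z : ℂ) ^ 4 * E₄ z :=
  apply_S_of_slash (k := 4) (E4_slash S) z

theorem E6_S (z : ℍ) : E₆ (S • z) = (z : ℂ) ^ 6 * E₆ z :=
  apply_S_of_slash (k := 6) (E6_slash S) z

theorem discriminant_S (z : ℍ) : discriminant (S • z) = (z : ℂ) ^ 12 * discriminant z :=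
  apply_S_of_slash (k := 12) discriminant_S_invariant z

theorem E2_T (z : ℍ) : E₂ (T • z) = E₂ z := by rw [← slash_T_apply 2 E₂, E2_slash_T]
theorem E4_T (z : ℍ) : E₄ (T • z) = E₄ z := by rw [← slash_T_apply 4 E₄, E4_slash]
theorem E6_T (z : ℍ) : E₆ (T • z) = E₆ z := by rw [← slash_T_apply 6 E₆, E6_slash]
theorem discriminant_T (z : ℍ) : discriminant (T • z) = discriminant z := by
  rw [← slash_T_apply 12 discriminant, discriminant_T_invariant]

end Leech
end

/-! ### Expansions in the nome and Ramanujan's differential identities -/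

noncomputable section
namespace Leech

open UpperHalfPlane hiding I
open Complex ModularForm ModularGroup Derivative SlashInvariantForm Filter CongruenceSubgroup
open scoped MatrixGroups Manifold ModularForm ArithmeticFunction.sigma

local notation "E₂" => EisensteinSeries.E2

/-- The nome `p = e^{πiz}`, so that `q = p²`. -/
def nome (z : ℍ) : ℂ := cexp (π * I * z)

theorem nome_ne_zero (z : ℍ) : nome z ≠ 0 := Complex.exp_ne_zero _

theorem qParam_one_eq (z : ℍ) : Function.Periodic.qParam 1 z = nome z ^ 2 := by
  rw [Function.Periodic.qParam, nome, ← Complex.exp_nat_mul]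
  congr 1; push_cast; ring

theorem norm_nome (z : ℍ) : ‖nome z‖ = Real.exp (-π * z.im) := by
  rw [nome, Complex.norm_exp]; simp

theorem nome_tendsto : Tendsto nome atImInfty (𝓝 0) := by
  have := qParam_tendsto_atImInfty (h := 2) two_pos
  refine this.congr fun z => ?_
  rw [Function.Periodic.qParam, nome]; congr 1; push_cast; ring

/-- The tail of the series divided by q^N is again a convergent power series in q, hence bounded at
i∞. -/
theorem exists_bounded_remainder {h : ℝ} (hh : 0 < h) {f : ℍ → ℂ} {c : ℕ → ℂ}
    (hf : ∀ τ : ℍ, HasSum (fun m ↦ c m • Function.Periodic.qParam h τ ^ m) (f τ)) (N : ℕ) :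
    ∃ g : ℍ → ℂ, IsBoundedAtImInfty g ∧ ∀ τ : ℍ, f τ =
      ∑ m ∈ Finset.range N, c m * Function.Periodic.qParam h τ ^ m +
        Function.Periodic.qParam h τ ^ N * g τ := by
  have key : ∀ τ : ℍ, HasSum (fun m ↦ c (m + N) • Function.Periodic.qParam h τ ^ m)
      ((f τ - ∑ m ∈ Finset.range N, c m * Function.Periodic.qParam h τ ^ m) /
        Function.Periodic.qParam h τ ^ N) := by
    intro τ
    have h1 := ((hasSum_nat_add_iff' N).mpr (hf τ)).div_const (Function.Periodic.qParam h τ ^ N)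
    have hq : Function.Periodic.qParam h τ ≠ 0 := Function.Periodic.qParam_ne_zero _
    simp only [smul_eq_mul] at h1 ⊢
    refine h1.congr_fun ?_
    intro m
    rw [pow_add]; field_simp
  refine ⟨_, isBoundedAtImInfty_of_hasSum_qExpansion hh key, fun τ => ?_⟩
  have hq : Function.Periodic.qParam h τ ≠ 0 := Function.Periodic.qParam_ne_zero _
  field_simp
  ring

theorem E2_expansion : ∃ g : ℍ → ℂ, IsBoundedAtImInfty g ∧ ∀ z, E₂ z =
    1 - 24 * nome z ^ 2 - 72 * nome z ^ 4 + nome z ^ 6 * g z := by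
  obtain ⟨g, hg, h⟩ := exists_bounded_remainder one_pos (f := E₂)
    (c := fun m => if m = 0 then 1 else -24 * σ 1 m) (fun τ => by
      simpa only [Function.Periodic.qParam, ofReal_one, div_one] using
        EisensteinSeries.hasSum_qExpansion_E2 (z := τ)) 3
  refine ⟨g, hg, fun z => ?_⟩
  have h1 : σ 1 2 = 3 := by decide
  rw [h z, qParam_one_eq]
  simp [Finset.sum_range_succ, h1]
  ring

theorem E4_expansion : ∃ g : ℍ → ℂ, IsBoundedAtImInfty g ∧ ∀ z, E₄ z =
    1 + 240 * nome z ^ 2 + 2160 * nome z ^ 4 + nome z ^ 6 * g z := by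
  obtain ⟨g, hg, h⟩ := exists_bounded_remainder one_pos (f := E₄)
    (fun τ => ModularForm.hasSum_qExpansion E₄ one_pos one_mem_strictPeriods_SL τ) 3
  refine ⟨g, hg, fun z => ?_⟩
  have h1 : σ 3 2 = 9 := by decide
  rw [h z, qParam_one_eq]
  norm_num [Finset.sum_range_succ, h1, EisensteinSeries.E_qExpansion_coeff _ ⟨2, rfl⟩,
    show bernoulli 4 = -1 / 30 by decide +kernel]
  ring

theorem E6_expansion : ∃ g : ℍ → ℂ, IsBoundedAtImInfty g ∧ ∀ z, E₆ z =
    1 - 504 * nome z ^ 2 - 16632 * nome z ^ 4 + nome z ^ 6 * g z := by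
  obtain ⟨g, hg, h⟩ := exists_bounded_remainder one_pos (f := E₆)
    (fun τ => ModularForm.hasSum_qExpansion E₆ one_pos one_mem_strictPeriods_SL τ) 3
  refine ⟨g, hg, fun z => ?_⟩
  have h1 : σ 5 2 = 33 := by decide
  rw [h z, qParam_one_eq]
  norm_num [Finset.sum_range_succ, h1, EisensteinSeries.E_qExpansion_coeff _ ⟨3, rfl⟩,
    show bernoulli 6 = 1 / 42 by decide +kernel]
  ring

theorem IsBoundedAtImInfty.tendsto_nome_pow_mul {g : ℍ → ℂ} (hg : IsBoundedAtImInfty g) {n : ℕ}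
    (hn : n ≠ 0) : Tendsto (fun z => nome z ^ n * g z) atImInfty (𝓝 0) := by
  have h1 : Tendsto (fun z => nome z ^ n) atImInfty (𝓝 0) := by
    simpa [hn] using nome_tendsto.pow n
  have h2 : g =O[atImInfty] (1 : ℍ → ℝ) := hg
  have h3 := h1.zero_mul_isBoundedUnder_le (g := g) ?_
  · exact h3
  · exact h2.isBoundedUnder_le

theorem E2_tendsto : Tendsto E₂ atImInfty (𝓝 1) := by
  obtain ⟨g, hg, h⟩ := E2_expansion
  rw [funext h]
  have := (((tendsto_const_nhds (x := (1 : ℂ))).sub ((nome_tendsto.pow 2).const_mul 24)).sub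
    ((nome_tendsto.pow 4).const_mul 72)).add (IsBoundedAtImInfty.tendsto_nome_pow_mul hg (n := 6) (by simp))
  simpa using this

theorem E4_tendsto : Tendsto E₄ atImInfty (𝓝 1) := by
  obtain ⟨g, hg, h⟩ := E4_expansion
  rw [funext h]
  have := (((tendsto_const_nhds (x := (1 : ℂ))).add ((nome_tendsto.pow 2).const_mul 240)).add
    ((nome_tendsto.pow 4).const_mul 2160)).add (IsBoundedAtImInfty.tendsto_nome_pow_mul hg (n := 6) (by simp))
  simpa using this

theorem E6_tendsto : Tendsto E₆ atImInfty (𝓝 1) := by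
  obtain ⟨g, hg, h⟩ := E6_expansion
  rw [funext h]
  have := (((tendsto_const_nhds (x := (1 : ℂ))).sub ((nome_tendsto.pow 2).const_mul 504)).sub
    ((nome_tendsto.pow 4).const_mul 16632)).add (IsBoundedAtImInfty.tendsto_nome_pow_mul hg (n := 6) (by simp))
  simpa using this

theorem E4_mdiff : MDiff (E₄ : ℍ → ℂ) := ModularFormClass.holo E₄
theorem E6_mdiff : MDiff (E₆ : ℍ → ℂ) := ModularFormClass.holo E₆
theorem E2_mdiff : MDiff E₂ := E2_mdifferentiable

theorem D_E2_tendsto : Tendsto (D E₂) atImInfty (𝓝 0) :=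
  normalizedDeriv_isZeroAtImInfty one_pos E2_mdiff (periodic_of_slash_T E2_slash_T)
    EisensteinSeries.isBoundedAtImInfty_E2
theorem D_E4_tendsto : Tendsto (D E₄) atImInfty (𝓝 0) :=
  normalizedDeriv_isZeroAtImInfty one_pos E4_mdiff (periodic_of_slash_T (E4_slash T))
    (ModularFormClass.bdd_at_infty E₄)
theorem D_E6_tendsto : Tendsto (D E₆) atImInfty (𝓝 0) :=
  normalizedDeriv_isZeroAtImInfty one_pos E6_mdiff (periodic_of_slash_T (E6_slash T))
    (ModularFormClass.bdd_at_infty E₆)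

/-- The Serre derivative of E₄ is modular of weight 6 with constant term -1/3. Adding E₆/3 gives a
form vanishing at i∞ in a weight below 12. `D_E6` follows the same pattern in weight 8. -/
theorem D_E4 (z : ℍ) : D E₄ z = (E₂ z * E₄ z - E₆ z) / 3 := by
  have hinv : ∀ γ : SL(2, ℤ), (serreDerivative (4 : ℤ) E₄ + (1 / 3 : ℂ) • (E₆ : ℍ → ℂ)) ∣[(6 : ℤ)] γ
      = serreDerivative (4 : ℤ) E₄ + (1 / 3 : ℂ) • (E₆ : ℍ → ℂ) := by
    intro γ
    have h1 := serreDerivative_slash_invariant (k := 4) E4_mdiff (E4_slash γ)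
    rw [SlashAction.add_slash, ModularForm.SL_smul_slash, E6_slash]
    congr 1
  have h := levelOne_eq_zero (k := 6) (by norm_num)
    ((serreDerivative_mdifferentiable (4 : ℤ) E4_mdiff).add (E6_mdiff.const_smul (1 / 3 : ℂ)))
    (hinv S) (hinv T) (by
      have := (D_E4_tendsto.sub ((E2_tendsto.const_mul ((4 : ℤ) * 12⁻¹ : ℂ)).mul E4_tendsto)).add
        (E6_tendsto.const_mul (1 / 3 : ℂ))
      norm_num at this
      refine this.congr fun z => ?_
      simp [-mul_eq_mul_right_iff, -mul_eq_mul_left_iff]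
      ring)
  have := congrFun h z
  simp at this
  linear_combination this

theorem D_E6 (z : ℍ) : D E₆ z = (E₂ z * E₆ z - E₄ z ^ 2) / 2 := by
  have hinv : ∀ γ : SL(2, ℤ),
      (serreDerivative (6 : ℤ) E₆ + (1 / 2 : ℂ) • ((E₄ : ℍ → ℂ) * E₄)) ∣[(8 : ℤ)] γ
      = serreDerivative (6 : ℤ) E₆ + (1 / 2 : ℂ) • ((E₄ : ℍ → ℂ) * E₄) := by
    intro γ
    have h1 := serreDerivative_slash_invariant (k := 6) E6_mdiff (E6_slash γ)
    have h2 := ModularForm.mul_slash_SL2 4 4 γ E₄ E₄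
    rw [E4_slash] at h2
    rw [SlashAction.add_slash, ModularForm.SL_smul_slash]
    congr 1
    congr 1
  have h := levelOne_eq_zero (k := 8) (by norm_num)
    ((serreDerivative_mdifferentiable (6 : ℤ) E6_mdiff).add
      ((E4_mdiff.mul E4_mdiff).const_smul (1 / 2 : ℂ)))
    (hinv S) (hinv T) (by
      have := (D_E6_tendsto.sub ((E2_tendsto.const_mul ((6 : ℤ) * 12⁻¹ : ℂ)).mul E6_tendsto)).add
        ((E4_tendsto.mul E4_tendsto).const_mul (1 / 2 : ℂ))
      norm_num at this
      refine this.congr fun z => ?_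
      simp [-mul_eq_mul_right_iff, -mul_eq_mul_left_iff]
      ring)
  have := congrFun h z
  simp at this
  linear_combination this

/-- E₂ is only quasimodular, so invariance of the difference of the two sides has to be computed:
the anomalies of `D E₂` and of E₂²/12 under S cancel. -/
theorem D_E2 (z : ℍ) : D E₂ z = (E₂ z ^ 2 - E₄ z) / 12 := by
  have hpi : (π : ℂ) ≠ 0 := by exact_mod_cast Real.pi_ne_zero
  have hT : ∀ z, D E₂ (T • z) = D E₂ z := by
    intro z
    have := congrFun (normalizedDerivOfComplex_SL_slash (k := 2) E2_mdiff (γ := T)) z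
    rw [E2_slash_T, Pi.sub_apply, slash_T_apply] at this
    simpa [T] using this.symm
  -- The bracket is arranged so that its last two terms are exactly what (E₂ + 6/(πiz))²/12 adds to
  -- E₂²/12.
  have hS : ∀ z : ℍ, D E₂ (S • z) = (z : ℂ) ^ 4 *
      (D E₂ z + 1 / (π * I) / z * E₂ z + (1 / 12) * (6 / (π * I) / z) ^ 2) := by
    intro z
    have hz := z.ne_zero
    have h1 := congrFun (normalizedDerivOfComplex_SL_slash (k := 2) E2_mdiff (γ := S)) z
    have h2 : E₂ ∣[(2 : ℤ)] S = fun z : ℍ => E₂ z + 6 / (π * I) / z := by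
      apply slash_S_of_apply (k := 2)
      intro z
      have hz := z.ne_zero
      rw [E2_S]; field_simp
    have h3 : D (fun z : ℍ => E₂ z + 6 / (π * I) / z) z =
        D E₂ z + (2 * π * I)⁻¹ * (-(6 / (π * I)) / z ^ 2) := by
      have hd := (UpperHalfPlane.mdifferentiableAt_iff.mp (E2_mdiff z)).hasDerivAt
      have hi := ((hasDerivAt_inv hz).const_mul (6 / (π * I) : ℂ))
      have he : (fun z : ℍ => E₂ z + 6 / (π * I) / z) ∘ ofComplex =ᶠ[𝓝 (z : ℂ)]
          fun w => (E₂ ∘ ofComplex) w + 6 / (π * I) * w⁻¹ := by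
        filter_upwards [isOpen_upperHalfPlaneSet.mem_nhds z.im_pos] with w hw
        simp [ofComplex_apply_of_im_pos hw, div_eq_mul_inv]
      simp only [normalizedDerivOfComplex]
      rw [he.deriv_eq, (hd.fun_add hi).deriv]
      ring
    rw [h2, h3, Pi.sub_apply, slash_S_apply] at h1
    have h4 : ((S : SL(2, ℤ)) 1 0 : ℂ) = 1 := by simp [S]
    simp only [denom_S] at h1
    have h5 : D E₂ (S • z) = (D E₂ (S • z) * (z : ℂ) ^ (-(2 + 2) : ℤ)) * (z : ℂ) ^ 4 := by
      rw [show (-(2 + 2) : ℤ) = -((4 : ℕ) : ℤ) by norm_num, zpow_neg, zpow_natCast]; field_simp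
    have h6 : D E₂ (S • z) * (z : ℂ) ^ (-(2 + 2) : ℤ) = D E₂ z + (2 * π * I)⁻¹ *
        (-(6 / (π * I)) / z ^ 2) + 2 * (2 * π * I)⁻¹ * (1 / z) * (E₂ z + 6 / (π * I) / z) := by
      have : (((S : SL(2, ℤ)) 1 0 : ℤ) : ℂ) = 1 := by simp [S]
      simp only [this] at h1
      push_cast at h1
      rw [show (-(2 + 2) : ℤ) = -4 by norm_num]
      linear_combination -h1
    rw [h5, h6]
    field_simp
    ring
  have h := levelOne_eq_zero (k := 4) (by norm_num)
    (f := fun z => D E₂ z - (E₂ z * E₂ z - E₄ z) * 12⁻¹)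
    ((normalizedDerivOfComplex_mdifferentiable E2_mdiff).sub
      (((E2_mdiff.mul E2_mdiff).sub E4_mdiff).mul mdifferentiable_const))
    (slash_S_of_apply (k := 4) fun z => by
      have hz := z.ne_zero
      have hI := I_ne_zero
      rw [hS, E2_S, E4_S]
      field_simp
      ring)
    (slash_T_of_apply fun z => by rw [hT, E2_T, E4_T])
    (by
      have := D_E2_tendsto.sub (((E2_tendsto.mul E2_tendsto).sub E4_tendsto).mul_const (12⁻¹ : ℂ))
      norm_num at this
      refine this.congr fun z => ?_
      ring)
  have := congrFun h z
  simp at this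
  linear_combination this

end Leech
end

/-! ### Theta functions: transformation laws and expansions -/

noncomputable section
namespace Leech

open UpperHalfPlane hiding I
open Complex ModularForm ModularGroup Derivative SlashInvariantForm Filter CongruenceSubgroup
open scoped MatrixGroups Manifold ModularForm ArithmeticFunction.sigma

local notation "E₂" => EisensteinSeries.E2

/-- The theta function `Θ₀₀`. -/
def theta00 (z : ℍ) : ℂ := jacobiTheta₂ 0 z

theorem exp_pi_I_mul_int (n : ℤ) : cexp (π * I * n) = (-1) ^ n := by
  rw [mul_comm, Complex.exp_int_mul, Complex.exp_pi_mul_I]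

theorem exp_pi_I_mul_int_sq (n : ℤ) : cexp (π * I * (n : ℂ) ^ 2) = (-1) ^ n := by
  obtain ⟨m, hm⟩ := Int.even_mul_succ_self (n - 1)
  have h : (n : ℂ) ^ 2 = (n : ℂ) + 2 * m := by
    have : n ^ 2 = n + 2 * m := by linarith [hm, show (n - 1) * (n - 1 + 1) = n ^ 2 - n by ring]
    exact_mod_cast this
  rw [h, mul_add, Complex.exp_add, exp_pi_I_mul_int,
    show (π * I * (2 * m) : ℂ) = m * (2 * π * I) by ring, Complex.exp_int_mul_two_pi_mul_I, mul_one]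

theorem theta01_eq_jacobiTheta₂ (z : ℍ) : theta01 z = jacobiTheta₂ (1 / 2) z := by
  rw [theta01, jacobiTheta₂]
  refine tsum_congr fun n => ?_
  rw [jacobiTheta₂_term, Complex.exp_add, ← exp_pi_I_mul_int]
  congr 2; ring

theorem theta01_eq_jacobiTheta (z : ℍ) : theta01 z = jacobiTheta (z + 1) := by
  rw [theta01, jacobiTheta]
  refine tsum_congr fun n => ?_
  rw [mul_add, Complex.exp_add, mul_one, exp_pi_I_mul_int_sq, mul_comm]

theorem theta10_eq_jacobiTheta₂ (z : ℍ) :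
    theta10 z = cexp (π * I * z / 4) * jacobiTheta₂ (z / 2) z := by
  rw [theta10, jacobiTheta₂, ← tsum_mul_left]
  refine tsum_congr fun n => ?_
  rw [jacobiTheta₂_term, ← Complex.exp_add]
  congr 1; ring

theorem theta00_T (z : ℍ) : theta00 (T • z) = theta01 z := by
  rw [theta00, theta01_eq_jacobiTheta, jacobiTheta_eq_jacobiTheta₂, coe_T_smul]

theorem theta01_T (z : ℍ) : theta01 (T • z) = theta00 z := by
  rw [theta00, theta01_eq_jacobiTheta, jacobiTheta_eq_jacobiTheta₂, coe_T_smul,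
    show (z : ℂ) + 1 + 1 = z + 2 by ring, jacobiTheta₂_add_right]

theorem theta10_T (z : ℍ) : theta10 (T • z) = cexp (π * I / 4) * theta10 z := by
  rw [theta10, theta10, ← tsum_mul_left]
  refine tsum_congr fun n => ?_
  rw [← Complex.exp_add, coe_T_smul]
  obtain ⟨m, hm⟩ := Int.even_mul_succ_self n
  have h : (n : ℂ) ^ 2 + n = 2 * m := by
    have : n ^ 2 + n = 2 * m := by linarith [hm, show n * (n + 1) = n ^ 2 + n by ring]
    exact_mod_cast this
  rw [show (π * I * ((n : ℂ) + 1 / 2) ^ 2 * (z + 1) : ℂ) =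
    (π * I / 4 + π * I * (n + 1 / 2) ^ 2 * z) + m * (2 * π * I) by
      linear_combination (π * I) * h, Complex.exp_add, Complex.exp_int_mul_two_pi_mul_I, mul_one]

/-- Passing to fourth powers removes the choice of branch of the square root in the theta functional
equation. -/
theorem csqrt_pow_four (w : ℂ) : (w ^ (1 / 2 : ℂ)) ^ 4 = w ^ 2 := by
  rw [← Complex.cpow_nat_mul, ← Complex.cpow_ofNat]
  norm_num

theorem theta00_S_pow (z : ℍ) : theta00 (S • z) ^ 4 = -(z : ℂ) ^ 2 * theta00 z ^ 4 := by
  have hz := z.ne_zero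
  have h := jacobiTheta₂_functional_equation 0 z
  rw [theta00, theta00, coe_S_smul, h]
  simp only [mul_pow, one_div]
  rw [inv_pow, ← one_div (2 : ℂ), csqrt_pow_four]
  simp
  rw [mul_pow, I_sq]; field_simp

theorem theta10_S_pow (z : ℍ) : theta10 (S • z) ^ 4 = -(z : ℂ) ^ 2 * theta01 z ^ 4 := by
  have hz := z.ne_zero
  have h := jacobiTheta₂_functional_equation (1 / 2) z
  have h1 : theta10 (S • z) = cexp (-π * I * (1 / 2) ^ 2 / z) * jacobiTheta₂ (1 / 2 / z) (-1 / z) := by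
    rw [theta10_eq_jacobiTheta₂, coe_S_smul, ← jacobiTheta₂_neg_left]
    congr 2 <;> ring
  rw [theta01_eq_jacobiTheta₂, h, mul_assoc, ← h1, mul_pow, one_div, inv_pow, csqrt_pow_four,
    mul_pow, neg_sq, I_sq]
  field_simp

theorem theta01_S_pow (z : ℍ) : theta01 (S • z) ^ 4 = -(z : ℂ) ^ 2 * theta10 z ^ 4 := by
  have hz := z.ne_zero
  have h := theta10_S_pow (S • z)
  have h2 : (S • S • z : ℍ) = z := by
    ext; rw [coe_S_smul, coe_S_smul]; field_simp
  rw [h2, coe_S_smul] at h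
  rw [h]; field_simp

/-- `Θ₁₀⁴` -/
def H₂ (z : ℍ) : ℂ := theta10 z ^ 4
/-- `Θ₀₀⁴` -/
def H₃ (z : ℍ) : ℂ := theta00 z ^ 4
/-- `Θ₀₁⁴` -/
def H₄ (z : ℍ) : ℂ := theta01 z ^ 4

theorem H₂_T (z : ℍ) : H₂ (T • z) = -H₂ z := by
  rw [H₂, theta10_T, mul_pow, ← Complex.exp_nat_mul, H₂]
  rw [show ((4 : ℕ) * (π * I / 4) : ℂ) = π * I by push_cast; ring, Complex.exp_pi_mul_I]
  ring
theorem H₃_T (z : ℍ) : H₃ (T • z) = H₄ z := by rw [H₃, theta00_T, H₄]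
theorem H₄_T (z : ℍ) : H₄ (T • z) = H₃ z := by rw [H₄, theta01_T, H₃]
theorem H₂_S (z : ℍ) : H₂ (S • z) = (z : ℂ) ^ 2 * -H₄ z := by rw [H₂, theta10_S_pow, H₄]; ring
theorem H₃_S (z : ℍ) : H₃ (S • z) = (z : ℂ) ^ 2 * -H₃ z := by rw [H₃, theta00_S_pow, H₃]; ring
theorem H₄_S (z : ℍ) : H₄ (S • z) = (z : ℂ) ^ 2 * -H₂ z := by rw [H₄, theta01_S_pow, H₂]; ring

theorem mdiff_of_hasDerivAt {f : ℍ → ℂ} {F : ℂ → ℂ} (h : ∀ z : ℍ, f z = F z)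
    (hF : ∀ z : ℂ, 0 < z.im → DifferentiableAt ℂ F z) : MDiff f := by
  rw [UpperHalfPlane.mdifferentiable_iff]
  refine DifferentiableOn.congr (f := F) (fun z hz => (hF z hz).differentiableWithinAt) ?_
  intro z hz
  rw [Function.comp_apply, ofComplex_apply_of_im_pos hz, h]

theorem theta00_mdiff : MDiff theta00 :=
  mdiff_of_hasDerivAt (fun _ => rfl) fun _ hz => differentiableAt_jacobiTheta₂_snd 0 hz

theorem theta01_mdiff : MDiff theta01 :=
  mdiff_of_hasDerivAt theta01_eq_jacobiTheta₂ fun _ hz => differentiableAt_jacobiTheta₂_snd _ hz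

theorem theta10_mdiff : MDiff theta10 :=
  mdiff_of_hasDerivAt theta10_eq_jacobiTheta₂ fun z hz => by
    have h1 : DifferentiableAt ℂ (fun p : ℂ × ℂ => jacobiTheta₂ p.1 p.2) (z / 2, z) :=
      (hasFDerivAt_jacobiTheta₂ (z / 2) hz).differentiableAt
    have h2 : DifferentiableAt ℂ (fun w : ℂ => (w / 2, w)) z := by fun_prop
    have h3 : DifferentiableAt ℂ (fun w : ℂ => jacobiTheta₂ (w / 2) w) z :=
      DifferentiableAt.comp (f := fun w : ℂ => (w / 2, w)) z
        (g := fun p : ℂ × ℂ => jacobiTheta₂ p.1 p.2) h1 h2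
    have h4 : DifferentiableAt ℂ (fun w : ℂ => cexp (π * I * w / 4)) z := by fun_prop
    exact h4.mul h3

theorem H₂_mdiff : MDiff H₂ := theta10_mdiff.pow 4
theorem H₃_mdiff : MDiff H₃ := theta00_mdiff.pow 4
theorem H₄_mdiff : MDiff H₄ := theta01_mdiff.pow 4

/-- Theta series are power series in the nome with sparse exponents. Exponents at least n are enough
to compare with a geometric series, and the bound is uniform in x. -/
theorem tsum_sparse_pow {x : ℂ} (hx : ‖x‖ ≤ 1 / 2) {a : ℕ → ℕ} (ha : ∀ n, n ≤ a n) :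
    Summable (fun n => x ^ a n) ∧ ‖∑' n, x ^ a n‖ ≤ 2 := by
  have hb : ∀ n, ‖x ^ a n‖ ≤ (1 / 2 : ℝ) ^ n := fun n => by
    rw [norm_pow]
    calc ‖x‖ ^ a n ≤ (1 / 2 : ℝ) ^ a n := by gcongr
      _ ≤ (1 / 2 : ℝ) ^ n := pow_le_pow_of_le_one (by norm_num) (by norm_num) (ha n)
  exact ⟨Summable.of_norm_bounded summable_geometric_two hb,
    tsum_of_norm_bounded hasSum_geometric_two hb⟩

theorem eventually_norm_nome_le : ∀ᶠ z in atImInfty, ‖nome z‖ ≤ 1 / 2 := by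
  have := nome_tendsto.norm
  rw [norm_zero] at this
  exact this.eventually_le_const (by norm_num)

theorem isBoundedAtImInfty_of_eventually_le {g : ℍ → ℂ} {C : ℝ}
    (h : ∀ᶠ z in atImInfty, ‖g z‖ ≤ C) : IsBoundedAtImInfty g := by
  refine Asymptotics.IsBigO.of_bound C (h.mono fun z hz => ?_)
  simpa using hz

theorem theta01_expansion : ∃ g : ℍ → ℂ, IsBoundedAtImInfty g ∧ ∀ z, theta01 z =
    1 - 2 * nome z + 2 * nome z ^ 4 + nome z ^ 5 * g z := by
  refine ⟨fun z => (theta01 z - (1 - 2 * nome z + 2 * nome z ^ 4)) / nome z ^ 5,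
    isBoundedAtImInfty_of_eventually_le (C := 4) ?_, fun z => ?_⟩
  · filter_upwards [eventually_norm_nome_le] with z hz
    have hy : ‖-nome z‖ ≤ 1 / 2 := by rwa [norm_neg]
    have h1 := tsum_sparse_pow hy (a := fun n => (n + 1) ^ 2) fun n => by nlinarith
    -- The exponents (n+3)² form the tail after y and y⁴. They are at least 9, so the natural
    -- subtraction of 5 loses nothing.
    have h2 := tsum_sparse_pow hy (a := fun n => (n + 3) ^ 2 - 5) fun n =>
      Nat.le_sub_of_add_le (by nlinarith [Nat.zero_le n])
    have h3 : theta01 z = 1 + 2 * ∑' n : ℕ, (-nome z) ^ (n + 1) ^ 2 := by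
      rw [theta01_eq_jacobiTheta, jacobiTheta_eq_tsum_nat (by simpa using z.im_pos)]
      congr 2
      refine tsum_congr fun n => ?_
      have : -nome z = cexp (π * I * (z + 1)) := by
        rw [mul_add, mul_one, Complex.exp_add, Complex.exp_pi_mul_I, nome]; ring
      rw [this, ← Complex.exp_nat_mul]
      congr 1; push_cast; ring
    have h4 : ∑' n : ℕ, (-nome z) ^ (n + 1) ^ 2 = -nome z + nome z ^ 4 +
        (-nome z) ^ 5 * ∑' n : ℕ, (-nome z) ^ ((n + 3) ^ 2 - 5) := by
      rw [← h1.1.sum_add_tsum_nat_add 2, ← tsum_mul_left]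
      congr 1
      · simp [Finset.sum_range_succ]; ring
      · refine tsum_congr fun n => ?_
        rw [← pow_add]
        congr 1
        have : 5 ≤ (n + 3) ^ 2 := by nlinarith [Nat.zero_le n]
        rw [Nat.add_sub_cancel' this]
    have hp := nome_ne_zero z
    have h5 : (theta01 z - (1 - 2 * nome z + 2 * nome z ^ 4)) / nome z ^ 5 =
        -2 * ∑' n : ℕ, (-nome z) ^ ((n + 3) ^ 2 - 5) := by
      rw [h3, h4, div_eq_iff (pow_ne_zero _ hp)]; ring
    rw [h5, norm_mul]
    norm_num
    linarith [h2.2]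
  · have hp := nome_ne_zero z
    field_simp
    ring

theorem theta10_expansion : ∃ g : ℍ → ℂ, IsBoundedAtImInfty g ∧ ∀ z, theta10 z =
    cexp (π * I * z / 4) * 2 * (1 + nome z ^ 2 + nome z ^ 4 * g z) := by
  refine ⟨fun z => (theta10 z / (cexp (π * I * z / 4) * 2) - (1 + nome z ^ 2)) / nome z ^ 4,
    isBoundedAtImInfty_of_eventually_le (C := 2) ?_, fun z => ?_⟩
  · filter_upwards [eventually_norm_nome_le] with z hz
    have h1 := tsum_sparse_pow hz (a := fun n => n ^ 2 + n) fun n => by nlinarith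
    have h2 := tsum_sparse_pow hz (a := fun n => (n + 2) ^ 2 + (n + 2) - 4) fun n =>
      Nat.le_sub_of_add_le (by nlinarith [Nat.zero_le n])
    have h3 : theta10 z = cexp (π * I * z / 4) * 2 * ∑' n : ℕ, nome z ^ (n ^ 2 + n) := by
      have hs : ∀ n : ℕ, cexp (π * I * ((n : ℂ) + 1 / 2) ^ 2 * z) =
          cexp (π * I * z / 4) * nome z ^ (n ^ 2 + n) := fun n => by
        rw [nome, ← Complex.exp_nat_mul, ← Complex.exp_add]
        congr 1; push_cast; ring
      have hs' : ∀ n : ℕ, cexp (π * I * (((-(n + 1) : ℤ) : ℂ) + 1 / 2) ^ 2 * z) =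
          cexp (π * I * z / 4) * nome z ^ (n ^ 2 + n) := fun n => by
        rw [← hs]; congr 1; push_cast; ring
      rw [theta10, tsum_of_nat_of_neg_add_one]
      · simp only [Int.cast_natCast, hs, hs', tsum_mul_left]; ring
      · simp only [Int.cast_natCast, hs]; exact h1.1.mul_left _
      · simp only [hs']; exact h1.1.mul_left _
    have h4 : ∑' n : ℕ, nome z ^ (n ^ 2 + n) = 1 + nome z ^ 2 +
        nome z ^ 4 * ∑' n : ℕ, nome z ^ ((n + 2) ^ 2 + (n + 2) - 4) := by
      rw [← h1.1.sum_add_tsum_nat_add 2, ← tsum_mul_left]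
      congr 1
      · simp [Finset.sum_range_succ]
      · refine tsum_congr fun n => ?_
        rw [← pow_add]
        congr 1
        have : 4 ≤ (n + 2) ^ 2 + (n + 2) := by nlinarith
        rw [Nat.add_sub_cancel' this]
    have hp := nome_ne_zero z
    have he := Complex.exp_ne_zero (π * I * z / 4)
    have h5 : (theta10 z / (cexp (π * I * z / 4) * 2) - (1 + nome z ^ 2)) / nome z ^ 4 =
        ∑' n : ℕ, nome z ^ ((n + 2) ^ 2 + (n + 2) - 4) := by
      rw [h3, h4, div_eq_iff (pow_ne_zero _ hp)]
      field_simp; ring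
    rw [h5]
    exact h2.2
  · have hp := nome_ne_zero z
    have he := Complex.exp_ne_zero (π * I * z / 4)
    field_simp
    ring

theorem exp_quarter_pow_four (z : ℍ) : cexp (π * I * z / 4) ^ 4 = nome z := by
  rw [← Complex.exp_nat_mul, nome]; congr 1; push_cast; ring

end Leech
end

/-! ### Jacobi's identity, E₄ in theta functions, derivatives of theta fourth powers -/

noncomputable section
namespace Leech

open UpperHalfPlane hiding I
open Complex ModularForm ModularGroup Derivative SlashInvariantForm Filter CongruenceSubgroup
open scoped MatrixGroups Manifold ModularForm ArithmeticFunction.sigma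

local notation "E₂" => EisensteinSeries.E2

theorem tendsto_T_smul : Tendsto (fun z : ℍ => T • z) atImInfty atImInfty := by
  rw [atImInfty, tendsto_comap_iff]
  refine tendsto_comap.congr fun z => ?_
  rw [Function.comp_apply, ← UpperHalfPlane.coe_im, ← UpperHalfPlane.coe_im, coe_T_smul]
  simp

theorem H₄_expansion : ∃ g : ℍ → ℂ, IsBoundedAtImInfty g ∧ ∀ z, H₄ z =
    (1 - 2 * nome z + 2 * nome z ^ 4 + nome z ^ 5 * g z) ^ 4 := by
  obtain ⟨g, hg, h⟩ := theta01_expansion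
  exact ⟨g, hg, fun z => by rw [H₄, h]⟩

theorem H₂_expansion : ∃ g : ℍ → ℂ, IsBoundedAtImInfty g ∧ ∀ z, H₂ z =
    16 * nome z * (1 + nome z ^ 2 + nome z ^ 4 * g z) ^ 4 := by
  obtain ⟨g, hg, h⟩ := theta10_expansion
  exact ⟨g, hg, fun z => by rw [H₂, h, mul_pow, mul_pow, exp_quarter_pow_four]; ring⟩

theorem H₄_tendsto : Tendsto H₄ atImInfty (𝓝 1) := by
  obtain ⟨g, hg, h⟩ := H₄_expansion
  rw [funext h]
  have := ((((tendsto_const_nhds (x := (1 : ℂ))).sub (nome_tendsto.const_mul 2)).add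
    ((nome_tendsto.pow 4).const_mul 2)).add
      (IsBoundedAtImInfty.tendsto_nome_pow_mul hg (n := 5) (by simp))).pow 4
  simpa using this

theorem H₂_tendsto : Tendsto H₂ atImInfty (𝓝 0) := by
  obtain ⟨g, hg, h⟩ := H₂_expansion
  rw [funext h]
  have := (nome_tendsto.const_mul 16).mul ((((tendsto_const_nhds (x := (1 : ℂ))).add
    (nome_tendsto.pow 2)).add
      (IsBoundedAtImInfty.tendsto_nome_pow_mul hg (n := 4) (by simp))).pow 4)
  simpa using this

theorem H₃_tendsto : Tendsto H₃ atImInfty (𝓝 1) :=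
  (H₄_tendsto.comp tendsto_T_smul).congr fun z => by
    rw [Function.comp_apply, H₄_T]

/-- Jacobi's identity. -/
theorem jacobi_identity (z : ℍ) : H₃ z = H₂ z + H₄ z := by
  -- Up to the weight factor, S and T only change the sign of H₂ + H₄ - H₃. Its square is thus of
  -- level one and vanishes at i∞.
  have h := levelOne_eq_zero (k := 4) (by norm_num) (f := fun z => (H₂ z + H₄ z - H₃ z) ^ 2)
    (((H₂_mdiff.add H₄_mdiff).sub H₃_mdiff).pow 2)
    (slash_S_of_apply (k := 4) fun z => by rw [H₂_S, H₃_S, H₄_S]; ring)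
    (slash_T_of_apply fun z => by rw [H₂_T, H₃_T, H₄_T]; ring)
    (by
      have := ((H₂_tendsto.add H₄_tendsto).sub H₃_tendsto).pow 2
      norm_num at this
      exact this)
  have := congrFun h z
  simp only [Pi.zero_apply, ne_eq, OfNat.ofNat_ne_zero, not_false_eq_true, pow_eq_zero_iff] at this
  linear_combination -this

theorem E4_eq_theta (z : ℍ) : E₄ z = H₂ z ^ 2 + H₂ z * H₄ z + H₄ z ^ 2 := by
  have h := levelOne_eq_zero (k := 4) (by norm_num)
    (f := fun z => E₄ z - (H₂ z * H₂ z + H₂ z * H₄ z + H₄ z * H₄ z))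
    (E4_mdiff.sub (((H₂_mdiff.mul H₂_mdiff).add (H₂_mdiff.mul H₄_mdiff)).add
      (H₄_mdiff.mul H₄_mdiff)))
    (slash_S_of_apply (k := 4) fun z => by rw [H₂_S, H₄_S, E4_S]; ring)
    (slash_T_of_apply fun z => by rw [H₂_T, H₄_T, E4_T, jacobi_identity]; ring)
    (by
      have := E4_tendsto.sub (((H₂_tendsto.mul H₂_tendsto).add (H₂_tendsto.mul H₄_tendsto)).add
        (H₄_tendsto.mul H₄_tendsto))
      norm_num at this
      exact this)
  have := congrFun h z
  simp only [Pi.zero_apply] at this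
  linear_combination this

theorem slash_T_sq_apply {f : ℍ → ℂ} {g : ℍ → ℂ} (h1 : ∀ z : ℍ, f (T • z) = g z)
    (h2 : ∀ z : ℍ, g (T • z) = f z) : Function.Periodic (f ∘ ofComplex) ((2 : ℝ) : ℂ) := by
  have := periodic_comp_ofComplex_of_T (f := f) 2 fun z => by rw [pow_two, mul_smul, h1, h2]
  simpa using this

theorem isBounded_of_tendsto {f : ℍ → ℂ} {c : ℂ} (h : Tendsto f atImInfty (𝓝 c)) :
    IsBoundedAtImInfty f :=
  h.isBigO_one ℝ

theorem D_H₂_tendsto : Tendsto (D H₂) atImInfty (𝓝 0) :=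
  normalizedDeriv_isZeroAtImInfty two_pos H₂_mdiff
    (slash_T_sq_apply (g := fun z => -H₂ z) H₂_T fun z => by rw [H₂_T, neg_neg])
    (isBounded_of_tendsto H₂_tendsto)

theorem D_H₄_tendsto : Tendsto (D H₄) atImInfty (𝓝 0) :=
  normalizedDeriv_isZeroAtImInfty two_pos H₄_mdiff (slash_T_sq_apply H₄_T H₃_T)
    (isBounded_of_tendsto H₄_tendsto)

/-- The defect in the formula for the Serre derivative of `Θ₁₀⁴`. -/
def defect₂ (z : ℍ) : ℂ := serreDerivative (2 : ℤ) H₂ z - (H₂ z * H₂ z + 2 * (H₂ z * H₄ z)) * 6⁻¹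
/-- The defect in the formula for the Serre derivative of `Θ₀₁⁴`. -/
def defect₄ (z : ℍ) : ℂ := serreDerivative (2 : ℤ) H₄ z + (2 * (H₂ z * H₄ z) + H₄ z * H₄ z) * 6⁻¹

theorem defect₂_mdiff : MDiff defect₂ :=
  (serreDerivative_mdifferentiable _ H₂_mdiff).sub
    (((H₂_mdiff.mul H₂_mdiff).add (mdifferentiable_const.mul (H₂_mdiff.mul H₄_mdiff))).mul
      mdifferentiable_const)

theorem defect₄_mdiff : MDiff defect₄ :=
  (serreDerivative_mdifferentiable _ H₄_mdiff).add
    (((mdifferentiable_const.mul (H₂_mdiff.mul H₄_mdiff)).add (H₄_mdiff.mul H₄_mdiff)).mul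
      mdifferentiable_const)

theorem serreDerivative_S {f g : ℍ → ℂ} (hf : MDiff f) (hg : MDiff g)
    (h : ∀ z : ℍ, f (S • z) = (z : ℂ) ^ 2 * -g z) (z : ℍ) :
    serreDerivative (2 : ℤ) f (S • z) = (z : ℂ) ^ 4 * -serreDerivative (2 : ℤ) g z := by
  have h1 : f ∣[((2 : ℕ) : ℤ)] S = (-1 : ℂ) • g :=
    slash_S_of_apply fun z => by rw [h]; simp
  have h2 := serreDerivative_slash_equivariant (k := 2) hf (γ := S)
  rw [show (2 : ℤ) = ((2 : ℕ) : ℤ) by rfl, h1, serreDerivative_smul _ _ _ hg] at h2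
  rw [show (2 : ℤ) = ((2 : ℕ) : ℤ) by rfl, apply_S_of_slash (k := 4) h2]
  simp only [Pi.smul_apply, smul_eq_mul]
  ring

theorem serreDerivative_T {f g : ℍ → ℂ} (hf : MDiff f) (h : ∀ z : ℍ, f (T • z) = g z) (z : ℍ) :
    serreDerivative (2 : ℤ) f (T • z) = serreDerivative (2 : ℤ) g z := by
  have h1 : f ∣[(2 : ℤ)] T = g := slash_T_of_apply h
  have h2 := serreDerivative_slash_equivariant (k := 2) hf (γ := T)
  rw [h1] at h2
  rw [← h2, slash_T_apply]

theorem defect₂_S (z : ℍ) : defect₂ (S • z) = (z : ℂ) ^ 4 * -defect₄ z := by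
  rw [defect₂, defect₄, serreDerivative_S H₂_mdiff H₄_mdiff H₂_S, H₂_S, H₄_S]; ring

theorem defect₄_S (z : ℍ) : defect₄ (S • z) = (z : ℂ) ^ 4 * -defect₂ z := by
  rw [defect₂, defect₄, serreDerivative_S H₄_mdiff H₂_mdiff H₄_S, H₂_S, H₄_S]; ring

theorem defect₂_T (z : ℍ) : defect₂ (T • z) = -defect₂ z := by
  have h : serreDerivative (2 : ℤ) ((-1 : ℂ) • H₂) z = -serreDerivative (2 : ℤ) H₂ z := by
    rw [serreDerivative_smul _ _ _ H₂_mdiff, Pi.smul_apply, smul_eq_mul]; ring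
  rw [defect₂, defect₂, serreDerivative_T (g := (-1 : ℂ) • H₂) H₂_mdiff (fun z => by
    rw [H₂_T]; simp), h, H₂_T, H₄_T, jacobi_identity]
  ring

theorem defect₄_T (z : ℍ) : defect₄ (T • z) = defect₂ z + defect₄ z := by
  have h : serreDerivative (2 : ℤ) (H₂ + H₄) z =
      serreDerivative (2 : ℤ) H₂ z + serreDerivative (2 : ℤ) H₄ z := by
    rw [serreDerivative_add _ _ _ H₂_mdiff H₄_mdiff, Pi.add_apply]
  rw [defect₄, defect₄, defect₂, serreDerivative_T (g := H₂ + H₄) H₄_mdiff (fun z => by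
    rw [H₄_T, jacobi_identity]; rfl), h, H₂_T, H₄_T, jacobi_identity]
  ring

theorem defect₂_tendsto : Tendsto defect₂ atImInfty (𝓝 0) := by
  have := (D_H₂_tendsto.sub ((E2_tendsto.const_mul ((2 : ℤ) * 12⁻¹ : ℂ)).mul H₂_tendsto)).sub
    (((H₂_tendsto.mul H₂_tendsto).add ((H₂_tendsto.mul H₄_tendsto).const_mul 2)).mul_const (6⁻¹ : ℂ))
  norm_num at this
  refine this.congr fun z => ?_
  rw [defect₂, serreDerivative_apply]
  push_cast
  ring

theorem defect₄_tendsto : Tendsto defect₄ atImInfty (𝓝 0) := by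
  have := (D_H₄_tendsto.sub ((E2_tendsto.const_mul ((2 : ℤ) * 12⁻¹ : ℂ)).mul H₄_tendsto)).add
    ((((H₂_tendsto.mul H₄_tendsto).const_mul 2).add (H₄_tendsto.mul H₄_tendsto)).mul_const (6⁻¹ : ℂ))
  norm_num at this
  refine this.congr fun z => ?_
  rw [defect₄, serreDerivative_apply]
  push_cast
  ring

/-- Under S and T the pair (u, v) of defects transforms by the same matrices as (H₂, H₄), two
weights higher. The invariant quadratic form a² + ab + b², which gives E₄ on (H₂, H₄), therefore
yields two level-one forms vanishing at i∞: its polarization between (H₂, H₄) and (u, v) in weight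
6, and its value on (u, v) in weight 8. Both are zero, and where E₄ ≠ 0 this forces u = v = 0. The
imaginary axis, where E₄ > 0, is all that is needed later. -/
theorem defect_eq_zero (z : ℍ) (hz : E₄ z ≠ 0) : defect₂ z = 0 ∧ defect₄ z = 0 := by
  have h6 := congrFun (levelOne_eq_zero (k := 6) (by norm_num)
    (f := fun z => (2 * H₂ z + H₄ z) * defect₂ z + (H₂ z + 2 * H₄ z) * defect₄ z)
    ((((mdifferentiable_const.mul H₂_mdiff).add H₄_mdiff).mul defect₂_mdiff).add
      ((H₂_mdiff.add (mdifferentiable_const.mul H₄_mdiff)).mul defect₄_mdiff))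
    (slash_S_of_apply (k := 6) fun z => by rw [H₂_S, H₄_S, defect₂_S, defect₄_S]; ring)
    (slash_T_of_apply fun z => by rw [H₂_T, H₄_T, defect₂_T, defect₄_T, jacobi_identity]; ring)
    (by
      have := (((H₂_tendsto.const_mul 2).add H₄_tendsto).mul defect₂_tendsto).add
        ((H₂_tendsto.add (H₄_tendsto.const_mul 2)).mul defect₄_tendsto)
      simp only [mul_zero, add_zero] at this
      exact this)) z
  have h8 := congrFun (levelOne_eq_zero (k := 8) (by norm_num)
    (f := fun z => defect₂ z * defect₂ z + defect₂ z * defect₄ z + defect₄ z * defect₄ z)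
    (((defect₂_mdiff.mul defect₂_mdiff).add (defect₂_mdiff.mul defect₄_mdiff)).add
      (defect₄_mdiff.mul defect₄_mdiff))
    (slash_S_of_apply (k := 8) fun z => by rw [defect₂_S, defect₄_S]; ring)
    (slash_T_of_apply fun z => by rw [defect₂_T, defect₄_T]; ring)
    (by
      have := ((defect₂_tendsto.mul defect₂_tendsto).add (defect₂_tendsto.mul defect₄_tendsto)).add
        (defect₄_tendsto.mul defect₄_tendsto)
      simp only [mul_zero, add_zero] at this
      exact this)) z
  simp only [Pi.zero_apply] at h6 h8
  have hE := E4_eq_theta z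
  set a := H₂ z
  set b := H₄ z
  set u := defect₂ z
  set v := defect₄ z
  -- Multiply the weight 8 relation by (2a+b)² and substitute (2a+b)u = -(a+2b)v. The coefficient of
  -- v² becomes (a+2b)² - (a+2b)(2a+b) + (2a+b)² = 3(a² + ab + b²).
  have h4 : E₄ z * v ^ 2 = 0 := by
    rw [hE]
    linear_combination ((2 * a + b) ^ 2 / 3) * h8 -
      ((2 * a + b) * u + (2 * a + b) * v - (a + 2 * b) * v) / 3 * h6
  have h2 : E₄ z * u ^ 2 = 0 := by
    rw [hE]
    linear_combination ((a + 2 * b) ^ 2 / 3) * h8 -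
      ((a + 2 * b) * v + (a + 2 * b) * u - (2 * a + b) * u) / 3 * h6
  simpa [hz] using And.intro h2 h4

theorem D_H₂ (z : ℍ) (hz : E₄ z ≠ 0) :
    D H₂ z = (E₂ z * H₂ z + H₂ z ^ 2 + 2 * H₂ z * H₄ z) / 6 := by
  have := (defect_eq_zero z hz).1
  rw [defect₂, serreDerivative_apply] at this
  push_cast at this
  linear_combination this

theorem D_H₄ (z : ℍ) (hz : E₄ z ≠ 0) :
    D H₄ z = (E₂ z * H₄ z - 2 * H₂ z * H₄ z - H₄ z ^ 2) / 6 := by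
  have := (defect_eq_zero z hz).2
  rw [defect₄, serreDerivative_apply] at this
  push_cast at this
  linear_combination this

end Leech
end

/-! ### Superpositions of Gaussians: analyticity and Fourier transform -/

noncomputable section
namespace Leech

open Complex Filter MeasureTheory Set

/-- Integrals of exponentials depend analytically on the parameter. -/
theorem analyticAt_integral_cexp {c ζ : ℝ → ℂ} {S : Set ℝ} (hS : MeasurableSet S) {η : ℝ}
    (hη : 0 < η) (hζ : ∀ s ∈ S, 0 ≤ (ζ s).im)
    (hc : AEStronglyMeasurable c (volume.restrict S))
    (hζm : AEStronglyMeasurable ζ (volume.restrict S))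
    (hint : IntegrableOn (fun s => ‖c s‖ * Real.exp (η * ‖ζ s‖)) S) {ρ₀ : ℝ} (hρ : 0 ≤ ρ₀) :
    AnalyticAt ℂ (fun ρ : ℂ => ∫ s in S, c s * cexp (π * I * ρ * ζ s)) ρ₀ := by
  -- On a ball of this radius e^{πiρζ} grows at most like e^{η|ζ|/2}; the other half of the
  -- exponential moment pays for the factor ζ in the derivative.
  set r := η / (2 * π)
  have hr : 0 < r := by positivity
  have hnorm : ∀ ρ ∈ Metric.ball (ρ₀ : ℂ) r, ∀ s ∈ S,
      ‖cexp (π * I * ρ * ζ s)‖ ≤ Real.exp (η / 2 * ‖ζ s‖) := by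
    intro ρ hρb s hs
    rw [Complex.norm_exp]
    refine Real.exp_le_exp.mpr ?_
    have h1 : (π * I * ρ * ζ s : ℂ) = (π * (ρ - ρ₀) * (I * ζ s)) + (((π * ρ₀ : ℝ) : ℂ) * (I * ζ s)) := by
      push_cast; ring
    have h2 : (((π * ρ₀ : ℝ) : ℂ) * (I * ζ s)).re ≤ 0 := by
      rw [Complex.re_ofReal_mul]
      have := hζ s hs
      simp
      positivity
    have h3 : (π * (ρ - ρ₀) * (I * ζ s) : ℂ).re ≤ η / 2 * ‖ζ s‖ := by
      refine (Complex.re_le_norm _).trans ?_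
      rw [norm_mul, norm_mul, norm_mul, Complex.norm_I, one_mul, Complex.norm_real,
        Real.norm_of_nonneg Real.pi_pos.le]
      have h4 : ‖ρ - ρ₀‖ ≤ r := by
        rw [← dist_eq_norm]; exact (Metric.mem_ball.mp hρb).le
      have h5 : π * ‖ρ - ρ₀‖ ≤ η / 2 := by
        calc π * ‖ρ - ρ₀‖ ≤ π * r := by gcongr
          _ = η / 2 := by simp only [r]; field_simp
      gcongr
    rw [h1, Complex.add_re]
    linarith
  have hmeas : ∀ ρ : ℂ, AEStronglyMeasurable (fun s => c s * cexp (π * I * ρ * ζ s))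
      (volume.restrict S) := fun ρ =>
    hc.mul (Complex.continuous_exp.comp_aestronglyMeasurable (hζm.const_mul _))
  have hint2 : Integrable (fun s => 2 * π / η * (‖c s‖ * Real.exp (η * ‖ζ s‖)))
      (volume.restrict S) := hint.const_mul _
  have hd : DifferentiableOn ℂ (fun ρ : ℂ => ∫ s in S, c s * cexp (π * I * ρ * ζ s))
      (Metric.ball (ρ₀ : ℂ) r) := by
    intro ρ hρb
    refine DifferentiableAt.differentiableWithinAt ?_
    refine (hasDerivAt_integral_of_dominated_loc_of_deriv_le
      (F' := fun ρ s => c s * (cexp (π * I * ρ * ζ s) * (π * I * ζ s)))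
      (Metric.isOpen_ball.mem_nhds hρb) (Eventually.of_forall hmeas) ?_ ?_ ?_ hint2 ?_).2.differentiableAt
    · refine Integrable.mono hint (hmeas ρ) ?_
      refine (ae_restrict_iff' hS).mpr (Eventually.of_forall fun s hs => ?_)
      rw [norm_mul, norm_mul, norm_norm, Real.norm_of_nonneg (Real.exp_pos _).le]
      gcongr
      refine (hnorm ρ hρb s hs).trans (Real.exp_le_exp.mpr ?_)
      have := norm_nonneg (ζ s)
      nlinarith
    · exact hc.mul ((Complex.continuous_exp.comp_aestronglyMeasurable (hζm.const_mul _)).mul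
        (hζm.const_mul _))
    · refine (ae_restrict_iff' hS).mpr (Eventually.of_forall fun s hs ρ' hρ' => ?_)
      rw [norm_mul, norm_mul, norm_mul, norm_mul, Complex.norm_I, mul_one, Complex.norm_real,
        Real.norm_of_nonneg Real.pi_pos.le]
      have h1 := hnorm ρ' hρ' s hs
      have h2 : η / 2 * ‖ζ s‖ ≤ Real.exp (η / 2 * ‖ζ s‖) := by
        linarith [Real.add_one_le_exp (η / 2 * ‖ζ s‖)]
      have h3 : Real.exp (η * ‖ζ s‖) = Real.exp (η / 2 * ‖ζ s‖) * Real.exp (η / 2 * ‖ζ s‖) := by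
        rw [← Real.exp_add]; ring_nf
      have h4 : π * ‖ζ s‖ = 2 * π / η * (η / 2 * ‖ζ s‖) := by field_simp
      rw [h3, h4]
      calc ‖c s‖ * (‖cexp (π * I * ρ' * ζ s)‖ * (2 * π / η * (η / 2 * ‖ζ s‖)))
          ≤ ‖c s‖ * (Real.exp (η / 2 * ‖ζ s‖) * (2 * π / η * Real.exp (η / 2 * ‖ζ s‖))) := by
            gcongr
        _ = _ := by ring
    · refine Eventually.of_forall fun s ρ' _ => ?_
      have h1 : HasDerivAt (fun ρ : ℂ => π * I * ρ * ζ s) (π * I * ζ s) ρ' := by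
        simpa using ((hasDerivAt_id ρ').const_mul (π * I)).mul_const (ζ s)
      exact (h1.cexp).const_mul (c s)
  exact hd.analyticAt (Metric.isOpen_ball.mem_nhds (Metric.mem_ball_self hr))

/-- The radial space in which the Fourier transform is taken. -/
abbrev E24 : Type := EuclideanSpace ℝ (Fin 24)

/-- The dimension is a multiple of 8, so the factor (i/ζ)^{24/2} carries no root of unity. -/
theorem fourier_gaussian {ζ : ℂ} (hζ : 0 < ζ.im) (w : E24) :
    𝓕 (fun x : E24 => cexp (π * I * (‖x‖ : ℂ) ^ 2 * ζ)) w =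
      (ζ ^ 12)⁻¹ * cexp (π * I * (‖w‖ : ℂ) ^ 2 * (-1 / ζ)) := by
  have hζ0 : ζ ≠ 0 := by rintro rfl; simp at hζ
  have hpi : (π : ℂ) ≠ 0 := by exact_mod_cast Real.pi_ne_zero
  have hb : 0 < (-π * I * ζ : ℂ).re := by
    simp; positivity
  have h := fourier_gaussian_innerProductSpace hb w
  have h1 : (fun x : E24 => cexp (π * I * (‖x‖ : ℂ) ^ 2 * ζ)) =
      fun v : E24 => cexp (-(-π * I * ζ) * (‖v‖ : ℂ) ^ 2) := by
    ext v; congr 1; ring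
  rw [h1, h]
  have hI := I_ne_zero
  congr 1
  · have : ((Module.finrank ℝ E24 : ℂ) / 2) = (12 : ℕ) := by simp; norm_num
    rw [this, Complex.cpow_natCast]
    have h2 : (π / (-π * I * ζ) : ℂ) = I / ζ := by
      field_simp; rw [I_sq]
    rw [h2, div_pow, show I ^ 12 = (I ^ 4) ^ 3 by ring, I_pow_four]; simp
  · congr 1
    field_simp
    rw [I_sq]; ring

theorem integrable_gaussian {ζ : ℂ} (hζ : 0 < ζ.im) :
    Integrable (fun x : E24 => cexp (π * I * (‖x‖ : ℂ) ^ 2 * ζ)) := by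
  have hb : 0 < (-π * I * ζ : ℂ).re := by
    simp; positivity
  have h := GaussianFourier.integrable_cexp_neg_mul_sq_norm_add hb 0 (0 : E24)
  refine h.congr (Eventually.of_forall fun v => ?_)
  simp only
  congr 1; simp; ring

theorem integral_norm_gaussian {ζ : ℂ} (hζ : 0 < ζ.im) :
    ∫ x : E24, ‖cexp (π * I * (‖x‖ : ℂ) ^ 2 * ζ)‖ = (ζ.im ^ 12)⁻¹ := by
  have h := GaussianFourier.integral_rexp_neg_mul_sq_norm (V := E24) (b := π * ζ.im) (by positivity)
  have h1 : ∀ x : E24, ‖cexp (π * I * (‖x‖ : ℂ) ^ 2 * ζ)‖ = Real.exp (-(π * ζ.im) * ‖x‖ ^ 2) := by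
    intro x
    rw [Complex.norm_exp]
    congr 1
    have : (π * I * (‖x‖ : ℂ) ^ 2 * ζ : ℂ) = ((π * ‖x‖ ^ 2 : ℝ) : ℂ) * (I * ζ) := by
      push_cast; ring
    rw [this, Complex.re_ofReal_mul]
    simp; ring
  simp only [h1, h]
  have : ((Module.finrank ℝ E24 : ℝ) / 2) = (12 : ℕ) := by simp; norm_num
  rw [this, Real.rpow_natCast, ← inv_pow]
  congr 1
  field_simp

section family

variable {c ζ : ℝ → ℂ} {S : Set ℝ}

/-- The L¹ norm of a Gaussian in dimension 24 is (Im ζ)^{-12}, so `hint` is precisely absolute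
integrability on the product, as Fubini requires. -/
theorem integrable_gaussian_family (hS : MeasurableSet S) (hζ : ∀ s ∈ S, 0 < (ζ s).im)
    (hc : AEStronglyMeasurable c (volume.restrict S))
    (hζm : AEStronglyMeasurable ζ (volume.restrict S))
    (hint : IntegrableOn (fun s => ‖c s‖ * ((ζ s).im ^ 12)⁻¹) S) :
    Integrable (fun p : E24 × ℝ => c p.2 * cexp (π * I * (‖p.1‖ : ℂ) ^ 2 * ζ p.2))
      ((volume : Measure E24).prod (volume.restrict S)) := by
  have hm : AEStronglyMeasurable (fun p : E24 × ℝ => c p.2 * cexp (π * I * (‖p.1‖ : ℂ) ^ 2 * ζ p.2))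
      ((volume : Measure E24).prod (volume.restrict S)) := by
    refine (hc.comp_snd (μ := (volume : Measure E24))).mul
      (Complex.continuous_exp.comp_aestronglyMeasurable
        (AEStronglyMeasurable.mul (Continuous.aestronglyMeasurable (by fun_prop))
          (hζm.comp_snd (μ := (volume : Measure E24)))))
  rw [integrable_prod_iff' hm]
  constructor
  · refine (ae_restrict_iff' hS).mpr (Eventually.of_forall fun s hs => ?_)
    exact (integrable_gaussian (hζ s hs)).const_mul (c s)
  · refine hint.congr ?_
    refine (ae_restrict_iff' hS).mpr (Eventually.of_forall fun s hs => ?_)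
    simp only [norm_mul (c s)]
    rw [integral_const_mul, integral_norm_gaussian (hζ s hs)]

theorem integrable_integral_gaussian (hS : MeasurableSet S) (hζ : ∀ s ∈ S, 0 < (ζ s).im)
    (hc : AEStronglyMeasurable c (volume.restrict S))
    (hζm : AEStronglyMeasurable ζ (volume.restrict S))
    (hint : IntegrableOn (fun s => ‖c s‖ * ((ζ s).im ^ 12)⁻¹) S) :
    Integrable (fun x : E24 => ∫ s in S, c s * cexp (π * I * (‖x‖ : ℂ) ^ 2 * ζ s)) :=
  (integrable_gaussian_family hS hζ hc hζm hint).integral_prod_left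

theorem fourier_integral_gaussian (hS : MeasurableSet S) (hζ : ∀ s ∈ S, 0 < (ζ s).im)
    (hc : AEStronglyMeasurable c (volume.restrict S))
    (hζm : AEStronglyMeasurable ζ (volume.restrict S))
    (hint : IntegrableOn (fun s => ‖c s‖ * ((ζ s).im ^ 12)⁻¹) S) (y : E24) :
    𝓕 (fun x : E24 => ∫ s in S, c s * cexp (π * I * (‖x‖ : ℂ) ^ 2 * ζ s)) y =
      ∫ s in S, c s * (((ζ s) ^ 12)⁻¹ * cexp (π * I * (‖y‖ : ℂ) ^ 2 * (-1 / ζ s))) := by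
  have hI := integrable_gaussian_family hS hζ hc hζm hint
  have hI2 : Integrable (fun p : E24 × ℝ => Real.fourierChar (-(inner ℝ p.1 y)) •
      (c p.2 * cexp (π * I * (‖p.1‖ : ℂ) ^ 2 * ζ p.2)))
      ((volume : Measure E24).prod (volume.restrict S)) := by
    refine hI.mono ?_ (Eventually.of_forall fun p => by rw [Circle.norm_smul])
    refine AEStronglyMeasurable.smul (𝕜 := Circle) ?_ hI.1
    exact (Continuous.aestronglyMeasurable (by fun_prop))
  rw [Real.fourier_eq]
  simp_rw [Circle.smul_def, ← integral_smul, ← Circle.smul_def]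
  rw [integral_integral_swap hI2]
  refine setIntegral_congr_fun hS fun s hs => ?_
  have h1 := fourier_gaussian (hζ s hs) y
  rw [Real.fourier_eq] at h1
  simp only [← h1, ← integral_const_mul]
  congr 1
  ext x
  rw [Circle.smul_def, Circle.smul_def, smul_eq_mul, smul_eq_mul]; ring

end family

end Leech
end

/-! ### Cauchy's theorem for vertical rays -/

noncomputable section
namespace Leech

open Complex Filter MeasureTheory Set

theorem vertical_im (σ t : ℝ) : ((σ : ℂ) + I * t).im = t := by simp

theorem vertical_re (σ t : ℝ) : ((σ : ℂ) + I * t).re = σ := by simp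

theorem continuousOn_vertical {h : ℂ → ℂ} (hh : ContinuousOn h {z | 0 < z.im}) (σ : ℝ) {s : ℝ}
    (hs : 0 < s) : ContinuousOn (fun t : ℝ => h (σ + I * t)) (Ici s) :=
  hh.comp (by fun_prop) fun t ht => by
    simpa using hs.trans_le ht

theorem integrableOn_vertical {h : ℂ → ℂ} (hh : ContinuousOn h {z | 0 < z.im}) {σ s C c Y : ℝ}
    (hs : 0 < s) (hc : 0 < c)
    (hb : ∀ z : ℂ, z.re = σ → Y ≤ z.im → ‖h z‖ ≤ C * Real.exp (-c * z.im)) :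
    IntegrableOn (fun t : ℝ => h (σ + I * t)) (Ioi s) := by
  refine (((continuousOn_vertical hh σ hs).locallyIntegrableOn measurableSet_Ici).integrableOn_of_isBigO_atTop
    (g := fun t => Real.exp (-c * t)) ?_ ⟨Ioi 0, Ioi_mem_atTop 0, exp_neg_integrableOn_Ioi 0 hc⟩).mono_set
    Ioi_subset_Ici_self
  refine Asymptotics.IsBigO.of_bound C ?_
  filter_upwards [eventually_ge_atTop Y] with t ht
  rw [Real.norm_of_nonneg (Real.exp_pos _).le]
  simpa using hb (σ + I * t) (vertical_re σ t) (by rw [vertical_im]; exact ht)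

/-- Along vertical rays, a primitive of an exponentially decaying function has a limit. -/
theorem tendsto_primitive_vertical {G h : ℂ → ℂ} (hG : ∀ z : ℂ, 0 < z.im → HasDerivAt G (h z) z)
    (hh : ContinuousOn h {z | 0 < z.im}) {σ s C c Y : ℝ} (hs : 0 < s) (hc : 0 < c)
    (hb : ∀ z : ℂ, z.re = σ → Y ≤ z.im → ‖h z‖ ≤ C * Real.exp (-c * z.im)) :
    Tendsto (fun y : ℝ => G (σ + I * y)) atTop
      (𝓝 (G (σ + I * s) + I * ∫ t in Ioi s, h (σ + I * t))) := by
  have hint := integrableOn_vertical hh hs hc hb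
  have h1 := (intervalIntegral_tendsto_integral_Ioi s (hint.const_mul I) tendsto_id).const_add
    (G (σ + I * s))
  rw [integral_const_mul] at h1
  refine h1.congr' ?_
  filter_upwards [eventually_ge_atTop s] with y hy
  have h2 : ∫ t in s..y, I * h (σ + I * t) = G (σ + I * y) - G (σ + I * s) := by
    refine intervalIntegral.integral_eq_sub_of_hasDerivAt (f := fun t : ℝ => G (σ + I * t)) ?_ ?_
    · intro t ht
      rw [uIcc_of_le hy] at ht
      have h3 : HasDerivAt (fun t : ℝ => (σ : ℂ) + I * t) I t := by
        simpa using ((hasDerivAt_id t).ofReal_comp.const_mul I).const_add (σ : ℂ)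
      have h4 := hG (σ + I * t) (by rw [vertical_im]; exact hs.trans_le ht.1)
      rw [mul_comm]
      exact h4.comp t h3
    · refine ContinuousOn.intervalIntegrable ?_
      rw [uIcc_of_le hy]
      exact ((continuousOn_vertical hh σ hs).mono Icc_subset_Ici_self).const_mul I |>.congr
        fun _ _ => rfl
  simp only [id, h2]; ring

/-- Cauchy's theorem for two vertical rays joined at `i∞`. -/
theorem vertical_shift {G h : ℂ → ℂ} (hG : ∀ z : ℂ, 0 < z.im → HasDerivAt G (h z) z)
    (hh : ContinuousOn h {z | 0 < z.im}) {σ₁ σ₂ s₁ s₂ C c Y : ℝ} (hs₁ : 0 < s₁) (hs₂ : 0 < s₂)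
    (hc : 0 < c)
    (hb : ∀ z : ℂ, z.re ∈ uIcc σ₁ σ₂ → Y ≤ z.im → ‖h z‖ ≤ C * Real.exp (-c * z.im)) :
    G (σ₁ + I * s₁) + I * ∫ t in Ioi s₁, h (σ₁ + I * t) =
      G (σ₂ + I * s₂) + I * ∫ t in Ioi s₂, h (σ₂ + I * t) := by
  have h1 := tendsto_primitive_vertical hG hh hs₁ hc
    (fun z hz hY => hb z (hz ▸ left_mem_uIcc) hY)
  have h2 := tendsto_primitive_vertical hG hh hs₂ hc
    (fun z hz hY => hb z (hz ▸ right_mem_uIcc) hY)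
  -- The horizontal segment at height y contributes at most its length times C e^{-cy}, so the
  -- limits of the primitive along both rays agree.
  have h3 : Tendsto (fun y : ℝ => G (σ₁ + I * y) - G (σ₂ + I * y)) atTop (𝓝 0) := by
    have h4 : Tendsto (fun y : ℝ => C * Real.exp (-c * y) * |σ₁ - σ₂|) atTop (𝓝 0) := by
      have : Tendsto (fun y : ℝ => Real.exp (-c * y)) atTop (𝓝 0) := by
        refine Real.tendsto_exp_atBot.comp ?_
        exact (tendsto_const_mul_atBot_of_neg (by linarith)).mpr tendsto_id
      simpa using (this.const_mul C).mul_const |σ₁ - σ₂|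
    refine squeeze_zero_norm' ?_ h4
    filter_upwards [eventually_ge_atTop Y, eventually_gt_atTop 0] with y hy hy0
    have h5 : Convex ℝ {z : ℂ | z.re ∈ uIcc σ₁ σ₂ ∧ z.im = y} := by
      exact ((convex_uIcc σ₁ σ₂).linear_preimage Complex.reLm).inter
        ((convex_singleton y).linear_preimage Complex.imLm)
    have h6 := h5.norm_image_sub_le_of_norm_hasDerivWithin_le (f := G) (f' := h)
      (s := {z : ℂ | z.re ∈ uIcc σ₁ σ₂ ∧ z.im = y})
      (C := C * Real.exp (-c * y)) (x := σ₂ + I * y) (y := σ₁ + I * y)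
      (fun z hz => (hG z (hz.2 ▸ hy0)).hasDerivWithinAt)
      (fun z hz => by have := hb z hz.1 (hz.2 ▸ hy); rwa [hz.2] at this)
      ⟨by simp, by simp⟩ ⟨by simp, by simp⟩
    refine h6.trans (le_of_eq ?_)
    congr 1
    rw [add_sub_add_right_eq_sub, ← ofReal_sub, norm_real, Real.norm_eq_abs]
  have h7 := tendsto_nhds_unique (h1.sub h2) h3
  exact sub_eq_zero.mp h7

/-- The upper half plane as a subset of `ℂ` is convex and open, so holomorphic functions on it
have primitives. -/
theorem exists_primitive {h : ℂ → ℂ} (hh : DifferentiableOn ℂ h {z | 0 < z.im}) :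
    ∃ G : ℂ → ℂ, ∀ z : ℂ, 0 < z.im → HasDerivAt G (h z) z := by
  have ho : IsOpen {z : ℂ | 0 < z.im} := isOpen_lt continuous_const continuous_im
  obtain ⟨G, hG⟩ := (convex_halfSpace_im_gt 0).exists_forall_hasDerivWithinAt
    (f := h) hh
  exact ⟨G, fun z hz => (hG z hz).hasDerivAt (ho.mem_nhds hz)⟩

end Leech
end

/-! ### Contour kernels and the everywhere analytic contour integral -/

noncomputable section
namespace Leech

open Complex Filter MeasureTheory Set

/-- The data of a contour kernel: `k` is integrated along the imaginary axis against Gaussians,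
`g` is its transform under `z ↦ -1/z` (with weight `-10`), and `ε = ±1` is the Fourier eigenvalue. -/
structure IsKernel (k g : ℂ → ℂ) (ε : ℂ) : Prop where
  sq_eq : ε * ε = 1
  diff_k : DifferentiableOn ℂ k {z | 0 < z.im}
  diff_g : DifferentiableOn ℂ g {z | 0 < z.im}
  k_inv : ∀ z : ℂ, 0 < z.im → k (-1 / z) = g z * (z ^ 10)⁻¹
  g_add_one : ∀ z : ℂ, 0 < z.im → g (z + 1) = ε * g z
  -- This is the combination that appears on the common ray from i to i∞. It decays even though k
  -- may grow like e^{4π Im z}; that growth is the reason for the restriction r > 2.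
  k_diff : ∀ z : ℂ, 0 < z.im → k (z + 1) + k (z - 1) - 2 * k z = 2 * ε * g z
  bound_g : ∃ C Y : ℝ, ∀ z : ℂ, |z.re| ≤ 1 → Y ≤ z.im → ‖g z‖ ≤ C * Real.exp (-π * z.im)
  bound_k : ∃ C Y : ℝ, ∀ z : ℂ, |z.re| ≤ 1 → Y ≤ z.im → ‖k z‖ ≤ C * Real.exp (4 * π * z.im)

/-- An exponential bound near `i∞` in a vertical strip extends down to any positive height. -/
theorem exists_bound_strip {h : ℂ → ℂ} (hh : ContinuousOn h {z | 0 < z.im}) {c s : ℝ} (hs : 0 < s)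
    (hb : ∃ C Y : ℝ, ∀ z : ℂ, |z.re| ≤ 1 → Y ≤ z.im → ‖h z‖ ≤ C * Real.exp (c * z.im)) :
    ∃ C : ℝ, 0 ≤ C ∧ ∀ z : ℂ, |z.re| ≤ 1 → s ≤ z.im → ‖h z‖ ≤ C * Real.exp (c * z.im) := by
  obtain ⟨C, Y, hC⟩ := hb
  have hK : IsCompact (Icc (-1 : ℝ) 1 ×ℂ Icc s Y) := isCompact_Icc.reProdIm isCompact_Icc
  have hcont : ContinuousOn (fun z : ℂ => h z * Real.exp (-c * z.im)) (Icc (-1 : ℝ) 1 ×ℂ Icc s Y) := by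
    refine (hh.mono fun z hz => ?_).mul (Continuous.continuousOn (by fun_prop))
    exact hs.trans_le (Complex.mem_reProdIm.mp hz).2.1
  obtain ⟨B, hB⟩ := hK.exists_bound_of_continuousOn hcont
  refine ⟨max (max B C) 0, le_max_right _ _, fun z hz hzs => ?_⟩
  rcases le_total Y z.im with hY | hY
  · refine (hC z hz hY).trans ?_
    gcongr
    exact (le_max_right _ _).trans (le_max_left _ _)
  · have h1 := hB z (Complex.mem_reProdIm.mpr ⟨abs_le.mp hz, hzs, hY⟩)
    rw [norm_mul, norm_real, Real.norm_of_nonneg (Real.exp_pos _).le] at h1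
    have h2 : ‖h z‖ = ‖h z‖ * Real.exp (-c * z.im) * Real.exp (c * z.im) := by
      rw [mul_assoc, ← Real.exp_add]; simp
    rw [h2]
    gcongr
    exact h1.trans ((le_max_left _ _).trans (le_max_left _ _))

/-- The contribution of the arc `z = a - 1/u`, `u = σ + is`, `s > s₀`. -/
def cuspIntegral (g : ℂ → ℂ) (σ a s₀ : ℝ) (ρ : ℂ) : ℂ :=
  ∫ t in Ioi s₀, (g (σ + I * t) * (((σ : ℂ) + I * t) ^ 12)⁻¹) *
    cexp (π * I * ρ * (a - 1 / (σ + I * t)))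

/-- The contribution of the ray from `i` to `i∞`. -/
def rayIntegral (g : ℂ → ℂ) (ρ : ℂ) : ℂ :=
  ∫ t in Ioi (1 : ℝ), g ((0 : ℝ) + I * t) * cexp (π * I * ρ * ((0 : ℝ) + I * t))

/-- The everywhere analytic form of the contour integral. -/
def contourIntegral (g : ℂ → ℂ) (ε : ℂ) (ρ : ℂ) : ℂ :=
  -- For a = ±1 the image of Re u = a/2 under u ↦ a - 1/u lies on the unit circle. It starts at i
  -- for Im u = 1/2 and ends at the cusp a; the minus signs reverse this direction. With dz = du/u²
  -- and k(-1/u) = g(u)u^{-10} the weight becomes u^{-12}.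
  -I * cuspIntegral g (-1 / 2 : ℝ) (-1 : ℝ) (1 / 2) ρ - I * cuspIntegral g (1 / 2 : ℝ) (1 : ℝ) (1 / 2) ρ
    + 2 * I * cuspIntegral g (0 : ℝ) (0 : ℝ) 1 ρ + 2 * ε * I * rayIntegral g ρ

theorem vertical_ne_zero (σ : ℝ) {t : ℝ} (ht : 0 < t) : (σ : ℂ) + I * t ≠ 0 := by
  intro h
  have := congrArg Complex.im h
  rw [vertical_im] at this
  simp at this; linarith

theorem im_sub_inv (a : ℝ) (u : ℂ) : ((a : ℂ) - 1 / u).im = u.im / normSq u := by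
  simp [Complex.inv_im]; ring

theorem norm_vertical_le {σ t : ℝ} (hσ : |σ| ≤ 1) (ht : 0 < t) : ‖(σ : ℂ) + I * t‖ ≤ 1 + t := by
  refine (norm_add_le _ _).trans ?_
  simpa [abs_of_pos ht] using hσ

theorem le_norm_vertical (σ : ℝ) {t : ℝ} (ht : 0 < t) : t ≤ ‖(σ : ℂ) + I * t‖ := by
  have := Complex.abs_im_le_norm ((σ : ℂ) + I * t)
  rwa [vertical_im, abs_of_pos ht] at this

section

variable {k g : ℂ → ℂ} {ε : ℂ}

theorem IsKernel.exists_bound_g (h : IsKernel k g ε) : ∃ C : ℝ, 0 ≤ C ∧ ∀ z : ℂ, |z.re| ≤ 1 → 1 / 2 ≤ z.im →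
    ‖g z‖ ≤ C * Real.exp (-π * z.im) :=
  exists_bound_strip h.diff_g.continuousOn (by norm_num) h.bound_g

theorem IsKernel.exists_bound_k (h : IsKernel k g ε) : ∃ C : ℝ, 0 ≤ C ∧ ∀ z : ℂ, |z.re| ≤ 1 → 1 / 2 ≤ z.im →
    ‖k z‖ ≤ C * Real.exp (4 * π * z.im) :=
  exists_bound_strip h.diff_k.continuousOn (by norm_num) h.bound_k

theorem IsKernel.continuousOn_coeff (h : IsKernel k g ε) (σ : ℝ) {s₀ : ℝ} (hs : 0 < s₀) : ContinuousOn
    (fun t : ℝ => g (σ + I * t) * (((σ : ℂ) + I * t) ^ 12)⁻¹) (Ioi s₀) := by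
  refine ((continuousOn_vertical h.diff_g.continuousOn σ hs).mono Ioi_subset_Ici_self).mul ?_
  refine ContinuousOn.inv₀ (by fun_prop) fun t ht => pow_ne_zero _ (vertical_ne_zero σ (hs.trans ht))

theorem continuousOn_arc (a σ : ℝ) {s₀ : ℝ} (hs : 0 < s₀) :
    ContinuousOn (fun t : ℝ => (a : ℂ) - 1 / (σ + I * t)) (Ioi s₀) := by
  refine continuousOn_const.sub (ContinuousOn.div (by fun_prop) (by fun_prop)
    fun t ht => vertical_ne_zero σ (hs.trans ht))

end

end Leech
end

/-! ### Analyticity and absolute integrability of the contour pieces -/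

noncomputable section
namespace Leech

open Complex Filter MeasureTheory Set

section

variable {k g : ℂ → ℂ} {ε : ℂ}

theorem norm_coeff_le {C : ℝ} (hC : ∀ z : ℂ, |z.re| ≤ 1 → 1 / 2 ≤ z.im →
    ‖g z‖ ≤ C * Real.exp (-π * z.im)) {σ t : ℝ} (hσ : |σ| ≤ 1) (ht : 1 / 2 ≤ t) :
    ‖g (σ + I * t)‖ ≤ C * Real.exp (-π * t) := by
  simpa using hC (σ + I * t) (by simpa using hσ) (by simpa using ht)

theorem integrableOn_of_norm_le {E : Type*} [NormedAddCommGroup E] {f : ℝ → E} {s₀ C c : ℝ}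
    (hc : 0 < c) (hm : AEStronglyMeasurable f (volume.restrict (Ioi s₀)))
    (hb : ∀ t ∈ Ioi s₀, ‖f t‖ ≤ C * Real.exp (-c * t)) : IntegrableOn f (Ioi s₀) := by
  have h1 : IntegrableOn (fun t => C * Real.exp (-c * t)) (Ioi s₀) :=
    (exp_neg_integrableOn_Ioi s₀ hc).const_mul C
  exact h1.mono' hm ((ae_restrict_iff' measurableSet_Ioi).mpr (Eventually.of_forall hb))

/-- The arc is bounded and g decays exponentially in t, so every exponential moment is finite. -/
theorem IsKernel.cusp_analytic (h : IsKernel k g ε) {σ a s₀ : ℝ} (hσ : |σ| ≤ 1) (hs : 1 / 2 ≤ s₀)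
    {ρ₀ : ℝ} (hρ : 0 ≤ ρ₀) : AnalyticAt ℂ (cuspIntegral g σ a s₀) ρ₀ := by
  obtain ⟨C, hC0, hC⟩ := h.exists_bound_g
  have hs0 : 0 < s₀ := by linarith
  have hc := h.continuousOn_coeff σ hs0
  have hζ := continuousOn_arc a σ hs0
  refine analyticAt_integral_cexp (η := 1) measurableSet_Ioi one_pos (fun t ht => ?_)
    (hc.aestronglyMeasurable measurableSet_Ioi) (hζ.aestronglyMeasurable measurableSet_Ioi) ?_ hρ
  · rw [im_sub_inv, vertical_im]
    exact div_nonneg (hs0.trans ht).le (normSq_nonneg _)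
  · refine integrableOn_of_norm_le (c := π) (C := C * 2 ^ 12 * Real.exp (|a| + 2)) Real.pi_pos
      (ContinuousOn.aestronglyMeasurable (by fun_prop) measurableSet_Ioi) fun t ht => ?_
    have ht2 : 1 / 2 ≤ t := hs.trans (le_of_lt ht)
    have ht0 : 0 < t := by linarith
    have h1 := norm_coeff_le hC hσ ht2
    have h2 : 1 / 2 ≤ ‖(σ : ℂ) + I * t‖ := ht2.trans (le_norm_vertical σ ht0)
    have h3 : ‖(σ : ℂ) + I * t‖⁻¹ ≤ 2 := by
      rw [inv_le_comm₀ (by linarith) (by norm_num)]; linarith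
    rw [norm_mul, norm_norm, norm_mul, norm_inv, norm_pow, Real.norm_of_nonneg (Real.exp_pos _).le,
      ← inv_pow]
    have h4 : ‖(a : ℂ) - 1 / (σ + I * t)‖ ≤ |a| + 2 := by
      refine (norm_sub_le _ _).trans ?_
      rw [norm_real, Real.norm_eq_abs, one_div, norm_inv]
      linarith
    calc ‖g (σ + I * t)‖ * ‖(σ : ℂ) + I * t‖⁻¹ ^ 12 * Real.exp (1 * ‖(a : ℂ) - 1 / (σ + I * t)‖)
        ≤ (C * Real.exp (-π * t)) * 2 ^ 12 * Real.exp (|a| + 2) := by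
          gcongr
          rw [one_mul]; exact h4
      _ = _ := by ring

theorem IsKernel.ray_analytic (h : IsKernel k g ε) {ρ₀ : ℝ} (hρ : 0 ≤ ρ₀) : AnalyticAt ℂ (rayIntegral g) ρ₀ := by
  obtain ⟨C, hC0, hC⟩ := h.exists_bound_g
  have hc : ContinuousOn (fun t : ℝ => g ((0 : ℝ) + I * t)) (Ioi 1) :=
    (continuousOn_vertical h.diff_g.continuousOn 0 one_pos).mono Ioi_subset_Ici_self
  refine analyticAt_integral_cexp (η := 1) measurableSet_Ioi one_pos (fun t ht => ?_)
    (hc.aestronglyMeasurable measurableSet_Ioi)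
    (Continuous.aestronglyMeasurable (by fun_prop)) ?_ hρ
  · rw [vertical_im]; exact (one_pos.trans ht).le
  -- On the ray ζ = it is unbounded, so the moment e^{η|ζ|} must be beaten by the decay e^{-πt} of
  -- g; η = 1 < π suffices.
  · refine integrableOn_of_norm_le (c := π - 1) (C := C * Real.exp 1) (by linarith [Real.pi_gt_three])
      (ContinuousOn.aestronglyMeasurable (hc.norm.mul (Continuous.continuousOn (by fun_prop)))
        measurableSet_Ioi) fun t ht => ?_
    have ht1 : 1 < t := ht
    have h1 := norm_coeff_le hC (σ := 0) (t := t) (by simp) (by linarith)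
    rw [norm_mul, norm_norm, Real.norm_of_nonneg (Real.exp_pos _).le]
    calc ‖g ((0 : ℝ) + I * t)‖ * Real.exp (1 * ‖((0 : ℝ) : ℂ) + I * t‖)
        ≤ (C * Real.exp (-π * t)) * Real.exp (1 + t) := by
          gcongr
          rw [one_mul]; exact norm_vertical_le (by simp) (by linarith)
      _ = _ := by rw [mul_assoc, mul_assoc, ← Real.exp_add, ← Real.exp_add]; ring_nf

theorem IsKernel.contour_analytic (h : IsKernel k g ε) {ρ₀ : ℝ} (hρ : 0 ≤ ρ₀) :
    AnalyticAt ℂ (contourIntegral g ε) ρ₀ := by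
  have h1 := h.cusp_analytic (σ := -1 / 2) (a := -1) (s₀ := 1 / 2) (by norm_num [abs_div]) le_rfl hρ
  have h2 := h.cusp_analytic (σ := 1 / 2) (a := 1) (s₀ := 1 / 2) (by norm_num [abs_div]) le_rfl hρ
  have h3 := h.cusp_analytic (σ := 0) (a := 0) (s₀ := 1) (by norm_num) (by norm_num) hρ
  have h4 := h.ray_analytic hρ
  exact (((analyticAt_const.mul h1).sub (analyticAt_const.mul h2)).add
    (analyticAt_const.mul h3)).add (analyticAt_const.mul h4)

/-- The points ζ approach the real axis, but Im ζ = t/|u|², so the two twelfth powers combine to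
(|u|/t)^{12}. Since |u| ≤ 1 + t and t ≥ 1/2, this is at most 3^{12}. -/
theorem IsKernel.cusp_integrable (h : IsKernel k g ε) {σ a s₀ : ℝ} (hσ : |σ| ≤ 1) (hs : 1 / 2 ≤ s₀) :
    IntegrableOn (fun t : ℝ => ‖g (σ + I * t) * (((σ : ℂ) + I * t) ^ 12)⁻¹‖ *
      (((a : ℂ) - 1 / (σ + I * t)).im ^ 12)⁻¹) (Ioi s₀) := by
  obtain ⟨C, hC0, hC⟩ := h.exists_bound_g
  have hs0 : 0 < s₀ := by linarith
  have hc := h.continuousOn_coeff σ hs0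
  have hζ := continuousOn_arc a σ hs0
  have hpos : ∀ t ∈ Ioi s₀, 0 < ((a : ℂ) - 1 / (σ + I * t)).im := fun t ht => by
    have ht0 : 0 < t := hs0.trans ht
    rw [im_sub_inv, vertical_im]
    exact div_pos ht0 (normSq_pos.mpr (vertical_ne_zero σ ht0))
  refine integrableOn_of_norm_le (c := π) (C := C * 3 ^ 12) Real.pi_pos
      (ContinuousOn.aestronglyMeasurable ?_ measurableSet_Ioi) fun t ht => ?_
  · refine hc.norm.mul (ContinuousOn.inv₀ ((continuous_im.comp_continuousOn hζ).pow 12) fun t ht => ?_)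
    exact pow_ne_zero _ (hpos t ht).ne'
  · have ht2 : 1 / 2 ≤ t := hs.trans (le_of_lt ht)
    have ht0 : 0 < t := by linarith
    have h1 := norm_coeff_le hC hσ ht2
    have h2 := norm_vertical_le hσ ht0
    have hn : 0 < ‖(σ : ℂ) + I * t‖ := norm_pos_iff.mpr (vertical_ne_zero σ ht0)
    rw [norm_mul, norm_norm, norm_mul, norm_inv, norm_pow,
      Real.norm_of_nonneg (inv_nonneg.mpr (pow_nonneg (hpos t ht).le _)),
      im_sub_inv, vertical_im, normSq_eq_norm_sq]
    have h3 : ‖(σ : ℂ) + I * t‖ / t ≤ 3 := by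
      rw [div_le_iff₀ ht0]; linarith
    calc ‖g (σ + I * t)‖ * (‖(σ : ℂ) + I * t‖ ^ 12)⁻¹ * ((t / ‖(σ : ℂ) + I * t‖ ^ 2) ^ 12)⁻¹
        = ‖g (σ + I * t)‖ * (‖(σ : ℂ) + I * t‖ / t) ^ 12 := by field_simp
      _ ≤ (C * Real.exp (-π * t)) * 3 ^ 12 := by gcongr
      _ = _ := by ring

theorem IsKernel.ray_integrable (h : IsKernel k g ε) :
    IntegrableOn (fun t : ℝ => ‖g ((0 : ℝ) + I * t)‖ * ((((0 : ℝ) : ℂ) + I * t).im ^ 12)⁻¹) (Ioi 1) := by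
  obtain ⟨C, hC0, hC⟩ := h.exists_bound_g
  have hc : ContinuousOn (fun t : ℝ => g ((0 : ℝ) + I * t)) (Ioi 1) :=
    (continuousOn_vertical h.diff_g.continuousOn 0 one_pos).mono Ioi_subset_Ici_self
  simp only [vertical_im]
  refine integrableOn_of_norm_le (c := π) (C := C) Real.pi_pos
      (ContinuousOn.aestronglyMeasurable ?_ measurableSet_Ioi) fun t ht => ?_
  · refine hc.norm.mul (ContinuousOn.inv₀ (by fun_prop) fun t ht => ?_)
    exact pow_ne_zero _ (one_pos.trans ht).ne'
  · have ht1 : 1 < t := ht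
    have h1 := norm_coeff_le hC (σ := 0) (t := t) (by simp) (by linarith)
    rw [norm_mul, norm_norm, norm_inv, norm_pow, Real.norm_of_nonneg (by linarith)]
    refine (mul_le_of_le_one_right (norm_nonneg _) (inv_le_one_of_one_le₀ (one_le_pow₀ ht1.le))).trans h1

end

end Leech
end

/-! ### The contour integral as a Fourier eigenfunction -/

noncomputable section
namespace Leech

open Complex Filter MeasureTheory Set

/-- `f` is integrable with Fourier transform `F`. -/
structure IsFourierPair (f F : E24 → ℂ) : Prop where
  integrable : Integrable f
  fourier_eq : ∀ y, 𝓕 f y = F y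

theorem IsFourierPair.const_mul {f F : E24 → ℂ} (h : IsFourierPair f F) (c : ℂ) :
    IsFourierPair (fun x => c * f x) (fun y => c * F y) where
  integrable := h.integrable.const_mul c
  fourier_eq y := by
    rw [← h.fourier_eq, Real.fourier_eq, Real.fourier_eq, ← integral_const_mul]
    refine integral_congr_ae (Eventually.of_forall fun v => ?_)
    simp only [Circle.smul_def, smul_eq_mul]; ring

theorem IsFourierPair.add {f F f' F' : E24 → ℂ} (h : IsFourierPair f F) (h' : IsFourierPair f' F') :
    IsFourierPair (fun x => f x + f' x) (fun y => F y + F' y) where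
  integrable := h.integrable.add h'.integrable
  fourier_eq y := by
    have hm : ∀ {u : E24 → ℂ}, Integrable u →
        Integrable fun v : E24 => Real.fourierChar (-(inner ℝ v y)) • u v := fun {u} hu => by
      refine hu.mono ?_ (Eventually.of_forall fun p => by rw [Circle.norm_smul])
      exact AEStronglyMeasurable.smul (𝕜 := Circle)
        (Continuous.aestronglyMeasurable (by fun_prop)) hu.1
    rw [← h.fourier_eq, ← h'.fourier_eq, Real.fourier_eq, Real.fourier_eq, Real.fourier_eq,
      ← integral_add (hm h.integrable) (hm h'.integrable)]
    simp only [smul_add]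

section

variable {k g : ℂ → ℂ} {ε : ℂ}

theorem arc_im_pos (a σ : ℝ) {t : ℝ} (ht : 0 < t) : 0 < ((a : ℂ) - 1 / (σ + I * t)).im := by
  rw [im_sub_inv, vertical_im]
  exact div_pos ht (normSq_pos.mpr (vertical_ne_zero σ ht))

theorem IsKernel.fourier_cusp (h : IsKernel k g ε) {σ a s₀ : ℝ} (hσ : |σ| ≤ 1) (hs : 1 / 2 ≤ s₀) :
    IsFourierPair (fun x : E24 => cuspIntegral g σ a s₀ ((‖x‖ : ℂ) ^ 2)) (fun y =>
      ∫ t in Ioi s₀, (g (σ + I * t) * (((σ : ℂ) + I * t) ^ 12)⁻¹) *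
        (((((a : ℂ) - 1 / (σ + I * t)) ^ 12)⁻¹) *
          cexp (π * I * (‖y‖ : ℂ) ^ 2 * (-1 / ((a : ℂ) - 1 / (σ + I * t)))))) := by
  have hs0 : 0 < s₀ := by linarith
  have h1 : ∀ t ∈ Ioi s₀, 0 < ((a : ℂ) - 1 / (σ + I * t)).im := fun t ht =>
    arc_im_pos a σ (hs0.trans ht)
  have h2 := (h.continuousOn_coeff σ hs0).aestronglyMeasurable (μ := volume) measurableSet_Ioi
  have h3 := (continuousOn_arc a σ hs0).aestronglyMeasurable (μ := volume) measurableSet_Ioi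
  have h4 := h.cusp_integrable (a := a) hσ hs
  exact ⟨integrable_integral_gaussian measurableSet_Ioi h1 h2 h3 h4,
    fourier_integral_gaussian measurableSet_Ioi h1 h2 h3 h4⟩

/-- Inversion ζ ↦ -1/ζ carries the ray from i to i∞ to the segment from i to 0; `fourier_cusp_zero`
is the converse. -/
theorem IsKernel.fourier_ray (h : IsKernel k g ε) :
    IsFourierPair (fun x : E24 => rayIntegral g ((‖x‖ : ℂ) ^ 2))
      (fun y => cuspIntegral g (0 : ℝ) (0 : ℝ) 1 ((‖y‖ : ℂ) ^ 2)) := by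
  have h1 : ∀ t ∈ Ioi (1 : ℝ), 0 < (((0 : ℝ) : ℂ) + I * t).im := fun t ht => by
    rw [vertical_im]; exact one_pos.trans ht
  have h2 : AEStronglyMeasurable (fun t : ℝ => g ((0 : ℝ) + I * t)) (volume.restrict (Ioi 1)) :=
    ((continuousOn_vertical h.diff_g.continuousOn 0 one_pos).mono
      Ioi_subset_Ici_self).aestronglyMeasurable measurableSet_Ioi
  have h3 : AEStronglyMeasurable (fun t : ℝ => ((0 : ℝ) : ℂ) + I * t) (volume.restrict (Ioi 1)) :=
    Continuous.aestronglyMeasurable (by fun_prop)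
  have h4 := h.ray_integrable
  refine ⟨integrable_integral_gaussian measurableSet_Ioi h1 h2 h3 h4, fun y => ?_⟩
  rw [show (fun x : E24 => rayIntegral g ((‖x‖ : ℂ) ^ 2)) = fun x : E24 => ∫ t in Ioi (1 : ℝ),
    g ((0 : ℝ) + I * t) * cexp (π * I * (‖x‖ : ℂ) ^ 2 * ((0 : ℝ) + I * t)) from rfl,
    fourier_integral_gaussian measurableSet_Ioi h1 h2 h3 h4 y, cuspIntegral]
  refine setIntegral_congr_fun measurableSet_Ioi fun t _ => ?_
  simp only [ofReal_zero, zero_sub, neg_div, mul_assoc]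

theorem IsKernel.g_sub_one (h : IsKernel k g ε) {z : ℂ} (hz : 0 < z.im) : g (z - 1) = ε * g z := by
  have h1 := h.g_add_one (z - 1) (by simpa using hz)
  rw [sub_add_cancel] at h1
  rw [h1, ← mul_assoc, h.sq_eq, one_mul]

/-- For a² = 1 one has -1/(a - 1/u) = -a - 1/(u - a): the image is the arc ending at the opposite
cusp -a, parametrized by u - a. The shift of g by ±1 produces ε, and u^{12}(a - 1/u)^{12} = (u -
a)^{12} restores the weight. -/
theorem IsKernel.fourier_cusp_one (h : IsKernel k g ε) {σ a s₀ : ℝ} (hσ : |σ| ≤ 1)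
    (hs : 1 / 2 ≤ s₀) (ha : a = 1 ∨ a = -1) :
    IsFourierPair (fun x : E24 => cuspIntegral g σ a s₀ ((‖x‖ : ℂ) ^ 2))
      (fun y => ε * cuspIntegral g (σ - a : ℝ) (-a : ℝ) s₀ ((‖y‖ : ℂ) ^ 2)) := by
  have h0 := h.fourier_cusp (a := a) hσ hs
  refine ⟨h0.integrable, fun y => ?_⟩
  rw [h0.fourier_eq, cuspIntegral, ← integral_const_mul]
  refine setIntegral_congr_fun measurableSet_Ioi fun t ht => ?_
  have ht0 : 0 < t := by have : s₀ < t := ht; linarith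
  have hu : (σ : ℂ) + I * t ≠ 0 := vertical_ne_zero σ ht0
  have hu1 : ((σ - a : ℝ) : ℂ) + I * t ≠ 0 := vertical_ne_zero _ ht0
  have him : 0 < ((σ : ℂ) + I * t).im := by rwa [vertical_im]
  have he : ((σ - a : ℝ) : ℂ) + I * t = (σ + I * t) - a := by push_cast; ring
  have hg : g (((σ - a : ℝ) : ℂ) + I * t) = ε * g (σ + I * t) := by
    rw [he]
    rcases ha with rfl | rfl
    · simpa using h.g_sub_one him
    · simpa using h.g_add_one _ him
  have haa : (a : ℂ) * a = 1 := by rcases ha with rfl | rfl <;> simp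
  have ha0 : (a : ℂ) ≠ 0 := by rintro h; simp [h] at haa
  have ha12 : (a : ℂ) ^ 12 = 1 := by
    rw [show (a : ℂ) ^ 12 = (a * a) ^ 6 by ring, haa, one_pow]
  have hζ : (a : ℂ) - 1 / (σ + I * t) = a * (((σ - a : ℝ) : ℂ) + I * t) / (σ + I * t) := by
    rw [he]; field_simp; linear_combination haa
  have hζ' : -1 / ((a : ℂ) - 1 / (σ + I * t)) =
      ((-a : ℝ) : ℂ) - 1 / (((σ - a : ℝ) : ℂ) + I * t) := by
    rw [hζ]
    push_cast
    have hu2 : (σ : ℂ) - a + I * t ≠ 0 := by simpa using hu1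
    field_simp
    linear_combination ((σ : ℂ) + I * t - a) * haa
  simp only [hζ', hg]
  rw [hζ, div_pow, mul_pow, ha12]
  generalize cexp _ = e
  field_simp
  linear_combination -(g (σ + I * t) * e) * h.sq_eq

theorem IsKernel.fourier_cusp_zero (h : IsKernel k g ε) :
    IsFourierPair (fun x : E24 => cuspIntegral g (0 : ℝ) (0 : ℝ) 1 ((‖x‖ : ℂ) ^ 2))
      (fun y => rayIntegral g ((‖y‖ : ℂ) ^ 2)) := by
  have h0 := h.fourier_cusp (σ := 0) (a := 0) (s₀ := 1) (by simp) (by norm_num)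
  refine ⟨h0.integrable, fun y => ?_⟩
  rw [h0.fourier_eq, rayIntegral]
  refine setIntegral_congr_fun measurableSet_Ioi fun t ht => ?_
  have hu : ((0 : ℝ) : ℂ) + I * t ≠ 0 := vertical_ne_zero 0 (one_pos.trans ht)
  have e1 : -1 / (((0 : ℝ) : ℂ) - 1 / ((0 : ℝ) + I * t)) = (0 : ℝ) + I * t := by
    generalize ((0 : ℝ) : ℂ) + I * t = u at hu ⊢
    simp
  simp only [e1]
  generalize cexp _ = e
  generalize ((0 : ℝ) : ℂ) + I * t = u at hu ⊢
  simp only [ofReal_zero, zero_sub, one_div]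
  have : (-u⁻¹) ^ 12 = (u ^ 12)⁻¹ := by rw [Even.neg_pow (by decide), inv_pow]
  rw [this]
  field_simp

/-- The contour integral is, up to the sign `ε`, its own Fourier transform. -/
theorem IsKernel.fourier_contour (h : IsKernel k g ε) :
    IsFourierPair (fun x : E24 => contourIntegral g ε ((‖x‖ : ℂ) ^ 2))
      (fun y => ε * contourIntegral g ε ((‖y‖ : ℂ) ^ 2)) := by
  have h1 := h.fourier_cusp_one (σ := -1 / 2) (a := -1) (s₀ := 1 / 2) (by norm_num [abs_div]) le_rfl
    (.inr rfl)
  have h2 := h.fourier_cusp_one (σ := 1 / 2) (a := 1) (s₀ := 1 / 2) (by norm_num [abs_div]) le_rfl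
    (.inl rfl)
  have h3 := h.fourier_cusp_zero
  have h4 := h.fourier_ray
  have H := (((h1.const_mul (-I)).add (h2.const_mul (-I))).add (h3.const_mul (2 * I))).add
    (h4.const_mul (2 * ε * I))
  -- With σ = a/2 the shifted parameter σ - a is -a/2, so the two arcs are exchanged exactly.
  have e1 : (-1 / 2 - -1 : ℝ) = 1 / 2 := by norm_num
  have e2 : (1 / 2 - 1 : ℝ) = -1 / 2 := by norm_num
  rw [e1, e2, neg_neg] at H
  refine ⟨H.integrable.congr (Eventually.of_forall fun x => ?_), fun y => ?_⟩
  · simp only [contourIntegral]; ring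
  · have e3 : (fun x : E24 => contourIntegral g ε ((‖x‖ : ℂ) ^ 2)) = _ := funext fun x => by
      rw [contourIntegral, sub_eq_add_neg, ← neg_mul]
    rw [e3, H.fourier_eq, contourIntegral]
    linear_combination (-2 * I * rayIntegral g ((‖y‖ : ℂ) ^ 2)) * h.sq_eq

end

end Leech
end

/-! ### Contour deformation: agreement with the integral along the imaginary axis -/

noncomputable section
namespace Leech

open Complex Filter MeasureTheory Set

theorem image_inv_Ioi_one : (fun t : ℝ => t⁻¹) '' Ioi 1 = Ioo 0 1 := by
  rw [image_inv_eq_inv, inv_Ioi₀ one_pos, inv_one]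

theorem hasDerivWithinAt_inv_Ioi_one : ∀ t ∈ Ioi (1 : ℝ),
    HasDerivWithinAt (fun t : ℝ => t⁻¹) (-(t ^ 2)⁻¹) (Ioi 1) t := fun _ ht =>
  (hasDerivAt_inv (one_pos.trans ht).ne').hasDerivWithinAt

theorem integrableOn_Ioo_inv {F : ℝ → ℂ} :
    IntegrableOn F (Ioo 0 1) ↔ IntegrableOn (fun t : ℝ => ((t ^ 2)⁻¹ : ℝ) • F t⁻¹) (Ioi 1) := by
  rw [← image_inv_Ioi_one, integrableOn_image_iff_integrableOn_abs_deriv_smul measurableSet_Ioi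
    hasDerivWithinAt_inv_Ioi_one inv_injective.injOn]
  simp only [abs_neg, abs_of_nonneg (inv_nonneg.mpr (sq_nonneg (_ : ℝ)))]

theorem integral_Ioo_inv (F : ℝ → ℂ) :
    ∫ t in Ioo 0 1, F t = ∫ t in Ioi (1 : ℝ), ((t ^ 2)⁻¹ : ℝ) • F t⁻¹ := by
  rw [← image_inv_Ioi_one, integral_image_eq_integral_abs_deriv_smul measurableSet_Ioi
    hasDerivWithinAt_inv_Ioi_one inv_injective.injOn]
  simp only [abs_neg, abs_of_nonneg (inv_nonneg.mpr (sq_nonneg (_ : ℝ)))]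

section

variable {k g : ℂ → ℂ} {ε : ℂ}

/-- The substitution t ↦ 1/t turns the lower part of the axis, where k has no direct bound, into an
integral of the decaying g. -/
theorem IsKernel.cusp_term (h : IsKernel k g ε) (a ρ : ℝ) {t : ℝ} (ht : 0 < t) :
    ((t ^ 2)⁻¹ : ℝ) • (k (I * (t⁻¹ : ℝ)) * cexp (π * I * ρ * (a + I * (t⁻¹ : ℝ)))) =
    -((g ((0 : ℝ) + I * t) * ((((0 : ℝ) : ℂ) + I * t) ^ 12)⁻¹) *
      cexp (π * I * ρ * (a - 1 / ((0 : ℝ) + I * t)))) := by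
  have ht0 : (t : ℂ) ≠ 0 := by exact_mod_cast ht.ne'
  have e1 : -1 / (I * t : ℂ) = I * (t⁻¹ : ℝ) := by
    push_cast; field_simp; simp
  have h1 := h.k_inv (I * t) (by simpa using ht)
  rw [e1] at h1
  have e2 : (a : ℂ) - 1 / ((0 : ℝ) + I * t) = a + I * (t⁻¹ : ℝ) := by
    rw [← e1, ofReal_zero, zero_add]; ring
  rw [e2, h1]
  simp only [ofReal_zero, zero_add, real_smul, mul_pow]
  generalize cexp _ = e
  rw [show I ^ 12 = (I ^ 4) ^ 3 by ring, show I ^ 10 = (I ^ 4) ^ 2 * I ^ 2 by ring, I_pow_four, I_sq]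
  push_cast
  field_simp

theorem IsKernel.cusp_integrable_kernel (h : IsKernel k g ε) (a ρ : ℝ) (hρ : 0 ≤ ρ) :
    IntegrableOn (fun t : ℝ => (g ((0 : ℝ) + I * t) * ((((0 : ℝ) : ℂ) + I * t) ^ 12)⁻¹) *
      cexp (π * I * ρ * (a - 1 / ((0 : ℝ) + I * t)))) (Ioi 1) := by
  obtain ⟨C, hC0, hC⟩ := h.exists_bound_g
  refine integrableOn_of_norm_le (c := π) (C := C) Real.pi_pos
    (((h.continuousOn_coeff 0 one_pos).mul (Complex.continuous_exp.comp_continuousOn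
      (continuousOn_const.mul (continuousOn_arc a 0 one_pos)))).aestronglyMeasurable
        measurableSet_Ioi) fun t ht => ?_
  have ht1 : 1 < t := ht
  have h1 := norm_coeff_le hC (σ := 0) (t := t) (by simp) (by linarith)
  have h2 : ‖cexp (π * I * ρ * (a - 1 / ((0 : ℝ) + I * t)))‖ ≤ 1 := by
    rw [Complex.norm_exp, Real.exp_le_one_iff]
    have := arc_im_pos a 0 (one_pos.trans ht1)
    rw [show (π * I * ρ * (a - 1 / ((0 : ℝ) + I * t)) : ℂ) =
      ((π * ρ : ℝ) : ℂ) * (I * (a - 1 / ((0 : ℝ) + I * t))) by push_cast; ring, re_ofReal_mul,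
      I_mul_re]
    have h3 : 0 ≤ π * ρ := by positivity
    nlinarith
  have h3 : ‖(((0 : ℝ) : ℂ) + I * t)‖⁻¹ ≤ 1 := inv_le_one_of_one_le₀
    (ht1.le.trans (le_norm_vertical 0 (one_pos.trans ht1)))
  rw [norm_mul, norm_mul, norm_inv, norm_pow, ← inv_pow]
  calc _ ≤ (C * Real.exp (-π * t)) * 1 ^ 12 * 1 := by gcongr
    _ = _ := by ring

/-- The exponentially decaying integrand at `i∞`. -/
theorem IsKernel.bound_shift (h : IsKernel k g ε) (a ρ : ℝ) :
    ∃ C : ℝ, 0 ≤ C ∧ ∀ z : ℂ, |z.re - a| ≤ 1 → 1 / 2 ≤ z.im →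
      ‖k (z - a) * cexp (π * I * ρ * z)‖ ≤ C * Real.exp (-(π * (ρ - 4)) * z.im) := by
  obtain ⟨C, hC0, hC⟩ := h.exists_bound_k
  refine ⟨C, hC0, fun z hz hY => ?_⟩
  have h1 := hC (z - a) (by simpa using hz) (by simpa using hY)
  have h2 : ‖cexp (π * I * ρ * z)‖ = Real.exp (-(π * ρ) * z.im) := by
    rw [Complex.norm_exp]; congr 1
    rw [show (π * I * ρ * z : ℂ) = ((π * ρ : ℝ) : ℂ) * (I * z) by push_cast; ring, re_ofReal_mul,
      I_mul_re]; ring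
  rw [norm_mul, h2]
  calc _ ≤ C * Real.exp (4 * π * (z - a).im) * Real.exp (-(π * ρ) * z.im) := by gcongr
    _ = _ := by
      rw [mul_assoc, ← Real.exp_add]
      simp; left; ring

theorem isOpen_im_pos : IsOpen {z : ℂ | 0 < z.im} := isOpen_lt continuous_const continuous_im

theorem IsKernel.diff_shift (h : IsKernel k g ε) (a ρ : ℝ) :
    DifferentiableOn ℂ (fun z => k (z - a) * cexp (π * I * ρ * z)) {z | 0 < z.im} := by
  refine DifferentiableOn.mul (h.diff_k.comp (by fun_prop) fun z hz => ?_)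
    (Differentiable.differentiableOn (by fun_prop))
  simpa using hz

/-- The integral of the kernel over a vertical ray at real part `a`. -/
theorem IsKernel.ray_eq (h : IsKernel k g ε) {a σ ρ : ℝ} (hρ : 4 < ρ)
    (hσ : σ = a / 2) (ha : a = 1 ∨ a = -1) :
    I * (∫ t in Ioi (1 : ℝ), k (((a : ℝ) + I * t) - a) * cexp (π * I * ρ * (a + I * t))) -
      I * cuspIntegral g 0 a 1 ρ =
    I * (∫ t in Ioi (1 : ℝ), k (((0 : ℝ) + I * t) - a) * cexp (π * I * ρ * ((0 : ℝ) + I * t))) -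
      I * cuspIntegral g σ a (1 / 2) ρ := by
  have hρ0 : 0 ≤ ρ := by linarith
  obtain ⟨F, hF⟩ := exists_primitive (h.diff_shift a ρ)
  obtain ⟨C, hC0, hC⟩ := h.bound_shift a _
  -- First move, near i∞ in the variable z: from the ray above a + i to the ray above i. Convergence
  -- of both needs ρ > 4.
  have h1 := vertical_shift (σ₁ := a) (σ₂ := 0) (c := π * (ρ - 4)) (C := C) (Y := 1 / 2) hF
    (h.diff_shift a ρ).continuousOn one_pos one_pos (mul_pos Real.pi_pos (by linarith))
    (fun z hz hY => hC z (by
      rcases ha with rfl | rfl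
      · rw [uIcc_of_ge (by norm_num)] at hz
        rw [abs_le]; constructor <;> linarith [hz.1, hz.2]
      · rw [uIcc_of_le (by norm_num)] at hz
        rw [abs_le]; constructor <;> linarith [hz.1, hz.2]) hY)
  obtain ⟨B, hB0, hB⟩ := h.exists_bound_g
  have him : ∀ u : ℂ, 0 < u.im → 0 < ((a : ℂ) - 1 / u).im := fun u hu => by
    rw [im_sub_inv]
    exact div_pos hu (normSq_pos.mpr (by rintro rfl; simp at hu))
  have hG : ∀ u : ℂ, 0 < u.im → HasDerivAt (fun u : ℂ => F (a - 1 / u))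
      (g u * (u ^ 12)⁻¹ * cexp (π * I * ρ * (a - 1 / u))) u := by
    intro u hu
    have hu0 : u ≠ 0 := by rintro rfl; simp at hu
    have h2 : HasDerivAt (fun u : ℂ => (a : ℂ) - 1 / u) ((u ^ 2)⁻¹) u := by
      simpa using (hasDerivAt_inv hu0).const_sub (a : ℂ)
    have h3 := (hF _ (him u hu)).comp u h2
    refine h3.congr_deriv ?_
    rw [show (a : ℂ) - 1 / u - a = -1 / u by ring, h.k_inv u hu]
    generalize cexp _ = e
    field_simp
  have hcont : ContinuousOn (fun u : ℂ => g u * (u ^ 12)⁻¹ * cexp (π * I * ρ * (a - 1 / u)))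
      {u | 0 < u.im} := by
    have hne : ∀ u ∈ {u : ℂ | 0 < u.im}, u ≠ 0 := by rintro u hu rfl; simp at hu
    refine (h.diff_g.continuousOn.mul (ContinuousOn.inv₀ (by fun_prop)
      fun u hu => pow_ne_zero _ (hne u hu))).mul (Complex.continuous_exp.comp_continuousOn
        (continuousOn_const.mul (continuousOn_const.sub (continuousOn_const.div (by fun_prop) hne))))
  -- Second move, near the cusp a in the variable u with z = a - 1/u: there the vertical segment
  -- from a to a + i and the arc from a to i are both vertical rays. The same primitive F serves, so
  -- its endpoint values cancel between the two moves.
  have h2 := vertical_shift (G := fun u : ℂ => F (a - 1 / u)) (σ₁ := 0) (σ₂ := σ)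
    (s₁ := 1) (s₂ := 1 / 2) (c := π) (C := B) (Y := 1) hG hcont one_pos (by norm_num) Real.pi_pos
    (fun z hz hY => by
      have hz1 : |z.re| ≤ 1 := by
        rcases ha with rfl | rfl
        · rw [hσ, uIcc_of_le (by norm_num)] at hz
          rw [abs_le]; constructor <;> linarith [hz.1, hz.2]
        · rw [hσ, uIcc_of_ge (by norm_num)] at hz
          rw [abs_le]; constructor <;> linarith [hz.1, hz.2]
      have h3 := hB z hz1 (by linarith)
      have h4 : ‖cexp (π * I * ρ * (a - 1 / z))‖ ≤ 1 := by
        rw [Complex.norm_exp, Real.exp_le_one_iff]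
        have := him z (by linarith)
        rw [show (π * I * ρ * (a - 1 / z) : ℂ) =
          ((π * ρ : ℝ) : ℂ) * (I * (a - 1 / z)) by push_cast; ring, re_ofReal_mul, I_mul_re]
        have h3 : 0 ≤ π * ρ := by positivity
        nlinarith
      have h5 : ‖z‖⁻¹ ≤ 1 := inv_le_one_of_one_le₀
        (hY.trans ((le_abs_self _).trans (abs_im_le_norm z)))
      rw [norm_mul, norm_mul, norm_inv, norm_pow, ← inv_pow]
      calc _ ≤ (B * Real.exp (-π * z.im)) * 1 ^ 12 * 1 := by gcongr
        _ = _ := by ring)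
  have p1 : (a : ℂ) - 1 / ((0 : ℝ) + I * (1 : ℝ)) = a + I * (1 : ℝ) := by
    simp
  -- This identity dictates the lower limit 1/2: the parameter a/2 + i/2 corresponds to the point i.
  have p2 : (a : ℂ) - 1 / (σ + I * ((1 / 2 : ℝ) : ℂ)) = (0 : ℝ) + I * (1 : ℝ) := by
    have hne : (σ : ℂ) + I * ((1 / 2 : ℝ) : ℂ) ≠ 0 := vertical_ne_zero σ (by norm_num)
    have : (1 : ℂ) / (σ + I * ((1 / 2 : ℝ) : ℂ)) = a - I := by
      rw [div_eq_iff hne, hσ]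
      have haa : (a : ℂ) * a = 1 := by rcases ha with rfl | rfl <;> simp
      push_cast
      linear_combination (-1 / 2 : ℂ) * haa + (1 / 2 : ℂ) * I_sq
    rw [this]; simp
  simp only [p1, p2] at h2
  simp only [cuspIntegral]
  push_cast at h1 h2 ⊢
  linear_combination h1 - h2

/-- For `r² > 4` the contour integral is the integral along the imaginary axis. -/
theorem IsKernel.contour_eq (h : IsKernel k g ε) {ρ : ℝ} (hρ : 4 < ρ) :
    contourIntegral g ε ρ = -4 * (Real.sin (π * ρ / 2) : ℂ) ^ 2 *
      ∫ t in Ioi (0 : ℝ), k (I * t) * cexp (π * I * ρ * (I * t)) * I := by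
  have hρ0 : 0 ≤ ρ := by linarith
  have hsplit : Ioi (0 : ℝ) = Ioc 0 1 ∪ Ioi 1 := (Ioc_union_Ioi_eq_Ioi zero_le_one).symm
  -- integrability near `i∞`
  have hint1 : ∀ a σ : ℝ, |σ - a| ≤ 1 → IntegrableOn (fun t : ℝ => k ((σ + I * t) - a) *
      cexp (π * I * ρ * (σ + I * t))) (Ioi 1) := fun a σ haσ => by
    obtain ⟨C, hC0, hC⟩ := h.bound_shift a _
    exact integrableOn_vertical (c := π * (ρ - 4)) (Y := 1 / 2) (h.diff_shift a ρ).continuousOn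
      one_pos (mul_pos Real.pi_pos (by linarith)) fun z hz hY => hC z (hz ▸ haσ) hY
  -- Splits the axis at t = 1 and rewrites the part below as a cusp integral by inversion;
  -- integrability at 0 is obtained the same way.
  have hV : ∀ a : ℝ, (∫ t in Ioi (0 : ℝ), k (I * t) * cexp (π * I * ρ * (a + I * t))) =
      (∫ t in Ioi (1 : ℝ), k (((a : ℝ) + I * t) - a) * cexp (π * I * ρ * (a + I * t))) -
        cuspIntegral g 0 a 1 ρ := by
    intro a
    have e1 : ∀ t : ℝ, k (((a : ℝ) + I * t) - a) * cexp (π * I * ρ * (a + I * t)) =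
      k (I * t) * cexp (π * I * ρ * (a + I * t)) := fun t => by rw [add_sub_cancel_left]
    have i1 := hint1 a a (by simp)
    simp only [e1] at i1 ⊢
    have hc := h.cusp_integrable_kernel a ρ hρ0
    have e2 : ∀ t ∈ Ioi (1 : ℝ), _ := fun t ht => h.cusp_term a ρ (one_pos.trans ht)
    have i0 : IntegrableOn (fun t : ℝ => k (I * t) * cexp (π * I * ρ * (a + I * t))) (Ioc 0 1) := by
      rw [integrableOn_Ioc_iff_integrableOn_Ioo, integrableOn_Ioo_inv]
      exact (integrableOn_congr_fun e2 measurableSet_Ioi).mpr hc.neg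
    rw [hsplit, setIntegral_union (Ioc_disjoint_Ioi le_rfl) measurableSet_Ioi i0 i1,
      integral_Ioc_eq_integral_Ioo, integral_Ioo_inv, setIntegral_congr_fun measurableSet_Ioi e2,
      integral_neg, cuspIntegral]
    ring
  have hE : ∀ a : ℝ, (∫ t in Ioi (0 : ℝ), k (I * t) * cexp (π * I * ρ * (a + I * t))) =
      cexp (π * I * ρ * a) * ∫ t in Ioi (0 : ℝ), k (I * t) * cexp (π * I * ρ * (I * t)) := by
    intro a
    rw [← integral_const_mul]
    refine integral_congr_ae (Eventually.of_forall fun t => ?_)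
    simp only [mul_add, Complex.exp_add]; ring
  have hm := h.ray_eq (a := -1) (σ := -1 / 2) hρ (by norm_num) (.inr rfl)
  have hp := h.ray_eq (a := 1) (σ := 1 / 2) hρ (by norm_num) (.inl rfl)
  have j1 := hint1 1 0 (by norm_num)
  have j2 := hint1 (-1) 0 (by norm_num)
  have j0 := hint1 0 0 (by norm_num)
  -- After both outer rays have been moved to the imaginary axis, the second-difference relation
  -- leaves only g.
  have hsum : (∫ t in Ioi (1 : ℝ), k (((0 : ℝ) + I * t) - (1 : ℝ)) *
        cexp (π * I * ρ * ((0 : ℝ) + I * t))) +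
      (∫ t in Ioi (1 : ℝ), k (((0 : ℝ) + I * t) - (-1 : ℝ)) * cexp (π * I * ρ * ((0 : ℝ) + I * t)))
      - 2 * (∫ t in Ioi (1 : ℝ), k (((0 : ℝ) + I * t) - (0 : ℝ)) *
        cexp (π * I * ρ * ((0 : ℝ) + I * t))) = 2 * ε * rayIntegral g ρ := by
    rw [← integral_add j1 j2, ← integral_const_mul]
    refine (integral_sub (j1.add j2) (j0.const_mul 2)).symm.trans ?_
    rw [rayIntegral, ← integral_const_mul]
    refine setIntegral_congr_fun measurableSet_Ioi fun t ht => ?_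
    have := h.k_diff ((0 : ℝ) + I * t) (by rw [vertical_im]; exact one_pos.trans ht)
    simp only [ofReal_neg, ofReal_one, sub_neg_eq_add, Pi.add_apply]
    rw [ofReal_zero, sub_zero]
    rw [ofReal_zero] at this
    linear_combination (cexp (π * I * ρ * (0 + I * t))) * this
  rw [integral_mul_const]
  set W := ∫ t in Ioi (0 : ℝ), k (I * t) * cexp (π * I * ρ * (I * t)) with hW
  have v0 := (hV 0).symm.trans (hE 0)
  have v1 := (hV 1).symm.trans (hE 1)
  have v2 := (hV (-1)).symm.trans (hE (-1))
  rw [contourIntegral]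
  have hsin : cexp (π * I * ρ * (1 : ℝ)) + cexp (π * I * ρ * (-1 : ℝ)) - 2 =
      -4 * (Real.sin (π * ρ / 2) : ℂ) ^ 2 := by
    rw [ofReal_sin, Complex.sin]
    push_cast
    have e1 : cexp (π * I * ρ * 1) = cexp (π * ρ / 2 * I) ^ 2 := by
      rw [← Complex.exp_nat_mul]; congr 1; push_cast; ring
    have e2 : cexp (π * I * ρ * -1) = cexp (-(π * ρ / 2) * I) ^ 2 := by
      rw [← Complex.exp_nat_mul]; congr 1; push_cast; ring
    have e3 : cexp (π * ρ / 2 * I) * cexp (-(π * ρ / 2) * I) = 1 := by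
      rw [← Complex.exp_add]; simp
    rw [e1, e2]
    linear_combination 2 * e3 + ((cexp (-(π * ρ / 2) * I) - cexp (π * ρ / 2 * I)) ^ 2) * I_sq
  rw [← hsin]
  have e0 : cexp (π * I * ρ * (0 : ℝ)) = 1 := by simp
  rw [e0] at v0
  push_cast at *
  linear_combination -hp - hm + (-I) * hsum + I * v1 + I * v2 - 2 * I * v0

end

end Leech
end

/-! ### Transformation laws of φ and ψ_I -/

noncomputable section
namespace Leech

open UpperHalfPlane hiding I
open Complex ModularForm ModularGroup Filter
open scoped MatrixGroups Manifold ModularForm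

local notation "E₂" => EisensteinSeries.E2

/-- The middle coefficient in `φ(-1/z)z¹⁰ = φ z² + φ₁ z + φ₂`. -/
def phi₁ (z : ℍ) : ℂ :=
  6 / (π * I) * (48 * E₆ z * E₄ z ^ 2 + 2 * (-49 * E₄ z ^ 3 + 25 * E₆ z ^ 2) * E₂ z) / discriminant z ^ 2

/-- The last coefficient in `φ(-1/z)z¹⁰ = φ z² + φ₁ z + φ₂`. -/
def phi₂ (z : ℍ) : ℂ := (6 / (π * I)) ^ 2 * (-49 * E₄ z ^ 3 + 25 * E₆ z ^ 2) / discriminant z ^ 2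

theorem phi_T (z : ℍ) : phi (T • z) = phi z := by
  simp only [phi, E2_T, E4_T, E6_T, discriminant_T]

theorem phi₁_T (z : ℍ) : phi₁ (T • z) = phi₁ z := by
  simp only [phi₁, E2_T, E4_T, E6_T, discriminant_T]

theorem phi₂_T (z : ℍ) : phi₂ (T • z) = phi₂ z := by
  simp only [phi₂, E4_T, E6_T, discriminant_T]

/-- φ is quadratic in E₂, and each E₂ picks up 6z/(πi) under S. This gives a quadratic polynomial in
z with 1-periodic coefficients, whose second difference is 2φ. -/
theorem phi_S (z : ℍ) : phi (S • z) * (z : ℂ) ^ 10 = phi z * z ^ 2 + phi₁ z * z + phi₂ z := by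
  have hz : (z : ℂ) ≠ 0 := UpperHalfPlane.ne_zero z
  have hΔ := discriminant_ne_zero z
  have hpi : (π : ℂ) ≠ 0 := by exact_mod_cast Real.pi_ne_zero
  have hI := I_ne_zero
  simp only [phi, phi₁, phi₂, E2_S, E4_S, E6_S, discriminant_S]
  field_simp
  ring

theorem psiI_eq (z : ℍ) : psiI z =
    (7 * H₄ z ^ 5 * H₂ z ^ 2 + 7 * H₄ z ^ 6 * H₂ z + 2 * H₄ z ^ 7) / discriminant z ^ 2 := by
  simp only [psiI, H₂, H₄]; ring

/-- The transform `ψ_I(-1/z)z¹⁰`. -/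
def psiS (z : ℍ) : ℂ :=
  -(7 * H₂ z ^ 5 * H₄ z ^ 2 + 7 * H₂ z ^ 6 * H₄ z + 2 * H₂ z ^ 7) / discriminant z ^ 2

theorem psiI_S (z : ℍ) : psiI (S • z) * (z : ℂ) ^ 10 = psiS z := by
  have hz : (z : ℂ) ≠ 0 := UpperHalfPlane.ne_zero z
  have hΔ := discriminant_ne_zero z
  rw [psiI_eq, psiS, H₂_S, H₄_S, discriminant_S]
  field_simp
  ring

theorem psiS_T (z : ℍ) : psiS (T • z) = -psiS z := by
  rw [psiS, psiS, H₂_T, H₄_T, discriminant_T, jacobi_identity]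
  ring

/-- With `psiS_T` this gives ψ_I(z ± 1) = ψ_I - ψ_S, so the second difference of ψ_I is -2ψ_S,
matching ε = -1. Both reduce to polynomial identities in H₂, H₄ through Jacobi's identity. -/
theorem psiI_T (z : ℍ) : psiI (T • z) = psiI z - psiS z := by
  rw [psiI_eq, psiI_eq, psiS, H₂_T, H₄_T, discriminant_T, jacobi_identity]
  ring

theorem psiI_T_T (z : ℍ) : psiI (T • T • z) = psiI z := by
  rw [psiI_T, psiI_T, psiS_T]; ring

theorem ofComplex_coe_add_one (z : ℍ) : ofComplex ((z : ℂ) + 1) = T • z := by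
  rw [← coe_T_smul, ofComplex_apply]

theorem ofComplex_neg_one_div (z : ℍ) : ofComplex (-1 / (z : ℂ)) = S • z := by
  rw [← coe_S_smul, ofComplex_apply]

theorem discriminant_mdiff : MDiff discriminant := ModularFormClass.holo CuspForm.discriminant

theorem discriminant_sq_ne_zero (z : ℍ) : discriminant z ^ 2 ≠ 0 :=
  pow_ne_zero _ (discriminant_ne_zero z)

theorem phi_mdiff : MDiff phi :=
  MDifferentiable.div (((((E4_mdiff.pow 4).const_smul (25 : ℂ)).sub
    (((E6_mdiff.pow 2).const_smul (49 : ℂ)).mul E4_mdiff)).add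
      (((E6_mdiff.const_smul (48 : ℂ)).mul (E4_mdiff.pow 2)).mul E2_mdiff)).add
    ((((E4_mdiff.pow 3).const_smul (-49 : ℂ)).add ((E6_mdiff.pow 2).const_smul (25 : ℂ))).mul
      (E2_mdiff.pow 2))) (discriminant_mdiff.pow 2) discriminant_sq_ne_zero

theorem psiI_mdiff : MDiff psiI := by
  rw [show psiI = _ from funext psiI_eq]
  exact MDifferentiable.div (((((H₄_mdiff.pow 5).const_smul (7 : ℂ)).mul (H₂_mdiff.pow 2)).add
    (((H₄_mdiff.pow 6).const_smul (7 : ℂ)).mul H₂_mdiff)).add ((H₄_mdiff.pow 7).const_smul (2 : ℂ)))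
      (discriminant_mdiff.pow 2) discriminant_sq_ne_zero

theorem psiS_mdiff : MDiff psiS :=
  MDifferentiable.div (((((H₂_mdiff.pow 5).const_smul (7 : ℂ)).mul (H₄_mdiff.pow 2)).add
    (((H₂_mdiff.pow 6).const_smul (7 : ℂ)).mul H₄_mdiff)).add ((H₂_mdiff.pow 7).const_smul (2 : ℂ))).neg
      (discriminant_mdiff.pow 2) discriminant_sq_ne_zero

end Leech
end

/-! ### Arithmetic of truncated expansions -/

noncomputable section
namespace Leech

open UpperHalfPlane hiding I
open Complex ModularForm Filter Asymptotics

/-- `f = a₀ + a₁u + a₂u² + a₃u³ + a₄u⁴ + O(u⁵)` at `i∞`. -/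
def HasExp (u f : ℍ → ℂ) (a₀ a₁ a₂ a₃ a₄ : ℂ) : Prop :=
  (fun z => f z - (a₀ + a₁ * u z + a₂ * u z ^ 2 + a₃ * u z ^ 3 + a₄ * u z ^ 4)) =O[atImInfty]
    fun z => u z ^ 5

section

variable {u f g : ℍ → ℂ} {a₀ a₁ a₂ a₃ a₄ b₀ b₁ b₂ b₃ b₄ : ℂ}

theorem isBigO_one_poly (hu : Tendsto u atImInfty (𝓝 0)) (a₀ a₁ a₂ a₃ a₄ : ℂ) :
    (fun z => a₀ + a₁ * u z + a₂ * u z ^ 2 + a₃ * u z ^ 3 + a₄ * u z ^ 4) =O[atImInfty]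
      fun _ => (1 : ℂ) := by
  have := ((((hu.const_mul a₁).const_add a₀).add ((hu.pow 2).const_mul a₂)).add
    ((hu.pow 3).const_mul a₃)).add ((hu.pow 4).const_mul a₄)
  exact this.isBigO_one ℂ

theorem HasExp.isBigO_one (hu : Tendsto u atImInfty (𝓝 0)) (hf : HasExp u f a₀ a₁ a₂ a₃ a₄) :
    f =O[atImInfty] fun _ => (1 : ℂ) := by
  have h1 : (fun z => u z ^ 5) =O[atImInfty] fun _ => (1 : ℂ) := (hu.pow 5).isBigO_one ℂ
  refine ((hf.trans h1).add (isBigO_one_poly hu a₀ a₁ a₂ a₃ a₄)).congr_left fun z => ?_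
  ring

theorem HasExp.add (hf : HasExp u f a₀ a₁ a₂ a₃ a₄) (hg : HasExp u g b₀ b₁ b₂ b₃ b₄) :
    HasExp u (fun z => f z + g z) (a₀ + b₀) (a₁ + b₁) (a₂ + b₂) (a₃ + b₃) (a₄ + b₄) := by
  refine (IsBigO.add hf hg).congr_left fun z => ?_
  ring

theorem HasExp.const_mul (c : ℂ) (hf : HasExp u f a₀ a₁ a₂ a₃ a₄) :
    HasExp u (fun z => c * f z) (c * a₀) (c * a₁) (c * a₂) (c * a₃) (c * a₄) := by
  refine (IsBigO.const_mul_left hf c).congr_left fun z => ?_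
  ring

theorem HasExp.mul (hu : Tendsto u atImInfty (𝓝 0)) (hf : HasExp u f a₀ a₁ a₂ a₃ a₄)
    (hg : HasExp u g b₀ b₁ b₂ b₃ b₄) :
    HasExp u (fun z => f z * g z) (a₀ * b₀) (a₀ * b₁ + a₁ * b₀) (a₀ * b₂ + a₁ * b₁ + a₂ * b₀)
      (a₀ * b₃ + a₁ * b₂ + a₂ * b₁ + a₃ * b₀)
      (a₀ * b₄ + a₁ * b₃ + a₂ * b₂ + a₃ * b₁ + a₄ * b₀) := by
  have h1 := (IsBigO.mul hf (hg.isBigO_one hu)).add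
    (IsBigO.mul (isBigO_one_poly hu a₀ a₁ a₂ a₃ a₄) hg |>.congr_right fun z => mul_comm _ _)
  -- The terms of degree 5 to 8 in the product of the two truncations, written as u⁵ times a
  -- polynomial.
  have h2 := IsBigO.mul (isBigO_refl (fun z => u z ^ 5) atImInfty) (isBigO_one_poly hu
    (a₁ * b₄ + a₂ * b₃ + a₃ * b₂ + a₄ * b₁) (a₂ * b₄ + a₃ * b₃ + a₄ * b₂)
    (a₃ * b₄ + a₄ * b₃) (a₄ * b₄) 0)
  refine ((h1.add h2).congr_left fun z => ?_).congr_right fun z => mul_one _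
  ring

theorem HasExp.congr (hf : HasExp u f a₀ a₁ a₂ a₃ a₄) (h : ∀ z, f z = g z) (h₀ : a₀ = b₀)
    (h₁ : a₁ = b₁) (h₂ : a₂ = b₂) (h₃ : a₃ = b₃) (h₄ : a₄ = b₄) : HasExp u g b₀ b₁ b₂ b₃ b₄ := by
  subst h₀ h₁ h₂ h₃ h₄
  rwa [show g = f from (funext h).symm]

theorem HasExp.of_remainder {G : ℍ → ℂ} (hG : IsBoundedAtImInfty G)
    (h : ∀ z, f z = a₀ + a₁ * u z + a₂ * u z ^ 2 + a₃ * u z ^ 3 + a₄ * u z ^ 4 + u z ^ 5 * G z) :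
    HasExp u f a₀ a₁ a₂ a₃ a₄ := by
  have hG' : G =O[atImInfty] fun _ => (1 : ℝ) := hG
  have h2 := IsBigO.mul (isBigO_refl (fun z => u z ^ 5) atImInfty) (hG'.trans
    (isBigO_const_const (1 : ℝ) (one_ne_zero : (1 : ℂ) ≠ 0) atImInfty))
  refine (h2.congr_left fun z => ?_).congr_right fun z => mul_one _
  rw [h]; ring

end

end Leech
end

/-! ### Expansions of the numerators and polar parts of the kernels -/

noncomputable section
namespace Leech

open UpperHalfPlane hiding I
open Complex ModularForm Filter Asymptotics
open scoped ArithmeticFunction.sigma MatrixGroups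

local notation "E₂" => EisensteinSeries.E2

theorem nome_sq_tendsto : Tendsto (fun z => nome z ^ 2) atImInfty (𝓝 0) := by
  simpa using nome_tendsto.pow 2

theorem E2_hasExp : HasExp (fun z => nome z ^ 2) E₂ 1 (-24) (-72) (-96) (-168) := by
  obtain ⟨g, hg, h⟩ := exists_bounded_remainder one_pos (f := E₂)
    (c := fun m => if m = 0 then 1 else -24 * σ 1 m) (fun τ => by
      simpa only [Function.Periodic.qParam, ofReal_one, div_one] using
        EisensteinSeries.hasSum_qExpansion_E2 (z := τ)) 5
  refine .of_remainder hg fun z => ?_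
  have h2 : σ 1 2 = 3 := by decide
  have h3 : σ 1 3 = 4 := by decide
  have h4 : σ 1 4 = 7 := by decide
  rw [h z, qParam_one_eq]
  norm_num [Finset.sum_range_succ, h2, h3, h4]

theorem E4_hasExp : HasExp (fun z => nome z ^ 2) E₄ 1 240 2160 6720 17520 := by
  obtain ⟨g, hg, h⟩ := exists_bounded_remainder one_pos (f := E₄)
    (fun τ => ModularForm.hasSum_qExpansion E₄ one_pos one_mem_strictPeriods_SL τ) 5
  refine .of_remainder hg fun z => ?_
  have h2 : σ 3 2 = 9 := by decide
  have h3 : σ 3 3 = 28 := by decide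
  have h4 : σ 3 4 = 73 := by decide
  rw [h z, qParam_one_eq]
  norm_num [Finset.sum_range_succ, h2, h3, h4, EisensteinSeries.E_qExpansion_coeff _ ⟨2, rfl⟩,
    show bernoulli 4 = -1 / 30 by decide +kernel]

theorem E6_hasExp : HasExp (fun z => nome z ^ 2) E₆ 1 (-504) (-16632) (-122976) (-532728) := by
  obtain ⟨g, hg, h⟩ := exists_bounded_remainder one_pos (f := E₆)
    (fun τ => ModularForm.hasSum_qExpansion E₆ one_pos one_mem_strictPeriods_SL τ) 5
  refine .of_remainder hg fun z => ?_
  have h2 : σ 5 2 = 33 := by decide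
  have h3 : σ 5 3 = 244 := by decide
  have h4 : σ 5 4 = 1057 := by decide
  rw [h z, qParam_one_eq]
  norm_num [Finset.sum_range_succ, h2, h3, h4, EisensteinSeries.E_qExpansion_coeff _ ⟨3, rfl⟩,
    show bernoulli 6 = 1 / 42 by decide +kernel]

theorem E4_sq_hasExp : HasExp (fun z => nome z ^ 2) (fun z => E₄ z ^ 2)
    1 480 61920 1050240 7926240 :=
  (E4_hasExp.mul nome_sq_tendsto E4_hasExp).congr (fun z => by ring) (by norm_num) (by norm_num)
    (by norm_num) (by norm_num) (by norm_num)

theorem E4_cube_hasExp : HasExp (fun z => nome z ^ 2) (fun z => E₄ z ^ 3)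
    1 720 179280 16954560 396974160 :=
  (E4_sq_hasExp.mul nome_sq_tendsto E4_hasExp).congr (fun z => by ring) (by norm_num) (by norm_num)
    (by norm_num) (by norm_num) (by norm_num)

theorem E6_sq_hasExp : HasExp (fun z => nome z ^ 2) (fun z => E₆ z ^ 2)
    1 (-1008) 220752 16519104 399517776 :=
  (E6_hasExp.mul nome_sq_tendsto E6_hasExp).congr (fun z => by ring) (by norm_num) (by norm_num)
    (by norm_num) (by norm_num) (by norm_num)

theorem discriminant_hasExp : HasExp (fun z => nome z ^ 2) discriminant 0 1 (-24) 252 (-1472) :=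
  ((E4_cube_hasExp.add (E6_sq_hasExp.const_mul (-1))).const_mul (1 / 1728)).congr
    (fun z => by rw [discriminant_eq_E₄_cube_sub_E₆_sq]; ring)
    (by norm_num) (by norm_num) (by norm_num) (by norm_num) (by norm_num)

theorem discriminant_sq_hasExp : HasExp (fun z => nome z ^ 2) (fun z => discriminant z ^ 2)
    0 0 1 (-48) 1080 :=
  (discriminant_hasExp.mul nome_sq_tendsto discriminant_hasExp).congr (fun z => by ring)
    (by norm_num) (by norm_num) (by norm_num) (by norm_num) (by norm_num)

/-- The coefficient `-49 E₄³ + 25 E₆²`. -/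
theorem phi₂_num_hasExp : HasExp (fun z => nome z ^ 2) (fun z => -49 * E₄ z ^ 3 + 25 * E₆ z ^ 2)
    (-24) (-60480) (-3265920) (-417795840) (-9463789440) :=
  ((E4_cube_hasExp.const_mul (-49)).add (E6_sq_hasExp.const_mul 25)).congr (fun z => by ring)
    (by norm_num) (by norm_num) (by norm_num) (by norm_num) (by norm_num)

theorem phi₁_num_hasExp : HasExp (fun z => nome z ^ 2)
    (fun z => 48 * E₆ z * E₄ z ^ 2 + 2 * (-49 * E₄ z ^ 3 + 25 * E₆ z ^ 2) * E₂ z)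
    0 (-120960) (-13063680) (-2506775040) (-75710315520) :=
  (((E6_hasExp.mul nome_sq_tendsto E4_sq_hasExp).const_mul 48).add
    ((phi₂_num_hasExp.mul nome_sq_tendsto E2_hasExp).const_mul 2)).congr (fun z => by ring)
    (by norm_num) (by norm_num) (by norm_num) (by norm_num) (by norm_num)

/-- The coefficients defining φ make the first three terms vanish. After division by Δ² = q² + ⋯
this leaves φ = O(q), the decay required of g. -/
theorem phi_num_hasExp : HasExp (fun z => nome z ^ 2)
    (fun z => (25 * E₄ z ^ 4 - 49 * E₆ z ^ 2 * E₄ z) + 48 * E₆ z * E₄ z ^ 2 * E₂ z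
      + (-49 * E₄ z ^ 3 + 25 * E₆ z ^ 2) * E₂ z ^ 2)
    0 0 0 (-3657830400) (-138997555200) :=
  ((((E4_cube_hasExp.const_mul 25).add (E6_sq_hasExp.const_mul (-49))).mul nome_sq_tendsto
      E4_hasExp).add
    ((((E6_hasExp.mul nome_sq_tendsto E4_sq_hasExp).const_mul 48).add
      (phi₂_num_hasExp.mul nome_sq_tendsto E2_hasExp)).mul nome_sq_tendsto E2_hasExp)).congr
    (fun z => by ring)
    (by norm_num) (by norm_num) (by norm_num) (by norm_num) (by norm_num)

theorem H₂_hasExp : HasExp nome H₂ 0 16 0 64 0 := by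
  obtain ⟨g, hg, h⟩ := H₂_expansion
  have hp : IsBoundedAtImInfty nome := isBounded_of_tendsto nome_tendsto
  have hb : IsBoundedAtImInfty (1 + nome ^ 2 * g) := by
    refine Filter.BoundedAtFilter.add (const_boundedAtFilter _ 1) (.mul ?_ hg)
    rw [pow_two]; exact .mul hp hp
  have hG : IsBoundedAtImInfty ((64 : ℂ) • g + (96 : ℂ) • ((1 + nome ^ 2 * g) * (1 + nome ^ 2 * g)) +
      (64 : ℂ) • ((nome * nome) * ((1 + nome ^ 2 * g) * (1 + nome ^ 2 * g) * (1 + nome ^ 2 * g))) +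
      (16 : ℂ) • ((nome * nome) * (nome * nome) * (((1 + nome ^ 2 * g) * (1 + nome ^ 2 * g)) *
        ((1 + nome ^ 2 * g) * (1 + nome ^ 2 * g))))) :=
    .add (.add (.add (.smul _ hg) (.smul _ (.mul hb hb)))
      (.smul _ (.mul (.mul hp hp) (.mul (.mul hb hb) hb))))
      (.smul _ (.mul (.mul (.mul hp hp) (.mul hp hp)) (.mul (.mul hb hb) (.mul hb hb))))
  refine .of_remainder hG fun z => ?_
  rw [h z]
  simp only [Pi.add_apply, Pi.mul_apply, Pi.smul_apply, Pi.one_apply, Pi.pow_apply, smul_eq_mul]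
  ring

theorem theta01_hasExp : HasExp nome theta01 1 (-2) 0 0 2 := by
  obtain ⟨g, hg, h⟩ := theta01_expansion
  exact .of_remainder hg fun z => by rw [h]; ring

theorem H₄_hasExp : HasExp nome H₄ 1 (-8) 24 (-32) 24 := by
  have h2 : HasExp nome (fun z => theta01 z ^ 2) 1 (-4) 4 0 4 :=
    (theta01_hasExp.mul nome_tendsto theta01_hasExp).congr (fun z => by ring)
      (by norm_num) (by norm_num) (by norm_num) (by norm_num) (by norm_num)
  exact (h2.mul nome_tendsto h2).congr (fun z => by rw [H₄]; ring)
      (by norm_num) (by norm_num) (by norm_num) (by norm_num) (by norm_num)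

/-- The odd coefficients vanish, so ψ_I has no terms e^{3πt} or e^{πt} on the axis; such terms would
produce poles at ρ = 3 and ρ = 1, where sin(πρ/2) is not zero. -/
theorem psiI_num_hasExp : HasExp nome (fun z => 7 * H₄ z ^ 5 * H₂ z ^ 2 + 7 * H₄ z ^ 6 * H₂ z +
    2 * H₄ z ^ 7) 2 0 (-560) 0 196560 := by
  have h42 := H₄_hasExp.mul nome_tendsto H₄_hasExp
  have h4 := (h42.mul nome_tendsto h42).mul nome_tendsto H₄_hasExp
  have h22 := H₂_hasExp.mul nome_tendsto H₂_hasExp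
  have h24 := H₂_hasExp.mul nome_tendsto H₄_hasExp
  exact (h4.mul nome_tendsto (((h22.const_mul 7).add (h24.const_mul 7)).add
    (h42.const_mul 2))).congr (fun z => by ring)
      (by norm_num) (by norm_num) (by norm_num) (by norm_num) (by norm_num)

/-- The common factor H₂⁵ has order five in the nome, one more than Δ². -/
theorem psiS_num_isBigO : (fun z => -(7 * H₂ z ^ 5 * H₄ z ^ 2 + 7 * H₂ z ^ 6 * H₄ z +
    2 * H₂ z ^ 7)) =O[atImInfty] fun z => nome z ^ 5 := by
  have h22 := H₂_hasExp.mul nome_tendsto H₂_hasExp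
  have h2 := (h22.mul nome_tendsto h22).mul nome_tendsto H₂_hasExp
  have h42 := H₄_hasExp.mul nome_tendsto H₄_hasExp
  have h24 := H₂_hasExp.mul nome_tendsto H₄_hasExp
  have h : HasExp nome _ 0 0 0 0 0 := ((h2.mul nome_tendsto (((h42.const_mul 7).add (h24.const_mul 7)).add
    (h22.const_mul 2))).const_mul (-1)).congr (fun z => rfl)
      (by norm_num) (by norm_num) (by norm_num) (by norm_num) (by norm_num)
  refine IsBigO.congr_left h fun z => ?_
  ring

theorem nome_isBigO_discriminant :
    (fun z => (discriminant z ^ 2)⁻¹) =O[atImInfty] fun z => (nome z ^ 4)⁻¹ := by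
  have h1 : (fun z => nome z ^ 2) =O[atImInfty] discriminant := by
    refine IsBigO.trans ?_ exp_isBigO_discriminant
    refine IsBigO.of_norm_le fun z => ?_
    rw [norm_pow, norm_nome, ← Real.exp_nat_mul]
    refine le_of_eq ?_
    congr 1; push_cast; ring
  have h2 : (fun z => nome z ^ 4) =O[atImInfty] fun z => discriminant z ^ 2 :=
    (h1.pow 2).congr_left fun z => by ring
  exact h2.inv_rev (Eventually.of_forall fun z hz => absurd hz (pow_ne_zero _ (nome_ne_zero z)))

/-- Division of a numerator by `Δ²`. -/
theorem polar_part {N : ℍ → ℂ} {c₀ c₁ c₂ : ℂ} {m : ℕ} (hm : m ≤ 2)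
    (hN : (fun z => N z - (c₀ + c₁ * nome z ^ 2 + c₂ * nome z ^ 4) *
      (1 - 48 * nome z ^ 2 + 1080 * nome z ^ 4)) =O[atImInfty] fun z => nome z ^ (m + 4)) :
    (fun z => N z / discriminant z ^ 2 -
      (c₀ * (nome z ^ 4)⁻¹ + c₁ * (nome z ^ 2)⁻¹ + c₂)) =O[atImInfty] fun z => nome z ^ m := by
  have hpow : (fun z => nome z ^ 6) =O[atImInfty] fun z => nome z ^ (m + 4) := by
    have : (fun z => nome z ^ (m + 4) * nome z ^ (2 - m)) =O[atImInfty]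
        fun z => nome z ^ (m + 4) * 1 :=
      (isBigO_refl _ _).mul ((nome_tendsto.pow (2 - m)).isBigO_one ℂ)
    refine (this.congr_left fun z => ?_).congr_right fun z => mul_one _
    rw [← pow_add]; congr 1; omega
  -- The polynomial 1 - 48q + 1080q² is Δ²/q² up to O(q³), so `hN` says that the numerator is (c₀ +
  -- c₁q + c₂q²)·Δ²/q² up to the stated error.
  have h1 : (fun z => discriminant z ^ 2 * (nome z ^ 4)⁻¹ -
      (1 - 48 * nome z ^ 2 + 1080 * nome z ^ 4)) =O[atImInfty] fun z => nome z ^ (m + 4) := by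
    refine IsBigO.trans ?_ hpow
    have := IsBigO.mul discriminant_sq_hasExp (isBigO_refl (fun z => (nome z ^ 4)⁻¹) atImInfty)
    refine (this.congr_left fun z => ?_).congr_right fun z => ?_
    · have := nome_ne_zero z
      field_simp; ring
    · have := nome_ne_zero z
      field_simp
  have h2 : (fun z => c₀ + c₁ * nome z ^ 2 + c₂ * nome z ^ 4) =O[atImInfty] fun _ => (1 : ℂ) :=
    (isBigO_one_poly nome_sq_tendsto c₀ c₁ c₂ 0 0).congr_left fun z => by ring
  have h3 := (hN.sub ((h2.mul h1).congr_right fun z => one_mul _)).mul nome_isBigO_discriminant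
  refine (h3.congr_left fun z => ?_).congr_right fun z => ?_
  · have := nome_ne_zero z
    have := discriminant_ne_zero z
    field_simp; ring
  · have := nome_ne_zero z
    rw [pow_add]; field_simp

theorem phi_num_isBigO : (fun z => (25 * E₄ z ^ 4 - 49 * E₆ z ^ 2 * E₄ z) + 48 * E₆ z * E₄ z ^ 2 * E₂ z
      + (-49 * E₄ z ^ 3 + 25 * E₆ z ^ 2) * E₂ z ^ 2) =O[atImInfty] fun z => nome z ^ (2 + 4) := by
  have h1 := (isBigO_refl (fun z => nome z ^ 6) atImInfty).mul
    (isBigO_one_poly nome_sq_tendsto (-3657830400) (-138997555200) 0 0 0)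
  have h2 : (fun z => (nome z ^ 2) ^ 5) =O[atImInfty] fun z => nome z ^ 6 := by
    have := (isBigO_refl (fun z => nome z ^ 6) atImInfty).mul ((nome_tendsto.pow 4).isBigO_one ℂ)
    exact (this.congr_left fun z => by ring).congr_right fun z => mul_one _
  refine ((IsBigO.trans phi_num_hasExp h2).add (h1.congr_right fun z => mul_one _)).congr_left
    fun z => ?_
  ring

theorem phi_isBigO : phi =O[atImInfty] fun z => nome z ^ 2 := by
  have := polar_part (N := fun z => (25 * E₄ z ^ 4 - 49 * E₆ z ^ 2 * E₄ z) + 48 * E₆ z * E₄ z ^ 2 * E₂ z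
      + (-49 * E₄ z ^ 3 + 25 * E₆ z ^ 2) * E₂ z ^ 2) (c₀ := 0) (c₁ := 0) (c₂ := 0) le_rfl
      (phi_num_isBigO.congr_left fun z => by ring)
  exact this.congr_left fun z => by rw [phi]; ring

/-- Coefficients of q³ and q⁴ are irrelevant modulo O(q³). The free b₀ and b₁ are later chosen to
complete the exact product expected by `polar_part`. -/
theorem isBigO_sq_poly {f : ℍ → ℂ} {a₀ a₁ a₂ a₃ a₄ : ℂ}
    (h : HasExp (fun z => nome z ^ 2) f a₀ a₁ a₂ a₃ a₄) (b₀ b₁ : ℂ) :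
    (fun z => f z - (a₀ + a₁ * nome z ^ 2 + a₂ * nome z ^ 4 + b₀ * nome z ^ 6 + b₁ * nome z ^ 8))
      =O[atImInfty] fun z => nome z ^ 6 := by
  have h1 := (isBigO_refl (fun z => nome z ^ 6) atImInfty).mul
    (isBigO_one_poly nome_sq_tendsto (a₃ - b₀) (a₄ - b₁) 0 0 0)
  have h2 : (fun z => (nome z ^ 2) ^ 5) =O[atImInfty] fun z => nome z ^ 6 := by
    have := (isBigO_refl (fun z => nome z ^ 6) atImInfty).mul ((nome_tendsto.pow 4).isBigO_one ℂ)
    exact (this.congr_left fun z => by ring).congr_right fun z => mul_one _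
  refine ((IsBigO.trans h h2).add (h1.congr_right fun z => mul_one _)).congr_left fun z => ?_
  ring

theorem phi₁_isBigO : (fun z => phi₁ z - I / π * (725760 * (nome z ^ 2)⁻¹ + 113218560))
    =O[atImInfty] fun z => nome z ^ 2 := by
  -- Dividing -120960q - 13063680q² by 1 - 48q gives the next coefficient -13063680 - 48·120960 =
  -- -18869760. Times -6 it is 113218560, the normalizing constant of f.
  have h := isBigO_sq_poly phi₁_num_hasExp (1080 * -120960 - 48 * -18869760) (1080 * -18869760)
  have := polar_part (N := fun z => 48 * E₆ z * E₄ z ^ 2 +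
    2 * (-49 * E₄ z ^ 3 + 25 * E₆ z ^ 2) * E₂ z) (c₀ := 0) (c₁ := -120960) (c₂ := -18869760) le_rfl
    (h.congr_left fun z => by ring)
  refine (this.const_mul_left (6 / (π * I))).congr_left fun z => ?_
  have hpi : (π : ℂ) ≠ 0 := by exact_mod_cast Real.pi_ne_zero
  have h1 : 6 / (π * I) = -6 * I / π := by
    field_simp; rw [I_sq]; ring
  rw [phi₁, mul_div_assoc, h1]
  ring

theorem phi₂_isBigO : (fun z => phi₂ z - 1 / π ^ 2 * (864 * (nome z ^ 4)⁻¹ +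
    2218752 * (nome z ^ 2)⁻¹ + 223140096)) =O[atImInfty] fun z => nome z ^ 2 := by
  have h := isBigO_sq_poly phi₂_num_hasExp (1080 * -61632 - 48 * -6198336) (1080 * -6198336)
  have := polar_part (N := fun z => -49 * E₄ z ^ 3 + 25 * E₆ z ^ 2)
    (c₀ := -24) (c₁ := -61632) (c₂ := -6198336) le_rfl (h.congr_left fun z => by ring)
  refine (this.const_mul_left ((6 / (π * I)) ^ 2)).congr_left fun z => ?_
  have hpi : (π : ℂ) ≠ 0 := by exact_mod_cast Real.pi_ne_zero
  have h1 : (6 / (π * I)) ^ 2 = -36 / (π : ℂ) ^ 2 := by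
    rw [div_pow, mul_pow, I_sq]; ring
  rw [phi₂, mul_div_assoc, h1]
  ring

theorem psiI_isBigO : (fun z => psiI z - (2 * (nome z ^ 4)⁻¹ - 464 * (nome z ^ 2)⁻¹ + 172128))
    =O[atImInfty] nome := by
  have h1 := (isBigO_refl (fun z => nome z ^ 5) atImInfty).mul
    (isBigO_one_poly nome_tendsto 0 (-(1080 * -464 - 48 * 172128)) 0 (-(1080 * 172128)) 0)
  have h2 := (IsBigO.add psiI_num_hasExp (h1.congr_right fun z => mul_one _))
  have := polar_part (N := fun z => 7 * H₄ z ^ 5 * H₂ z ^ 2 + 7 * H₄ z ^ 6 * H₂ z +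
    2 * H₄ z ^ 7) (c₀ := 2) (c₁ := -464) (c₂ := 172128) (m := 1) (by norm_num)
    (h2.congr_left fun z => by ring)
  refine (this.congr_left fun z => ?_).congr_right fun z => pow_one _
  rw [psiI_eq]; ring

theorem psiS_isBigO : psiS =O[atImInfty] nome := by
  have := polar_part (N := fun z => -(7 * H₂ z ^ 5 * H₄ z ^ 2 + 7 * H₂ z ^ 6 * H₄ z +
    2 * H₂ z ^ 7)) (c₀ := 0) (c₁ := 0) (c₂ := 0) (m := 1) (by norm_num)
    (psiS_num_isBigO.congr_left fun z => by ring)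
  exact (this.congr_left fun z => by rw [psiS]; ring).congr_right fun z => pow_one _

end Leech
end

/-! ### The two contour kernels -/

noncomputable section
namespace Leech

open UpperHalfPlane hiding I
open Complex ModularForm ModularGroup Filter Asymptotics
open scoped MatrixGroups Manifold

theorem norm_nome_le_one (z : ℍ) : ‖nome z‖ ≤ 1 := by
  rw [norm_nome, Real.exp_le_one_iff]
  have := z.im_pos
  have := Real.pi_pos
  nlinarith

theorem nome_pow_isBigO_inv (m n : ℕ) :
    (fun z => nome z ^ m) =O[atImInfty] fun z => (nome z ^ n)⁻¹ := by
  refine IsBigO.of_bound' (Eventually.of_forall fun z => ?_)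
  rw [norm_pow, norm_inv, norm_pow]
  have h0 : 0 < ‖nome z‖ := norm_pos_iff.mpr (nome_ne_zero z)
  exact (pow_le_one₀ h0.le (norm_nome_le_one z)).trans
    ((one_le_inv₀ (pow_pos h0 n)).mpr (pow_le_one₀ h0.le (norm_nome_le_one z)))

theorem nome_inv_isBigO_inv {m n : ℕ} (h : m ≤ n) :
    (fun z => (nome z ^ m)⁻¹) =O[atImInfty] fun z => (nome z ^ n)⁻¹ := by
  refine IsBigO.of_bound' (Eventually.of_forall fun z => ?_)
  rw [norm_inv, norm_pow, norm_inv, norm_pow]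
  have h0 : 0 < ‖nome z‖ := norm_pos_iff.mpr (nome_ne_zero z)
  exact inv_anti₀ (pow_pos h0 n) (pow_le_pow_of_le_one h0.le (norm_nome_le_one z) h)

theorem exists_bound_of_isBigO {F G : ℍ → ℂ} (h : F =O[atImInfty] G) :
    ∃ C Y : ℝ, 0 ≤ C ∧ ∀ z : ℍ, Y ≤ z.im → ‖F z‖ ≤ C * ‖G z‖ := by
  obtain ⟨C, hC0, hC⟩ := h.exists_nonneg
  obtain ⟨Y, hY⟩ := (UpperHalfPlane.atImInfty_mem _).mp hC.bound
  exact ⟨C, Y, hC0, fun z hz => hY z hz⟩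

theorem norm_nome_pow (z : ℍ) (n : ℕ) : ‖nome z ^ n‖ = Real.exp (-(n * π) * z.im) := by
  rw [norm_pow, norm_nome, ← Real.exp_nat_mul]; congr 1; ring

theorem norm_nome_pow_inv (z : ℍ) (n : ℕ) : ‖(nome z ^ n)⁻¹‖ = Real.exp (n * π * z.im) := by
  rw [norm_inv, norm_nome_pow, ← Real.exp_neg]; congr 1; ring

theorem phi₁_isBigO_inv : phi₁ =O[atImInfty] fun z => (nome z ^ 2)⁻¹ := by
  have h1 := phi₁_isBigO.trans (nome_pow_isBigO_inv 2 2)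
  have h2 : (fun z => I / π * (725760 * (nome z ^ 2)⁻¹ + 113218560)) =O[atImInfty]
      fun z => (nome z ^ 2)⁻¹ := by
    refine IsBigO.const_mul_left (((isBigO_refl _ _).const_mul_left _).add ?_) _
    exact ((nome_pow_isBigO_inv 0 2).const_mul_left 113218560).congr_left fun z => by simp
  exact (h1.add h2).congr_left fun z => by ring

theorem phi₂_isBigO_inv : phi₂ =O[atImInfty] fun z => (nome z ^ 4)⁻¹ := by
  have h1 := phi₂_isBigO.trans (nome_pow_isBigO_inv 2 4)
  have h2 : (fun z => 1 / (π : ℂ) ^ 2 * (864 * (nome z ^ 4)⁻¹ +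
    2218752 * (nome z ^ 2)⁻¹ + 223140096)) =O[atImInfty] fun z => (nome z ^ 4)⁻¹ := by
    refine IsBigO.const_mul_left ((((isBigO_refl _ _).const_mul_left _).add
      ((nome_inv_isBigO_inv (by norm_num)).const_mul_left _)).add ?_) _
    exact ((nome_pow_isBigO_inv 0 4).const_mul_left 223140096).congr_left fun z => by simp
  exact (h1.add h2).congr_left fun z => by ring

theorem psiI_isBigO_inv : psiI =O[atImInfty] fun z => (nome z ^ 4)⁻¹ := by
  have h1 := psiI_isBigO.trans ((nome_pow_isBigO_inv 1 4).congr_left fun z => pow_one _)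
  have h2 : (fun z => 2 * (nome z ^ 4)⁻¹ - 464 * (nome z ^ 2)⁻¹ + 172128) =O[atImInfty]
      fun z => (nome z ^ 4)⁻¹ := by
    refine (((isBigO_refl _ _).const_mul_left _).sub
      ((nome_inv_isBigO_inv (by norm_num)).const_mul_left _)).add ?_
    exact ((nome_pow_isBigO_inv 0 4).const_mul_left 172128).congr_left fun z => by simp
  exact (h1.add h2).congr_left fun z => by ring

/-- The kernel of `a`. -/
def kernelA (z : ℂ) : ℂ := phi (ofComplex (-1 / z)) * z ^ 10

/-- The kernel of `b`. -/
def kernelB (z : ℂ) : ℂ := psiI (ofComplex z)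

theorem kernelA_coe (z : ℍ) : kernelA z = phi z * z ^ 2 + phi₁ z * z + phi₂ z := by
  rw [kernelA, ofComplex_neg_one_div, phi_S]

theorem exists_coe {z : ℂ} (hz : 0 < z.im) : ∃ τ : ℍ, (τ : ℂ) = z := ⟨⟨z, hz⟩, rfl⟩

theorem coe_sub_one (z : ℍ) : ∃ w : ℍ, (w : ℂ) = z - 1 ∧ T • w = z := by
  obtain ⟨w, hw⟩ := exists_coe (z := (z : ℂ) - 1) (by simpa using z.im_pos)
  refine ⟨w, hw, ?_⟩
  ext
  rw [coe_T_smul, hw]; ring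

theorem isKernel_A : IsKernel kernelA (fun z => phi (ofComplex z)) 1 where
  sq_eq := by norm_num
  diff_k := by
    refine DifferentiableOn.mul ?_ (by fun_prop)
    refine (UpperHalfPlane.mdifferentiable_iff.mp phi_mdiff).comp (f := fun z : ℂ => -1 / z) ?_ fun z hz => ?_
    · exact DifferentiableOn.div (by fun_prop) (by fun_prop) fun z hz => by
        rintro rfl; simp at hz
    · obtain ⟨τ, rfl⟩ := exists_coe hz
      change 0 < (-1 / (τ : ℂ)).im
      rw [← coe_S_smul]; exact (S • τ).im_pos
  diff_g := UpperHalfPlane.mdifferentiable_iff.mp phi_mdiff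
  k_inv z hz := by
    obtain ⟨τ, rfl⟩ := exists_coe hz
    have hτ : (τ : ℂ) ≠ 0 := UpperHalfPlane.ne_zero τ
    rw [kernelA, show -1 / (-1 / (τ : ℂ)) = τ by field_simp, div_pow]
    norm_num
  g_add_one z hz := by
    obtain ⟨τ, rfl⟩ := exists_coe hz
    rw [ofComplex_coe_add_one, phi_T, ofComplex_apply, one_mul]
  k_diff z hz := by
    obtain ⟨τ, rfl⟩ := exists_coe hz
    obtain ⟨w, hw, hT⟩ := coe_sub_one τ
    rw [← hw, ← coe_T_smul, kernelA_coe, kernelA_coe, kernelA_coe, phi_T, phi₁_T, phi₂_T,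
      ofComplex_apply, coe_T_smul, hw, ← hT, phi_T, phi₁_T, phi₂_T, hT]
    ring
  bound_g := by
    obtain ⟨C, Y, hC, h⟩ := exists_bound_of_isBigO phi_isBigO
    refine ⟨C, max Y 1, fun z _ hz => ?_⟩
    obtain ⟨τ, rfl⟩ := exists_coe (one_pos.trans_le ((le_max_right _ _).trans hz))
    rw [ofComplex_apply]
    refine (h τ ((le_max_left _ _).trans hz)).trans ?_
    rw [norm_nome_pow]
    refine mul_le_mul_of_nonneg_left (Real.exp_le_exp.mpr ?_) hC
    have := τ.im_pos
    have := Real.pi_pos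
    push_cast
    simp only [coe_im]
    nlinarith [mul_pos this τ.im_pos]
  bound_k := by
    obtain ⟨C₀, Y₀, hC₀, h₀⟩ := exists_bound_of_isBigO (phi_isBigO.trans (nome_pow_isBigO_inv 2 2))
    obtain ⟨C₁, Y₁, hC₁, h₁⟩ := exists_bound_of_isBigO phi₁_isBigO_inv
    obtain ⟨C₂, Y₂, hC₂, h₂⟩ := exists_bound_of_isBigO phi₂_isBigO_inv
    refine ⟨C₀ + C₁ + C₂, max (max Y₀ Y₁) (max Y₂ 1), fun z hz1 hz => ?_⟩
    have hy1 : 1 ≤ z.im := (le_max_right _ _).trans ((le_max_right _ _).trans hz)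
    obtain ⟨τ, rfl⟩ := exists_coe (one_pos.trans_le hy1)
    have b₀ := h₀ τ ((le_max_left _ _).trans ((le_max_left _ _).trans hz))
    have b₁ := h₁ τ ((le_max_right _ _).trans ((le_max_left _ _).trans hz))
    have b₂ := h₂ τ ((le_max_left _ _).trans ((le_max_right _ _).trans hz))
    rw [norm_nome_pow_inv] at b₀ b₁ b₂
    simp only [coe_im] at hy1 hz1 ⊢
    -- In the strip the factors z² and z cost at most e^{2π Im z} and e^{π Im z}, which still fits
    -- under e^{4π Im z} because φ and φ₁ are O(e^{2π Im z}).
    have hn : ‖(τ : ℂ)‖ ≤ Real.exp (π * τ.im) := by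
      have e : (τ : ℂ) = (τ.re : ℂ) + I * (τ.im : ℝ) := by
        apply Complex.ext <;> simp
      have h3 : |τ.re| ≤ 1 := by simpa using hz1
      rw [e]
      refine (norm_vertical_le h3 τ.im_pos).trans ?_
      have := Real.add_one_le_exp (π * τ.im)
      have := Real.pi_gt_three
      nlinarith [τ.im_pos]
    have hn1 : 1 ≤ Real.exp (π * τ.im) := Real.one_le_exp (by have := τ.im_pos; positivity)
    rw [kernelA_coe]
    have e4 : Real.exp (4 * π * τ.im) = Real.exp (π * τ.im) ^ 4 := by
      rw [← Real.exp_nat_mul]; congr 1; push_cast; ring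
    have e2 : Real.exp ((2 : ℕ) * π * τ.im) = Real.exp (π * τ.im) ^ 2 := by
      rw [← Real.exp_nat_mul]; congr 1; push_cast; ring
    have e4' : Real.exp ((4 : ℕ) * π * τ.im) = Real.exp (π * τ.im) ^ 4 := by
      rw [← Real.exp_nat_mul]; congr 1; push_cast; ring
    rw [e2] at b₀ b₁
    rw [e4'] at b₂
    rw [e4]
    set e := Real.exp (π * τ.im)
    have e3 : e ^ 3 ≤ e ^ 4 := pow_le_pow_right₀ hn1 (by norm_num)
    calc ‖phi τ * (τ : ℂ) ^ 2 + phi₁ τ * τ + phi₂ τ‖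
        ≤ ‖phi τ‖ * ‖(τ : ℂ)‖ ^ 2 + ‖phi₁ τ‖ * ‖(τ : ℂ)‖ + ‖phi₂ τ‖ := by
          refine (norm_add_le _ _).trans (add_le_add_left ((norm_add_le _ _).trans ?_) _)
          rw [norm_mul, norm_mul, norm_pow]
      _ ≤ (C₀ * e ^ 2) * e ^ 2 + (C₁ * e ^ 2) * e + C₂ * e ^ 4 := by gcongr
      _ = C₀ * e ^ 4 + C₁ * e ^ 3 + C₂ * e ^ 4 := by ring
      _ ≤ C₀ * e ^ 4 + C₁ * e ^ 4 + C₂ * e ^ 4 := by gcongr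
      _ = (C₀ + C₁ + C₂) * e ^ 4 := by ring

theorem isKernel_B : IsKernel kernelB (fun z => psiS (ofComplex z)) (-1) where
  sq_eq := by norm_num
  diff_k := UpperHalfPlane.mdifferentiable_iff.mp psiI_mdiff
  diff_g := UpperHalfPlane.mdifferentiable_iff.mp psiS_mdiff
  k_inv z hz := by
    obtain ⟨τ, rfl⟩ := exists_coe hz
    have hτ : (τ : ℂ) ≠ 0 := UpperHalfPlane.ne_zero τ
    rw [kernelB, ofComplex_neg_one_div, ofComplex_apply, ← psiI_S]
    field_simp
  g_add_one z hz := by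
    obtain ⟨τ, rfl⟩ := exists_coe hz
    rw [ofComplex_coe_add_one, psiS_T, ofComplex_apply, neg_one_mul]
  k_diff z hz := by
    obtain ⟨τ, rfl⟩ := exists_coe hz
    obtain ⟨w, hw, hT⟩ := coe_sub_one τ
    rw [← hw, kernelB, kernelB, kernelB, ofComplex_coe_add_one, ofComplex_apply, ofComplex_apply,
      psiI_T, ← psiI_T_T w, hT, psiI_T]
    ring
  bound_g := by
    obtain ⟨C, Y, hC, h⟩ := exists_bound_of_isBigO psiS_isBigO
    refine ⟨C, max Y 1, fun z _ hz => ?_⟩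
    obtain ⟨τ, rfl⟩ := exists_coe (one_pos.trans_le ((le_max_right _ _).trans hz))
    rw [ofComplex_apply]
    refine (h τ ((le_max_left _ _).trans hz)).trans ?_
    rw [norm_nome]; rfl
  bound_k := by
    obtain ⟨C, Y, hC, h⟩ := exists_bound_of_isBigO psiI_isBigO_inv
    refine ⟨C, max Y 1, fun z _ hz => ?_⟩
    obtain ⟨τ, rfl⟩ := exists_coe (one_pos.trans_le ((le_max_right _ _).trans hz))
    rw [kernelB, ofComplex_apply]
    refine (h τ ((le_max_left _ _).trans hz)).trans ?_
    rw [norm_nome_pow_inv]; exact le_of_eq (by push_cast; rfl)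

end Leech
end

/-! ### Laplace transforms with a polar part and their continuation -/

noncomputable section
namespace Leech

open Complex Filter MeasureTheory Set Asymptotics

/-- The non-decaying part `c₄e^{4πt} + (c₂ + d₂t)e^{2πt} + c₀ + d₀t` of a kernel. -/
def polarPart (c₄ c₂ d₂ c₀ d₀ : ℂ) (t : ℝ) : ℂ :=
  c₄ * Real.exp (4 * π * t) + (c₂ + d₂ * t) * Real.exp (2 * π * t) + c₀ + d₀ * t

/-- `W` is the analytic continuation of `sin(πs/2)²` times the Laplace transform of `K`, whose
non-decaying part is given by the coefficients `c₄, c₂, d₂, c₀, d₀`. -/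
structure HasPolar (W : ℂ → ℂ) (K : ℝ → ℂ) (c₄ c₂ d₂ c₀ d₀ : ℂ) : Prop where
  analytic : ∀ s : ℝ, 0 ≤ s → AnalyticAt ℂ W s
  meas : AEStronglyMeasurable (fun t => K t - polarPart c₄ c₂ d₂ c₀ d₀ t)
    (volume.restrict (Ioi 0))
  -- The extra weight e^t makes the Laplace transform of the remainder analytic in a neighbourhood
  -- of each s ≥ 0, including s = 0.
  integrable : IntegrableOn (fun t => ‖K t - polarPart c₄ c₂ d₂ c₀ d₀ t‖ * Real.exp t) (Ioi 0)
  isBigO : (fun t => K t - polarPart c₄ c₂ d₂ c₀ d₀ t) =O[atTop] fun t => Real.exp (-2 * t)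
  eq_laplace : ∀ s : ℝ, 4 < s → W s = (Real.sin (π * s / 2) : ℂ) ^ 2 *
    ∫ t in Ioi (0 : ℝ), K t * Real.exp (-(π * s) * t)

section

variable {W : ℂ → ℂ} {K : ℝ → ℂ} {c₄ c₂ d₂ c₀ d₀ : ℂ}

/-- The Laplace transform of the decaying part of the kernel. -/
def remLaplace (K : ℝ → ℂ) (c₄ c₂ d₂ c₀ d₀ : ℂ) (ρ : ℂ) : ℂ :=
  ∫ t in Ioi (0 : ℝ), (K t - polarPart c₄ c₂ d₂ c₀ d₀ t) * cexp (π * I * ρ * (I * t))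

theorem HasPolar.remLaplace_analytic (h : HasPolar W K c₄ c₂ d₂ c₀ d₀) {s : ℝ} (hs : 0 ≤ s) :
    AnalyticAt ℂ (remLaplace K c₄ c₂ d₂ c₀ d₀) s := by
  refine analyticAt_integral_cexp (η := 1) measurableSet_Ioi one_pos (fun t ht => ?_) h.meas
    (Continuous.aestronglyMeasurable (by fun_prop)) ?_ hs
  · simpa using (le_of_lt ht : (0 : ℝ) ≤ t)
  · refine h.integrable.congr_fun (fun t ht => ?_) measurableSet_Ioi
    have : (0 : ℝ) < t := ht
    simp [abs_of_pos this]

theorem cexp_eq_real (s t : ℝ) : cexp (π * I * s * (I * t)) = Real.exp (-(π * s) * t) := by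
  rw [ofReal_exp]; congr 1; push_cast
  linear_combination (π * s * t : ℂ) * I_sq

theorem HasPolar.rem_integrable (h : HasPolar W K c₄ c₂ d₂ c₀ d₀) {s : ℝ} (hs : 0 ≤ s) :
    IntegrableOn (fun t => (K t - polarPart c₄ c₂ d₂ c₀ d₀ t) * Real.exp (-(π * s) * t))
      (Ioi 0) := by
  refine Integrable.mono' h.integrable (h.meas.mul
    (Continuous.aestronglyMeasurable (by fun_prop))) ?_
  refine (ae_restrict_iff' measurableSet_Ioi).mpr (Eventually.of_forall fun t ht => ?_)
  have ht : 0 < t := ht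
  rw [norm_mul, norm_real, Real.norm_of_nonneg (Real.exp_pos _).le]
  gcongr
  have := Real.pi_pos
  have h1 : 0 ≤ π * s * t := by positivity
  linarith

theorem integral_exp_neg_mul {a : ℝ} (ha : 0 < a) :
    ∫ t in Ioi (0 : ℝ), ((Real.exp (-a * t) : ℝ) : ℂ) = 1 / a := by
  rw [integral_complex_ofReal, integral_exp_mul_Ioi (by linarith)]
  push_cast; simp

theorem integrableOn_exp_neg_mul {a : ℝ} (ha : 0 < a) :
    IntegrableOn (fun t : ℝ => ((Real.exp (-a * t) : ℝ) : ℂ)) (Ioi 0) :=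
  (exp_neg_integrableOn_Ioi 0 ha).ofReal

theorem integrableOn_mul_exp_neg_mul {a : ℝ} (ha : 0 < a) :
    IntegrableOn (fun t : ℝ => (t : ℂ) * ((Real.exp (-a * t) : ℝ) : ℂ)) (Ioi 0) := by
  have := (integrableOn_rpow_mul_exp_neg_mul_rpow (s := 1) (p := 1) (b := a) (by norm_num) one_pos ha).ofReal (𝕜 := ℂ)
  refine IntegrableOn.congr_fun this (fun t ht => ?_) measurableSet_Ioi
  simp

theorem integral_mul_exp_neg_mul {a : ℝ} (ha : 0 < a) :
    ∫ t in Ioi (0 : ℝ), (t : ℂ) * ((Real.exp (-a * t) : ℝ) : ℂ) = 1 / a ^ 2 := by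
  have h := Real.integral_rpow_mul_exp_neg_mul_Ioi (a := 2) (r := a) two_pos ha
  rw [show Real.Gamma 2 = 1 by simp] at h
  have h1 : ∫ t in Ioi (0 : ℝ), t * Real.exp (-a * t) = 1 / a ^ 2 := by
    rw [mul_one, show (2 : ℝ) = (2 : ℕ) by norm_num, Real.rpow_natCast, one_div_pow] at h
    rw [← h]
    refine setIntegral_congr_fun measurableSet_Ioi fun t ht => ?_
    norm_num
  have h2 : ((∫ t in Ioi (0 : ℝ), t * Real.exp (-a * t) : ℝ) : ℂ) = ((1 / a ^ 2 : ℝ) : ℂ) := by rw [h1]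
  rw [← integral_complex_ofReal] at h2
  push_cast at h2 ⊢
  exact h2

/-- The continued Laplace transform. -/
def laplaceCont (K : ℝ → ℂ) (c₄ c₂ d₂ c₀ d₀ : ℂ) (ρ : ℂ) : ℂ :=
  c₄ / (π * (ρ - 4)) + c₂ / (π * (ρ - 2)) + d₂ / (π * (ρ - 2)) ^ 2 + c₀ / (π * ρ) +
    d₀ / (π * ρ) ^ 2 + remLaplace K c₄ c₂ d₂ c₀ d₀ ρ

/-- The five exponential integrals are elementary. If c₄ = 0 the integral already converges for s >
2, which is what makes ρ = 4 accessible for the Fourier transform of f. -/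
theorem HasPolar.laplace_eq (h : HasPolar W K c₄ c₂ d₂ c₀ d₀) {s : ℝ} (hs : 2 < s)
    (hc : c₄ = 0 ∨ 4 < s) :
    IntegrableOn (fun t => K t * Real.exp (-(π * s) * t)) (Ioi 0) ∧
    ∫ t in Ioi (0 : ℝ), K t * Real.exp (-(π * s) * t) = laplaceCont K c₄ c₂ d₂ c₀ d₀ s := by
  have hpi := Real.pi_pos
  have h₂ : 0 < π * (s - 2) := mul_pos hpi (by linarith)
  have h₀ : 0 < π * s := mul_pos hpi (by linarith)
  have hr := h.rem_integrable (s := s) (by linarith)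
  have i4 : IntegrableOn (fun t : ℝ => c₄ * ((Real.exp (-(π * (s - 4)) * t) : ℝ) : ℂ)) (Ioi 0) ∧
      ∫ t in Ioi (0 : ℝ), c₄ * ((Real.exp (-(π * (s - 4)) * t) : ℝ) : ℂ) = c₄ / (π * (s - 4)) := by
    rcases hc with rfl | h4
    · simp
    · have h₄ : 0 < π * (s - 4) := mul_pos hpi (by linarith)
      refine ⟨(integrableOn_exp_neg_mul h₄).const_mul _, ?_⟩
      rw [integral_const_mul, integral_exp_neg_mul h₄]
      push_cast; ring
  have i2 := (integrableOn_exp_neg_mul h₂).const_mul c₂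
  have j2 := (integrableOn_mul_exp_neg_mul h₂).const_mul d₂
  have i0 := (integrableOn_exp_neg_mul h₀).const_mul c₀
  have j0 := (integrableOn_mul_exp_neg_mul h₀).const_mul d₀
  have hK : ∀ t : ℝ, K t * Real.exp (-(π * s) * t) =
      c₄ * ((Real.exp (-(π * (s - 4)) * t) : ℝ) : ℂ) + c₂ * ((Real.exp (-(π * (s - 2)) * t) : ℝ) : ℂ)
      + d₂ * ((t : ℂ) * ((Real.exp (-(π * (s - 2)) * t) : ℝ) : ℂ))
      + c₀ * ((Real.exp (-(π * s) * t) : ℝ) : ℂ) + d₀ * ((t : ℂ) * ((Real.exp (-(π * s) * t) : ℝ) : ℂ))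
      + (K t - polarPart c₄ c₂ d₂ c₀ d₀ t) * Real.exp (-(π * s) * t) := by
    intro t
    have e4 : Real.exp (-(π * (s - 4)) * t) = Real.exp (4 * π * t) * Real.exp (-(π * s) * t) := by
      rw [← Real.exp_add]; ring_nf
    have e2 : Real.exp (-(π * (s - 2)) * t) = Real.exp (2 * π * t) * Real.exp (-(π * s) * t) := by
      rw [← Real.exp_add]; ring_nf
    rw [e4, e2, polarPart]
    push_cast; ring
  have I1 := i4.1.add i2
  have I2 := I1.add j2
  have I3 := I2.add i0
  have I4 := I3.add j0
  have I5 := I4.add hr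
  simp only [funext hK]
  refine ⟨I5, ?_⟩
  refine (integral_add' I4 hr).trans ?_
  rw [integral_add' I3 j0, integral_add' I2 i0, integral_add' I1 j2, integral_add' i4.1 i2]
  simp only [integral_const_mul c₂, integral_const_mul d₂, integral_const_mul c₀, integral_const_mul d₀]
  rw [i4.2, integral_exp_neg_mul h₂, integral_exp_neg_mul h₀, integral_mul_exp_neg_mul h₂,
    integral_mul_exp_neg_mul h₀, laplaceCont, remLaplace]
  simp only [cexp_eq_real]
  push_cast
  ring

theorem isPreconnected_nonneg : IsPreconnected ((fun x : ℝ => (x : ℂ)) '' Ici 0) :=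
  isPreconnected_Ici.image _ (by fun_prop)

theorem tendsto_ofReal_punctured (s : ℝ) :
    Tendsto (fun x : ℝ => (x : ℂ)) (𝓝[>] s) (𝓝[≠] (s : ℂ)) := by
  refine tendsto_nhdsWithin_iff.mpr ⟨?_, ?_⟩
  · exact (continuous_ofReal.tendsto s).mono_left nhdsWithin_le_nhds
  · filter_upwards [self_mem_nhdsWithin] with x hx
    simpa using (ne_of_gt hx : x ≠ s)

/-- Multiplying by ρ²(ρ-2)²(ρ-4) clears all the poles. Both sides are then analytic at each point of
[0, ∞) and agree beyond 5, so the identity theorem on this connected set applies. -/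
theorem HasPolar.eq_laplaceCont (h : HasPolar W K c₄ c₂ d₂ c₀ d₀) {s : ℝ} (hs : 0 < s)
    (h2 : s ≠ 2) (h4 : s ≠ 4) :
    W s = Complex.sin (π * s / 2) ^ 2 * laplaceCont K c₄ c₂ d₂ c₀ d₀ s := by
  have hpi : (π : ℂ) ≠ 0 := by exact_mod_cast Real.pi_ne_zero
  set F : ℂ → ℂ := fun ρ => ρ ^ 2 * (ρ - 2) ^ 2 * (ρ - 4) * W ρ with hF
  set G : ℂ → ℂ := fun ρ => Complex.sin (π * ρ / 2) ^ 2 *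
    (c₄ / π * (ρ ^ 2 * (ρ - 2) ^ 2) + c₂ / π * (ρ ^ 2 * (ρ - 2) * (ρ - 4)) +
      d₂ / π ^ 2 * (ρ ^ 2 * (ρ - 4)) + c₀ / π * (ρ * (ρ - 2) ^ 2 * (ρ - 4)) +
      d₀ / π ^ 2 * ((ρ - 2) ^ 2 * (ρ - 4)) +
      ρ ^ 2 * (ρ - 2) ^ 2 * (ρ - 4) * remLaplace K c₄ c₂ d₂ c₀ d₀ ρ) with hG
  have hFG : ∀ x : ℝ, 0 < x → x ≠ 2 → x ≠ 4 → G x = (x : ℂ) ^ 2 * (x - 2) ^ 2 * (x - 4) *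
      (Complex.sin (π * x / 2) ^ 2 * laplaceCont K c₄ c₂ d₂ c₀ d₀ x) := by
    intro x hx hx2 hx4
    have e0 : (x : ℂ) ≠ 0 := by exact_mod_cast hx.ne'
    have e2 : (x : ℂ) - 2 ≠ 0 := sub_ne_zero.mpr (by exact_mod_cast hx2)
    have e4 : (x : ℂ) - 4 ≠ 0 := sub_ne_zero.mpr (by exact_mod_cast hx4)
    simp only [hG, laplaceCont]
    field_simp
  have hFa : AnalyticOnNhd ℂ F ((fun x : ℝ => (x : ℂ)) '' Ici 0) := by
    rintro _ ⟨x, hx, rfl⟩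
    have := h.analytic x hx
    fun_prop
  have hGa : AnalyticOnNhd ℂ G ((fun x : ℝ => (x : ℂ)) '' Ici 0) := by
    rintro _ ⟨x, hx, rfl⟩
    have := h.remLaplace_analytic (s := x) hx
    have h3 : AnalyticAt ℂ (fun ρ : ℂ => Complex.sin (π * ρ / 2)) (x : ℂ) := by fun_prop
    fun_prop
  have hfreq : ∃ᶠ z in 𝓝[≠] ((5 : ℝ) : ℂ), F z = G z := by
    refine (tendsto_ofReal_punctured 5).frequently (Eventually.frequently ?_)
    filter_upwards [self_mem_nhdsWithin] with x hx
    have hx : 5 < x := hx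
    rw [hFG x (by linarith) (by linarith) (by linarith)]
    simp only [hF]
    rw [h.eq_laplace x (by linarith), (h.laplace_eq (s := x) (by linarith) (.inr (by linarith))).2]
    push_cast; rfl
  have := hFa.eqOn_of_preconnected_of_frequently_eq hGa isPreconnected_nonneg
    (z₀ := ((5 : ℝ) : ℂ)) ⟨5, by norm_num, rfl⟩ hfreq ⟨s, hs.le, rfl⟩
  simp only at this
  rw [hFG s hs h2 h4] at this
  have e0 : (s : ℂ) ≠ 0 := by exact_mod_cast hs.ne'
  have e2 : (s : ℂ) - 2 ≠ 0 := sub_ne_zero.mpr (by exact_mod_cast h2)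
  have e4 : (s : ℂ) - 4 ≠ 0 := sub_ne_zero.mpr (by exact_mod_cast h4)
  exact mul_left_cancel₀ (mul_ne_zero (mul_ne_zero (pow_ne_zero 2 e0) (pow_ne_zero 2 e2)) e4) this

end

end Leech
end

/-! ### Local behaviour at even integers -/

noncomputable section
namespace Leech

open Complex Filter MeasureTheory Set Asymptotics

/-- The even entire function with `sin(πw/2) = w · sineQuotient w`. -/
def sineQuotient : ℂ → ℂ := dslope (fun w => Complex.sin (π * w / 2)) 0

theorem mul_sineQuotient (w : ℂ) : w * sineQuotient w = Complex.sin (π * w / 2) := by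
  have := sub_smul_dslope (fun w => Complex.sin (π * w / 2)) 0 w
  simpa [sineQuotient] using this

theorem sineQuotient_differentiable : Differentiable ℂ sineQuotient := by
  have h : Differentiable ℂ fun w : ℂ => Complex.sin (π * w / 2) := by fun_prop
  exact differentiableOn_univ.mp
    ((Complex.differentiableOn_dslope univ_mem).mpr h.differentiableOn)

theorem sineQuotient_zero : sineQuotient 0 = π / 2 := by
  have h : HasDerivAt (fun w : ℂ => Complex.sin (π * w / 2)) (Complex.cos (π * 0 / 2) * (π / 2)) 0 :=
    HasDerivAt.csin (by simpa using ((hasDerivAt_id (0 : ℂ)).const_mul (π : ℂ)).div_const 2)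
  rw [sineQuotient, dslope_same, h.deriv]; simp

theorem sineQuotient_neg (w : ℂ) : sineQuotient (-w) = sineQuotient w := by
  rcases eq_or_ne w 0 with rfl | hw
  · simp
  · refine mul_left_cancel₀ hw ?_
    have h1 := mul_sineQuotient (-w)
    rw [show (π * -w / 2 : ℂ) = -(π * w / 2) by ring, Complex.sin_neg, ← mul_sineQuotient w] at h1
    linear_combination -h1

/-- An even function has zero derivative at 0. Hence sin² contributes only π²/4 to the value and to
the first derivative at a pole. -/
theorem hasDerivAt_sineQuotient : HasDerivAt sineQuotient 0 0 := by
  have h : HasDerivAt sineQuotient (deriv sineQuotient 0) 0 :=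
    (sineQuotient_differentiable 0).hasDerivAt
  have h1 : HasDerivAt (fun w => sineQuotient (-w)) (-deriv sineQuotient 0) 0 := by
    have := HasDerivAt.comp (0 : ℂ) (h₂ := sineQuotient) (h := fun w : ℂ => -w)
      (by rw [neg_zero]; exact h) (hasDerivAt_neg 0)
    simpa [Function.comp_def] using this
  simp only [sineQuotient_neg] at h1
  have h2 := h.unique h1
  have : deriv sineQuotient 0 = 0 := by linear_combination h2 / 2
  rwa [this] at h

/-- Local form of `sin(πρ/2)² T(ρ)` at an even integer where `T` has a pole of order at most two. -/
theorem local_form {W T : ℂ → ℂ} {A B : ℂ} (n : ℕ) (hW : AnalyticAt ℂ W (2 * n : ℝ))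
    (hT : AnalyticAt ℂ T (2 * n : ℝ))
    (h : ∀ᶠ x : ℝ in 𝓝[>] (2 * n : ℝ), W x = Complex.sin (π * x / 2) ^ 2 *
      (A / (x - 2 * n) ^ 2 + B / (x - 2 * n) + T x)) :
    W =ᶠ[𝓝 ((2 * n : ℝ) : ℂ)] fun ρ => sineQuotient (ρ - 2 * n) ^ 2 *
      (A + B * (ρ - 2 * n) + (ρ - 2 * n) ^ 2 * T ρ) := by
  have hS : AnalyticAt ℂ (fun ρ : ℂ => sineQuotient (ρ - 2 * n)) (2 * n : ℝ) :=
    (Differentiable.comp sineQuotient_differentiable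
      (by fun_prop : Differentiable ℂ fun ρ : ℂ => ρ - 2 * n)).analyticAt _
  refine (hW.frequently_eq_iff_eventually_eq (by fun_prop)).mp ?_
  refine (tendsto_ofReal_punctured _).frequently (Eventually.frequently ?_)
  filter_upwards [h, self_mem_nhdsWithin] with x hx hx2
  have hne : (x : ℂ) - 2 * n ≠ 0 := by
    have : x - 2 * n ≠ 0 := (sub_pos.mpr hx2).ne'
    exact_mod_cast this
  have hs : Complex.sin (π * x / 2) ^ 2 = ((x - 2 * n) * sineQuotient (x - 2 * n)) ^ 2 := by
    rw [mul_sineQuotient, show (π * (x - 2 * n) / 2 : ℂ) = π * x / 2 - n * π by ring,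
      Complex.sin_antiperiodic.sub_nat_mul_eq, mul_pow, ← pow_mul, mul_comm n 2, pow_mul]
    simp
  rw [hx, hs]
  field_simp

/-- The square of the sine quotient is π²/4 to first order, and the term with T is of second order,
so only A and B survive. -/
theorem local_values {W T : ℂ → ℂ} {A B : ℂ} (n : ℕ) (hT : AnalyticAt ℂ T (2 * n : ℝ))
    (h : W =ᶠ[𝓝 ((2 * n : ℝ) : ℂ)] fun ρ => sineQuotient (ρ - 2 * n) ^ 2 *
      (A + B * (ρ - 2 * n) + (ρ - 2 * n) ^ 2 * T ρ)) :
    W (2 * n : ℝ) = π ^ 2 / 4 * A ∧ HasDerivAt W (π ^ 2 / 4 * B) (2 * n : ℝ) := by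
  have e : ((2 * n : ℝ) : ℂ) - 2 * n = 0 := by push_cast; ring
  constructor
  · rw [h.eq_of_nhds]
    simp only [e, sineQuotient_zero]; ring
  · refine HasDerivAt.congr_of_eventuallyEq ?_ h
    have h1 : HasDerivAt (fun ρ : ℂ => ρ - 2 * n) 1 ((2 * n : ℝ) : ℂ) := (hasDerivAt_id _).sub_const _
    have h2 : HasDerivAt (fun ρ : ℂ => sineQuotient (ρ - 2 * n)) 0 ((2 * n : ℝ) : ℂ) := by
      have := HasDerivAt.comp ((2 * n : ℝ) : ℂ) (h₂ := sineQuotient) (by rw [e]; exact hasDerivAt_sineQuotient) h1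
      simpa [Function.comp_def] using this
    have h3 := (h2.pow 2).mul (((h1.const_mul B).const_add A).add
      ((h1.pow 2).mul hT.differentiableAt.hasDerivAt))
    refine h3.congr_deriv ?_
    simp only [Pi.pow_apply, Pi.mul_apply, Pi.add_apply, e, sineQuotient_zero]
    ring

section

variable {W : ℂ → ℂ} {K : ℝ → ℂ} {c₄ c₂ d₂ c₀ d₀ : ℂ}

theorem eventually_gt_ne (s a : ℝ) : ∀ᶠ x : ℝ in 𝓝[>] s, x ≠ a := by
  rcases eq_or_ne s a with rfl | h
  · filter_upwards [self_mem_nhdsWithin] with x hx using (ne_of_gt hx)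
  · exact (eventually_ne_nhds h).filter_mono nhdsWithin_le_nhds

theorem HasPolar.eventually_eq (h : HasPolar W K c₄ c₂ d₂ c₀ d₀) (n : ℕ) :
    ∀ᶠ x : ℝ in 𝓝[>] (2 * n : ℝ), W x = Complex.sin (π * x / 2) ^ 2 *
      laplaceCont K c₄ c₂ d₂ c₀ d₀ x := by
  filter_upwards [self_mem_nhdsWithin, eventually_gt_ne _ 2, eventually_gt_ne _ 4] with x hx h2 h4
  have hx : 2 * (n : ℝ) < x := hx
  exact h.eq_laplaceCont (lt_of_le_of_lt (by positivity) hx) h2 h4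

/-- The polar terms d₀/(πρ)² and c₀/(πρ) play the roles of A and B, everything else being regular at
0. At 2 the roles fall to d₂ and c₂; at 4 there is no double pole, so the value is 0. -/
theorem HasPolar.at_zero (h : HasPolar W K c₄ c₂ d₂ c₀ d₀) :
    W 0 = d₀ / 4 ∧ HasDerivAt W (π * c₀ / 4) 0 := by
  have hpi : (π : ℂ) ≠ 0 := by exact_mod_cast Real.pi_ne_zero
  have hR := h.remLaplace_analytic (s := 2 * (0 : ℕ)) (by norm_num)
  have hT : AnalyticAt ℂ (fun ρ : ℂ => c₄ / (π * (ρ - 4)) + c₂ / (π * (ρ - 2)) +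
      d₂ / (π * (ρ - 2)) ^ 2 + remLaplace K c₄ c₂ d₂ c₀ d₀ ρ) (2 * (0 : ℕ) : ℝ) := by
    refine (((AnalyticAt.div (by fun_prop) (by fun_prop) ?_).add
      (AnalyticAt.div (by fun_prop) (by fun_prop) ?_)).add
      (AnalyticAt.div (by fun_prop) (by fun_prop) ?_)).add hR <;> simp [hpi]
  have := local_values 0 hT (local_form (A := d₀ / π ^ 2) (B := c₀ / π) 0 (h.analytic _ (by norm_num)) hT (by
    filter_upwards [h.eventually_eq 0] with x hx
    rw [hx, laplaceCont]
    push_cast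
    ring))
  simp only [Nat.cast_zero, mul_zero, ofReal_zero] at this
  refine ⟨by rw [this.1]; field_simp, this.2.congr_deriv (by field_simp)⟩

theorem HasPolar.at_two (h : HasPolar W K c₄ c₂ d₂ c₀ d₀) :
    W 2 = d₂ / 4 ∧ HasDerivAt W (π * c₂ / 4) 2 := by
  have hpi : (π : ℂ) ≠ 0 := by exact_mod_cast Real.pi_ne_zero
  have hR := h.remLaplace_analytic (s := 2 * (1 : ℕ)) (by norm_num)
  have hT : AnalyticAt ℂ (fun ρ : ℂ => c₄ / (π * (ρ - 4)) + c₀ / (π * ρ) +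
      d₀ / (π * ρ) ^ 2 + remLaplace K c₄ c₂ d₂ c₀ d₀ ρ) (2 * (1 : ℕ) : ℝ) := by
    refine (((AnalyticAt.div (by fun_prop) (by fun_prop) ?_).add
      (AnalyticAt.div (by fun_prop) (by fun_prop) ?_)).add
      (AnalyticAt.div (by fun_prop) (by fun_prop) ?_)).add hR <;> norm_num [hpi]
  have := local_values 1 hT (local_form (A := d₂ / π ^ 2) (B := c₂ / π) 1 (h.analytic _ (by norm_num)) hT (by
    filter_upwards [h.eventually_eq 1] with x hx
    rw [hx, laplaceCont]
    norm_num only [Nat.cast_one, Nat.cast_ofNat]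
    simp only [div_mul_eq_div_div, mul_pow]
    ring))
  simp only [Nat.cast_one, mul_one, ofReal_ofNat] at this
  refine ⟨by rw [this.1]; field_simp, this.2.congr_deriv (by field_simp)⟩

theorem HasPolar.at_four (h : HasPolar W K c₄ c₂ d₂ c₀ d₀) :
    W 4 = 0 ∧ HasDerivAt W (π * c₄ / 4) 4 := by
  have hpi : (π : ℂ) ≠ 0 := by exact_mod_cast Real.pi_ne_zero
  have hR := h.remLaplace_analytic (s := 2 * (2 : ℕ)) (by norm_num)
  have hT : AnalyticAt ℂ (fun ρ : ℂ => c₂ / (π * (ρ - 2)) + d₂ / (π * (ρ - 2)) ^ 2 + c₀ / (π * ρ) +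
      d₀ / (π * ρ) ^ 2 + remLaplace K c₄ c₂ d₂ c₀ d₀ ρ) (2 * (2 : ℕ) : ℝ) := by
    refine ((((AnalyticAt.div (by fun_prop) (by fun_prop) ?_).add
      (AnalyticAt.div (by fun_prop) (by fun_prop) ?_)).add
      (AnalyticAt.div (by fun_prop) (by fun_prop) ?_)).add
      (AnalyticAt.div (by fun_prop) (by fun_prop) ?_)).add hR <;> norm_num [hpi]
  have := local_values 2 hT (local_form (A := 0) (B := c₄ / π) 2 (h.analytic _ (by norm_num)) hT (by
    filter_upwards [h.eventually_eq 2] with x hx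
    rw [hx, laplaceCont]
    norm_num only [Nat.cast_one, Nat.cast_ofNat]
    simp only [div_mul_eq_div_div, mul_pow]
    ring))
  have e : ((2 * (2 : ℕ) : ℝ) : ℂ) = 4 := by push_cast; norm_num
  rw [e] at this
  refine ⟨by rw [this.1]; ring, this.2.congr_deriv (by field_simp)⟩

/-- The double zeros of the continued function. -/
theorem HasPolar.double_zero (h : HasPolar W K c₄ c₂ d₂ c₀ d₀) {n : ℕ} (hn : 2 ≤ n)
    (hc : c₄ = 0 ∨ 3 ≤ n) : ∃ g : ℂ → ℂ, AnalyticAt ℂ g (2 * n : ℝ) ∧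
      g (2 * n : ℝ) = π ^ 2 / 4 * ∫ t in Ioi (0 : ℝ), K t * Real.exp (-(π * (2 * n)) * t) ∧
      W =ᶠ[𝓝 ((2 * n : ℝ) : ℂ)] fun ρ => (ρ - 2 * n) ^ 2 * g ρ := by
  have hpi : (π : ℂ) ≠ 0 := by exact_mod_cast Real.pi_ne_zero
  have hn' : (2 : ℝ) ≤ n := by exact_mod_cast hn
  have hR := h.remLaplace_analytic (s := 2 * n) (by positivity)
  have e0 : ((2 * n : ℝ) : ℂ) ≠ 0 := by exact_mod_cast (by linarith : (0 : ℝ) < 2 * n).ne'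
  have e2 : ((2 * n : ℝ) : ℂ) - 2 ≠ 0 := by
    exact_mod_cast (by linarith : (0 : ℝ) < 2 * n - 2).ne'
  have hc' : c₄ = 0 ∨ ((2 * n : ℝ) : ℂ) - 4 ≠ 0 := hc.imp_right fun h3 => by
    have : (3 : ℝ) ≤ n := by exact_mod_cast h3
    exact_mod_cast (by linarith : (0 : ℝ) < 2 * n - 4).ne'
  have hT : AnalyticAt ℂ (laplaceCont K c₄ c₂ d₂ c₀ d₀) (2 * n : ℝ) := by
    refine (((((?_ : AnalyticAt ℂ (fun ρ : ℂ => c₄ / (π * (ρ - 4))) _).add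
      (AnalyticAt.div (by fun_prop) (by fun_prop) ?_)).add
      (AnalyticAt.div (by fun_prop) (by fun_prop) ?_)).add
      (AnalyticAt.div (by fun_prop) (by fun_prop) ?_)).add
      (AnalyticAt.div (by fun_prop) (by fun_prop) ?_)).add hR
    · rcases hc' with rfl | h4
      · simpa using analyticAt_const
      · exact AnalyticAt.div (by fun_prop) (by fun_prop) (mul_ne_zero hpi h4)
    · exact mul_ne_zero hpi e2
    · exact pow_ne_zero _ (mul_ne_zero hpi e2)
    · exact mul_ne_zero hpi e0
    · exact pow_ne_zero _ (mul_ne_zero hpi e0)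
  -- Here the continued transform is regular, so the double zero of sin² is not cancelled.
  have hl := local_form (A := 0) (B := 0) n (h.analytic _ (by positivity)) hT (by
    filter_upwards [h.eventually_eq n] with x hx
    rw [hx]; ring)
  have hS : AnalyticAt ℂ (fun ρ : ℂ => sineQuotient (ρ - 2 * n)) (2 * n : ℝ) :=
    (Differentiable.comp sineQuotient_differentiable
      (by fun_prop : Differentiable ℂ fun ρ : ℂ => ρ - 2 * n)).analyticAt _
  refine ⟨fun ρ => sineQuotient (ρ - 2 * n) ^ 2 * laplaceCont K c₄ c₂ d₂ c₀ d₀ ρ,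
    by fun_prop, ?_, ?_⟩
  · have e : ((2 * n : ℝ) : ℂ) - 2 * n = 0 := by push_cast; ring
    have := (h.laplace_eq (s := 2 * n)
      (by linarith) (hc.imp_right fun h3 => by
        have : (3 : ℝ) ≤ n := by exact_mod_cast h3
        linarith)).2
    simp only [e, sineQuotient_zero, ← this]; ring
  · filter_upwards [hl] with ρ hρ
    rw [hρ]; ring

end

end Leech
end

/-! ### Polar parts of the two kernels on the imaginary axis -/

noncomputable section
namespace Leech

open UpperHalfPlane hiding I
open Complex Filter MeasureTheory Set Asymptotics

section

variable {W W' : ℂ → ℂ} {K K' : ℝ → ℂ} {c₄ c₂ d₂ c₀ d₀ c₄' c₂' d₂' c₀' d₀' : ℂ}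

theorem HasPolar.laplace_integrable (h : HasPolar W K c₄ c₂ d₂ c₀ d₀) {s : ℝ} (hs : 4 < s) :
    IntegrableOn (fun t => K t * Real.exp (-(π * s) * t)) (Ioi 0) :=
  (h.laplace_eq (by linarith) (.inr hs)).1

theorem HasPolar.const_mul (h : HasPolar W K c₄ c₂ d₂ c₀ d₀) (c : ℂ) :
    HasPolar (fun ρ => c * W ρ) (fun t => c * K t) (c * c₄) (c * c₂) (c * d₂) (c * c₀) (c * d₀) where
  analytic s hs := analyticAt_const.mul (h.analytic s hs)
  meas := (h.meas.const_mul c).congr (Eventually.of_forall fun t => by simp only [polarPart]; ring)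
  integrable := by
    refine (h.integrable.const_mul ‖c‖).congr (Eventually.of_forall fun t => ?_)
    simp only
    rw [← mul_assoc, ← norm_mul]
    congr 2
    simp only [polarPart]; ring
  isBigO := (h.isBigO.const_mul_left c).congr_left fun t => by simp only [polarPart]; ring
  eq_laplace s hs := by
    rw [h.eq_laplace s hs]
    simp only [mul_assoc]
    rw [integral_const_mul]; ring

theorem HasPolar.add (h : HasPolar W K c₄ c₂ d₂ c₀ d₀)
    (h' : HasPolar W' K' c₄' c₂' d₂' c₀' d₀') :
    HasPolar (fun ρ => W ρ + W' ρ) (fun t => K t + K' t) (c₄ + c₄') (c₂ + c₂') (d₂ + d₂')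
      (c₀ + c₀') (d₀ + d₀') where
  analytic s hs := (h.analytic s hs).add (h'.analytic s hs)
  meas := (h.meas.add h'.meas).congr
    (Eventually.of_forall fun t => by simp only [polarPart, Pi.add_apply]; ring)
  integrable := by
    refine (h.integrable.add h'.integrable).mono' ?_ (Eventually.of_forall fun t => ?_)
    · refine AEStronglyMeasurable.mul (AEStronglyMeasurable.norm ((h.meas.add h'.meas).congr
        (Eventually.of_forall fun t => ?_))) (Continuous.aestronglyMeasurable (by fun_prop))
      simp only [polarPart, Pi.add_apply]; ring
    · rw [norm_mul, norm_norm, Real.norm_of_nonneg (Real.exp_pos _).le, Pi.add_apply, ← add_mul]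
      gcongr
      refine le_trans (le_of_eq ?_) (norm_add_le _ _)
      congr 1
      simp only [polarPart]; ring
  isBigO := (h.isBigO.add h'.isBigO).congr_left fun t => by simp only [polarPart]; ring
  eq_laplace s hs := by
    rw [h.eq_laplace s hs, h'.eq_laplace s hs, ← mul_add,
      ← integral_add (h.laplace_integrable hs) (h'.laplace_integrable hs)]
    simp only [add_mul]

end

theorem IsKernel.continuousOn_axis {k g : ℂ → ℂ} {ε : ℂ} (h : IsKernel k g ε) :
    ContinuousOn (fun t : ℝ => k (I * t)) (Ioi 0) :=
  h.diff_k.continuousOn.comp (by fun_prop) fun t ht => by simpa using ht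

/-- By inversion k(it) is, up to sign, t^{10} g(i/t), and g is bounded above height 1. -/
theorem IsKernel.axis_bound {k g : ℂ → ℂ} {ε : ℂ} (h : IsKernel k g ε) :
    ∃ C : ℝ, ∀ t ∈ Ioc (0 : ℝ) 1, ‖k (I * t)‖ ≤ C := by
  obtain ⟨C, hC0, hC⟩ := h.exists_bound_g
  refine ⟨C, fun t ht => ?_⟩
  have ht0 : 0 < t := ht.1
  have ht1 : 1 ≤ t⁻¹ := (one_le_inv₀ ht0).mpr ht.2
  have e1 : -1 / (I * (t⁻¹ : ℝ) : ℂ) = I * t := by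
    have : (t : ℂ) ≠ 0 := by exact_mod_cast ht0.ne'
    push_cast; field_simp; simp
  have h1 := h.k_inv (I * (t⁻¹ : ℝ)) (by simpa using ht0)
  rw [e1] at h1
  rw [h1, norm_mul, norm_inv, norm_pow, norm_mul, norm_I, one_mul, norm_real,
    Real.norm_of_nonneg (by positivity)]
  have h2 := hC (I * (t⁻¹ : ℝ)) (by simp) (by simp; linarith)
  have h3 : Real.exp (-π * (I * (t⁻¹ : ℝ)).im) ≤ 1 := by
    rw [Real.exp_le_one_iff]
    have := Real.pi_pos
    have h4 : 0 < π * t⁻¹ := by positivity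
    simp; linarith
  calc _ ≤ (C * 1) * 1 := by
        gcongr
        · exact h2.trans (by gcongr)
        · exact inv_le_one_of_one_le₀ (one_le_pow₀ ht1)
    _ = C := by ring

/-- A contour kernel has a continued Laplace transform. -/
theorem IsKernel.hasPolar {k g : ℂ → ℂ} {ε : ℂ} (h : IsKernel k g ε) {c₄ c₂ d₂ c₀ d₀ : ℂ}
    (hrem : (fun t : ℝ => k (I * t) - polarPart c₄ c₂ d₂ c₀ d₀ t) =O[atTop]
      fun t => Real.exp (-2 * t)) :
    HasPolar (fun ρ => I / 4 * contourIntegral g ε ρ) (fun t => k (I * t)) c₄ c₂ d₂ c₀ d₀ := by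
  have hpolar : Continuous (polarPart c₄ c₂ d₂ c₀ d₀) := by
    unfold polarPart; fun_prop
  have hcont : ContinuousOn (fun t : ℝ => k (I * t) - polarPart c₄ c₂ d₂ c₀ d₀ t) (Ioi 0) :=
    h.continuousOn_axis.sub hpolar.continuousOn
  have hcont' : ContinuousOn (fun t : ℝ => ‖k (I * t) - polarPart c₄ c₂ d₂ c₀ d₀ t‖ * Real.exp t)
      (Ioi 0) := hcont.norm.mul (by fun_prop)
  refine ⟨fun s hs => analyticAt_const.mul (h.contour_analytic hs),
    hcont.aestronglyMeasurable measurableSet_Ioi, ?_, hrem, fun s hs => ?_⟩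
  · rw [← Ioc_union_Ioi_eq_Ioi zero_le_one]
    refine IntegrableOn.union ?_ ?_
    · obtain ⟨C, hC⟩ := h.axis_bound
      obtain ⟨B, hB⟩ := (isCompact_Icc (a := (0 : ℝ)) (b := 1)).exists_bound_of_continuousOn
        hpolar.continuousOn
      refine IntegrableOn.of_bound (by simp)
        ((hcont'.mono Ioc_subset_Ioi_self).aestronglyMeasurable measurableSet_Ioc)
        ((C + B) * Real.exp 1) ?_
      refine (ae_restrict_iff' measurableSet_Ioc).mpr (Eventually.of_forall fun t ht => ?_)
      rw [norm_mul, norm_norm, Real.norm_of_nonneg (Real.exp_pos _).le]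
      have h1 := (norm_sub_le _ _).trans (add_le_add (hC t ht) (hB t ⟨ht.1.le, ht.2⟩))
      exact mul_le_mul h1 (Real.exp_le_exp.mpr ht.2) (Real.exp_pos _).le ((norm_nonneg _).trans h1)
    · refine (((hcont'.mono (Ici_subset_Ioi.mpr one_pos)).locallyIntegrableOn
        measurableSet_Ici).integrableOn_of_isBigO_atTop (g := fun t => Real.exp (-1 * t)) ?_
        ⟨Ioi 0, Ioi_mem_atTop 0, exp_neg_integrableOn_Ioi 0 one_pos⟩).mono_set Ioi_subset_Ici_self
      refine (hrem.norm_left.mul (isBigO_refl (fun t : ℝ => Real.exp t) atTop)).congr_right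
        fun t => ?_
      rw [← Real.exp_add]; congr 1; ring
  · rw [h.contour_eq hs, integral_mul_const]
    simp only [cexp_eq_real]
    linear_combination (-(Real.sin (π * s / 2) : ℂ) ^ 2 *
      ∫ t in Ioi (0 : ℝ), k (I * t) * Real.exp (-(π * s) * t)) * I_sq

/-- The point `it` of the upper half plane. -/
def axis (t : ℝ) : ℍ := ofComplex (I * t)

theorem coe_axis {t : ℝ} (ht : 0 < t) : (axis t : ℂ) = I * t := by
  rw [axis, ofComplex_apply_of_im_pos (by simpa using ht)]

theorem axis_im {t : ℝ} (ht : 0 < t) : (axis t).im = t := by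
  rw [← coe_im, coe_axis ht]; simp

theorem tendsto_axis : Tendsto axis atTop atImInfty := by
  rw [atImInfty, tendsto_comap_iff]
  refine tendsto_id.congr' ?_
  filter_upwards [eventually_gt_atTop 0] with t ht
  simp [axis_im ht]

theorem nome_axis {t : ℝ} (ht : 0 < t) : nome (axis t) = Real.exp (-π * t) := by
  rw [nome, coe_axis ht, ofReal_exp]
  congr 1; push_cast
  linear_combination (π * t : ℂ) * I_sq

theorem nome_axis_inv {t : ℝ} (ht : 0 < t) (n : ℕ) :
    (nome (axis t) ^ n)⁻¹ = Real.exp (n * π * t) := by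
  rw [nome_axis ht, ← ofReal_pow, ← ofReal_inv, ← Real.exp_nat_mul, ← Real.exp_neg]
  congr 2; ring

theorem isBigO_axis {f : ℍ → ℂ} {n : ℕ} (h : f =O[atImInfty] fun z => nome z ^ n) :
    (fun t => f (axis t)) =O[atTop] fun t : ℝ => Real.exp (-(n * π) * t) := by
  refine (h.comp_tendsto tendsto_axis).trans (IsBigO.of_bound' ?_)
  filter_upwards [eventually_gt_atTop 0] with t ht
  rw [Function.comp_apply, norm_nome_pow, axis_im ht, Real.norm_of_nonneg (Real.exp_pos _).le]

theorem exp_isBigO_exp {a b : ℝ} (h : b ≤ a) :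
    (fun t : ℝ => Real.exp (-a * t)) =O[atTop] fun t => Real.exp (-b * t) := by
  refine IsBigO.of_bound' ?_
  filter_upwards [eventually_gt_atTop 0] with t ht
  rw [Real.norm_of_nonneg (Real.exp_pos _).le, Real.norm_of_nonneg (Real.exp_pos _).le,
    Real.exp_le_exp]
  nlinarith

theorem sq_mul_exp_isBigO : (fun t : ℝ => t ^ 2 * Real.exp (-(2 * π) * t)) =O[atTop]
    fun t => Real.exp (-2 * t) := by
  have h1 : (fun t : ℝ => t ^ 2) =O[atTop] fun t => Real.exp t :=
    (Real.isLittleO_pow_exp_atTop (n := 2)).isBigO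
  refine ((h1.mul (isBigO_refl (fun t : ℝ => Real.exp (-(2 * π) * t)) atTop)).congr_right
    (fun t => (Real.exp_add _ _).symm)).trans ?_
  refine ((exp_isBigO_exp (a := 2 * π - 1) (b := 2) (by linarith [Real.pi_gt_three]))).congr_left
    fun t => ?_
  congr 1; ring

/-- The transform of `a`. -/
theorem hasPolar_A : HasPolar
    (fun ρ => I / 4 * contourIntegral (fun z => phi (ofComplex z)) 1 ρ) (fun t => kernelA (I * t))
    (864 / π ^ 2) (2218752 / π ^ 2) (-725760 / π) (223140096 / π ^ 2) (-113218560 / π) := by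
  refine isKernel_A.hasPolar ?_
  have b0 := isBigO_axis phi_isBigO
  have b1 := isBigO_axis phi₁_isBigO
  have b2 := isBigO_axis phi₂_isBigO
  simp only [Nat.cast_ofNat] at b0 b1 b2
  have hsq : (fun t : ℝ => ((t : ℂ)) ^ 2) =O[atTop] fun t : ℝ => t ^ 2 :=
    IsBigO.of_bound' (Eventually.of_forall fun t => by simp)
  have hone : (fun _ : ℝ => (1 : ℝ)) =O[atTop] fun t : ℝ => t ^ 2 := by
    refine IsBigO.of_bound' ?_
    filter_upwards [eventually_ge_atTop 1] with t ht
    rw [norm_one, Real.norm_of_nonneg (sq_nonneg t)]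
    nlinarith
  have hlin : (fun t : ℝ => I * (t : ℂ)) =O[atTop] fun t : ℝ => t ^ 2 := by
    refine IsBigO.of_bound' ?_
    filter_upwards [eventually_ge_atTop 1] with t ht
    rw [norm_mul, norm_I, one_mul, norm_real, Real.norm_of_nonneg (by linarith),
      Real.norm_of_nonneg (sq_nonneg t)]
    nlinarith
  -- On z = it the three terms of φz² + φ₁z + φ₂ become -t²φ, itφ₁ and φ₂; the factor t² at most
  -- weakens the decay e^{-2πt} to e^{-2t}.
  have r0 := ((hsq.mul b0).trans sq_mul_exp_isBigO).neg_left
  have r1 := (hlin.mul b1).trans sq_mul_exp_isBigO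
  have r2 := ((hone.mul b2.norm_left).trans sq_mul_exp_isBigO)
  simp only [one_mul] at r2
  refine ((r0.add r1).add r2.of_norm_left).congr' ?_ (Eventually.of_forall fun _ => rfl)
  filter_upwards [eventually_gt_atTop 0] with t ht
  have hpi : (π : ℂ) ≠ 0 := by exact_mod_cast Real.pi_ne_zero
  rw [← coe_axis ht, kernelA_coe, coe_axis ht, nome_axis_inv ht, nome_axis_inv ht, polarPart]
  push_cast
  linear_combination (-phi (axis t) * t ^ 2 -
    (t : ℂ) / π * (725760 * cexp (2 * π * t) + 113218560)) * I_sq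

/-- The transform of `b`. -/
theorem hasPolar_B : HasPolar
    (fun ρ => I / 4 * contourIntegral (fun z => psiS (ofComplex z)) (-1) ρ)
    (fun t => kernelB (I * t)) 2 (-464) 0 172128 0 := by
  refine isKernel_B.hasPolar ?_
  have b := isBigO_axis (n := 1) (psiI_isBigO.congr_right fun z => (pow_one _).symm)
  refine (b.trans (exp_isBigO_exp (b := 2) (by push_cast; linarith [Real.pi_gt_three]))).congr' ?_
    (Eventually.of_forall fun _ => rfl)
  filter_upwards [eventually_gt_atTop 0] with t ht
  rw [← coe_axis ht, kernelB, ofComplex_apply, nome_axis_inv ht, nome_axis_inv ht, polarPart]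
  push_cast
  ring

end Leech
end

/-! ### The function f, its Fourier transform, and the passage from ρ to r -/

noncomputable section
namespace Leech

open UpperHalfPlane hiding I
open Complex Filter MeasureTheory Set

/-- The combination of transforms whose pullback under `ρ = r²` is `f` (`δ = 1`) or `f̂` (`δ = -1`). -/
def magic (δ ρ : ℂ) : ℂ :=
  -4 * I * -(π * I / 113218560) *
      (I / 4 * contourIntegral (fun z => phi (ofComplex z)) 1 ρ) +
    -4 * I * -(δ * (I / (262080 * π))) *
      (I / 4 * contourIntegral (fun z => psiS (ofComplex z)) (-1) ρ)

/-- The kernel of `magic`. -/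
def magicKernel (δ : ℂ) (t : ℝ) : ℂ :=
  -4 * I * -(π * I / 113218560) * kernelA (I * t) +
    -4 * I * -(δ * (I / (262080 * π))) * kernelB (I * t)

/-- These five coefficients determine all the special values. The relation d₀ = 4 normalizes the
value at 0 to 1, d₂ = 1/39 gives the value 1/156 at ρ = 2, and c₄ is proportional to 1 + δ, so it
vanishes exactly for the Fourier transform: hence its double root at r = 2, where f has a simple
one. The factors -4i only undo the i/4 in `IsKernel.hasPolar`. -/
theorem magic_hasPolar (δ : ℂ) : HasPolar (magic δ) (magicKernel δ)
    (-(1 + δ) / (32760 * π)) ((-321 + 29 * δ) / (4095 * π)) (1 / 39)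
    ((-10761 - 3586 * δ) / (1365 * π)) 4 := by
  have hpi : (π : ℂ) ≠ 0 := by exact_mod_cast Real.pi_ne_zero
  have e1 : -4 * I * -(π * I / 113218560) = -(π / 28304640 : ℂ) := by
    linear_combination (4 * π / 113218560 : ℂ) * I_sq
  have e2 : -4 * I * -(δ * (I / (262080 * π))) = -(δ / (65520 * π)) := by
    field_simp
    linear_combination (262080 * δ) * I_sq
  have h := (hasPolar_A.const_mul (-4 * I * -(π * I / 113218560))).add
    (hasPolar_B.const_mul (-4 * I * -(δ * (I / (262080 * π)))))
  have k4 : -4 * I * -(π * I / 113218560) * (864 / π ^ 2) + -4 * I * -(δ * (I / (262080 * π))) * 2 =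
      -(1 + δ) / (32760 * π) := by
    rw [e1, e2]; field_simp; ring
  have k2 : -4 * I * -(π * I / 113218560) * (2218752 / π ^ 2) +
      -4 * I * -(δ * (I / (262080 * π))) * -464 = (-321 + 29 * δ) / (4095 * π) := by
    rw [e1, e2]; field_simp; ring
  have l2 : -4 * I * -(π * I / 113218560) * (-725760 / π) +
      -4 * I * -(δ * (I / (262080 * π))) * 0 = 1 / 39 := by
    rw [e1]; field_simp; norm_num; ring
  have k0 : -4 * I * -(π * I / 113218560) * (223140096 / π ^ 2) +
      -4 * I * -(δ * (I / (262080 * π))) * 172128 = (-10761 - 3586 * δ) / (1365 * π) := by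
    rw [e1, e2]; field_simp; ring
  have l0 : -4 * I * -(π * I / 113218560) * (-113218560 / π) +
      -4 * I * -(δ * (I / (262080 * π))) * 0 = 4 := by
    rw [e1]; field_simp; norm_num; ring
  rw [k4, k2, l2, k0, l0] at h
  exact h

theorem magic_eq (δ ρ : ℂ) : magic δ ρ =
    -(π * I / 113218560) * contourIntegral (fun z => phi (ofComplex z)) 1 ρ -
      δ * (I / (262080 * π)) * contourIntegral (fun z => psiS (ofComplex z)) (-1) ρ := by
  rw [magic]
  linear_combination ((π * I / 113218560) * contourIntegral (fun z => phi (ofComplex z)) 1 ρ +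
      δ * (I / (262080 * π)) * contourIntegral (fun z => psiS (ofComplex z)) (-1) ρ) * I_sq

theorem aIntegral_eq {r : ℝ} (hr : 2 < r) :
    aIntegral r = contourIntegral (fun z => phi (ofComplex z)) 1 ((r : ℂ) ^ 2) := by
  have h := isKernel_A.contour_eq (ρ := r ^ 2) (by nlinarith)
  rw [aIntegral, imagAxisIntegral]
  push_cast at h ⊢
  rw [h]
  simp only [kernelA]

theorem bIntegral_eq {r : ℝ} (hr : 2 < r) :
    bIntegral r = contourIntegral (fun z => psiS (ofComplex z)) (-1) ((r : ℂ) ^ 2) := by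
  have h := isKernel_B.contour_eq (ρ := r ^ 2) (by nlinarith)
  rw [bIntegral, imagAxisIntegral]
  push_cast at h ⊢
  rw [h]
  simp only [kernelB]

theorem analyticAt_comp_sq {W : ℂ → ℂ} (hW : ∀ s : ℝ, 0 ≤ s → AnalyticAt ℂ W s) (r : ℝ) :
    AnalyticAt ℝ (fun r : ℝ => W ((r : ℂ) ^ 2)) r := by
  have h1 : AnalyticAt ℝ W ((r : ℂ) ^ 2) := by
    have := (hW (r ^ 2) (sq_nonneg r)).restrictScalars (𝕜 := ℝ)
    simpa using this
  have h2 : AnalyticAt ℝ (fun r : ℝ => (r : ℂ) ^ 2) r :=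
    (ofRealCLM.analyticAt r).pow 2
  exact AnalyticAt.fun_comp (g := W) (f := fun r : ℝ => (r : ℂ) ^ 2) h1 h2

theorem isAnalyticContinuation_unique {h g g' : ℝ → ℂ} (hg : IsAnalyticContinuation h g)
    (hg' : IsAnalyticContinuation h g') : g = g' := by
  refine hg.analytic.eq_of_eventuallyEq (z₀ := 3) hg'.analytic ?_
  filter_upwards [lt_mem_nhds (show (2 : ℝ) < 3 by norm_num)] with r hr
  rw [hg.eq_of_two_lt r hr, hg'.eq_of_two_lt r hr]

theorem aIntegral_continuation : IsAnalyticContinuation aIntegral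
    (fun r : ℝ => contourIntegral (fun z => phi (ofComplex z)) 1 ((r : ℂ) ^ 2)) where
  analytic r _ := analyticAt_comp_sq (fun _ hs => isKernel_A.contour_analytic hs) r
  eq_of_two_lt _ hr := (aIntegral_eq hr).symm

theorem bIntegral_continuation : IsAnalyticContinuation bIntegral
    (fun r : ℝ => contourIntegral (fun z => psiS (ofComplex z)) (-1) ((r : ℂ) ^ 2)) where
  analytic r _ := analyticAt_comp_sq (fun _ hs => isKernel_B.contour_analytic hs) r
  eq_of_two_lt _ hr := (bIntegral_eq hr).symm

theorem auxFunction_eq {a b : ℝ → ℂ} (ha : IsAnalyticContinuation aIntegral a)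
    (hb : IsAnalyticContinuation bIntegral b) :
    auxFunction a b = fun r : ℝ => magic 1 ((r : ℂ) ^ 2) := by
  ext r
  rw [isAnalyticContinuation_unique ha aIntegral_continuation,
    isAnalyticContinuation_unique hb bIntegral_continuation, auxFunction, magic_eq]
  ring

/-- The φ part has Fourier eigenvalue 1 and the ψ part eigenvalue -1, so the transform changes the
sign of δ. -/
theorem radialFourier_magic : radialFourier (fun r : ℝ => magic 1 ((r : ℂ) ^ 2)) =
    fun r : ℝ => magic (-1) ((r : ℂ) ^ 2) := by
  ext r
  have h := ((isKernel_A.fourier_contour.const_mul (-(π * I / 113218560))).add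
    (isKernel_B.fourier_contour.const_mul (-(I / (262080 * π))))).fourier_eq
      (EuclideanSpace.single 0 r)
  rw [radialFourier]
  have e : (fun x : EuclideanSpace ℝ (Fin 24) => magic 1 ((‖x‖ : ℂ) ^ 2)) = _ := funext fun x => by
    rw [magic_eq, one_mul, sub_eq_add_neg, ← neg_mul]
  rw [e, h, magic_eq]
  have hn : ((‖(EuclideanSpace.single 0 r : E24)‖ : ℝ) : ℂ) ^ 2 = (r : ℂ) ^ 2 := by
    rw [PiLp.norm_single, ← ofReal_pow, ← ofReal_pow, Real.norm_eq_abs, sq_abs]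
  rw [hn]
  ring

section

variable {W W' : ℂ → ℂ} {c c' : ℂ}

theorem hasDerivAt_comp_sq {r : ℝ} (h : HasDerivAt W c ((r : ℂ) ^ 2)) :
    HasDerivAt (fun r : ℝ => W ((r : ℂ) ^ 2)) (2 * r * c) r := by
  have h1 : HasDerivAt (fun z : ℂ => W (z ^ 2)) (c * (2 * (r : ℂ))) (r : ℂ) := by
    have := HasDerivAt.comp (r : ℂ) (h₂ := W) (h := fun z : ℂ => z ^ 2) h
      (by simpa using hasDerivAt_pow 2 (r : ℂ))
    simpa [Function.comp_def] using this
  exact h1.comp_ofReal.congr_deriv (by ring)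

/-- The first derivative is 2rW'(r²), so its derivative at 0 is 2W'(0): the coefficient of r² is
W'(0). -/
theorem iteratedDeriv_two_comp_sq (hW : ∀ s : ℝ, 0 ≤ s → AnalyticAt ℂ W s)
    (h : HasDerivAt W c 0) :
    iteratedDeriv 2 (fun r : ℝ => W ((r : ℂ) ^ 2)) 0 = 2 * c := by
  have h1 : deriv (fun r : ℝ => W ((r : ℂ) ^ 2)) = fun r : ℝ => 2 * (r : ℂ) * deriv W ((r : ℂ) ^ 2) := by
    ext r
    have h2 : AnalyticAt ℂ W ((r : ℂ) ^ 2) := by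
      have := hW (r ^ 2) (sq_nonneg r)
      simpa using this
    exact (hasDerivAt_comp_sq h2.differentiableAt.hasDerivAt).deriv
  rw [iteratedDeriv_succ, iteratedDeriv_one, h1]
  have h3 : HasDerivAt (fun r : ℝ => 2 * (r : ℂ)) 2 0 := by
    simpa using ((hasDerivAt_id (0 : ℝ)).ofReal_comp).const_mul (2 : ℂ)
  have h4 : HasDerivAt (deriv W) (deriv (deriv W) 0) (((0 : ℝ) : ℂ) ^ 2) := by
    have := (hW 0 le_rfl).deriv.differentiableAt.hasDerivAt
    simpa using this
  have h5 := h3.mul (hasDerivAt_comp_sq h4)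
  refine h5.deriv.trans ?_
  simp [h.deriv]

/-- Near r₀ = √(2n) > 0 one has (r² - 2n)² = (r - r₀)²(r + r₀)² with r + r₀ ≠ 0, so the order is
preserved under ρ = r². -/
theorem order_two_comp_sq (hW : ∀ s : ℝ, 0 ≤ s → AnalyticAt ℂ W s) {n : ℕ} (hn : 0 < n) {g : ℂ → ℂ}
    (hg : AnalyticAt ℂ g (2 * n : ℝ)) (hg0 : g (2 * n : ℝ) ≠ 0)
    (h : W =ᶠ[𝓝 ((2 * n : ℝ) : ℂ)] fun ρ => (ρ - 2 * n) ^ 2 * g ρ) :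
    analyticOrderAt (fun r : ℝ => W ((r : ℂ) ^ 2)) (Real.sqrt (2 * n)) = 2 := by
  set r₀ := Real.sqrt (2 * n) with hr₀
  have hsq : r₀ ^ 2 = 2 * n := Real.sq_sqrt (by positivity)
  have hpos : 0 < r₀ := Real.sqrt_pos.mpr (by positivity)
  have hcast : ((r₀ : ℂ)) ^ 2 = ((2 * n : ℝ) : ℂ) := by rw [← hsq]; push_cast; rfl
  refine (analyticAt_comp_sq hW r₀).analyticOrderAt_eq_natCast (n := 2) |>.mpr
    ⟨fun r => ((r : ℂ) + r₀) ^ 2 * g ((r : ℂ) ^ 2), ?_, ?_, ?_⟩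
  · have h1 : AnalyticAt ℝ g ((r₀ : ℂ) ^ 2) := by
      rw [hcast]; exact hg.restrictScalars
    have h2 : AnalyticAt ℝ (fun r : ℝ => (r : ℂ)) r₀ := ofRealCLM.analyticAt r₀
    exact ((h2.add analyticAt_const).pow 2).mul (h1.comp_of_eq (h2.pow 2) rfl)
  · refine mul_ne_zero (pow_ne_zero 2 ?_) (by rw [hcast]; exact hg0)
    exact_mod_cast (by linarith : (0 : ℝ) < r₀ + r₀).ne'
  · have h1 : Tendsto (fun r : ℝ => (r : ℂ) ^ 2) (𝓝 r₀) (𝓝 ((2 * n : ℝ) : ℂ)) := by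
      rw [← hcast]
      exact Continuous.tendsto (by fun_prop) r₀
    filter_upwards [h1.eventually h] with r hr
    rw [hr, real_smul]
    have : (2 * n : ℂ) = (r₀ : ℂ) ^ 2 := by rw [hcast]; push_cast; rfl
    rw [this]
    push_cast
    ring

end

end Leech
end

/-! ### Modular forms restricted to the imaginary axis -/

noncomputable section
namespace Leech

open UpperHalfPlane hiding I
open Complex ModularForm ModularGroup Filter Set Asymptotics Derivative
open scoped ArithmeticFunction.sigma MatrixGroups Manifold

local notation "E₂" => EisensteinSeries.E2

/-- Along z = it the derivative d/dt is -2π times the normalized derivative, so modular differential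
identities become real ones. -/
theorem hasDerivAt_axis {f : ℍ → ℂ} (hf : MDiff f) {t : ℝ} (ht : 0 < t) :
    HasDerivAt (fun t : ℝ => (f (axis t)).re) (-2 * π * (D f (axis t)).re) t := by
  have h1 : DifferentiableAt ℂ (f ∘ ofComplex) (I * t) :=
    (UpperHalfPlane.mdifferentiable_iff.mp hf).differentiableAt
      (isOpen_im_pos.mem_nhds (by simpa using ht))
  have h2 : HasDerivAt (fun t : ℝ => I * (t : ℂ)) I t := by
    simpa using ((hasDerivAt_id t).ofReal_comp).const_mul I
  have h3 : HasDerivAt (fun t : ℝ => f (axis t)) (deriv (f ∘ ofComplex) (I * t) * I) t :=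
    HasDerivAt.comp (h₂ := f ∘ ofComplex) (h := fun t : ℝ => I * (t : ℂ)) t h1.hasDerivAt h2
  have h4 : HasDerivAt (fun t : ℝ => (f (axis t)).re) (deriv (f ∘ ofComplex) (I * t) * I).re t :=
    reCLM.hasFDerivAt.comp_hasDerivAt t h3
  refine h4.congr_deriv ?_
  have hpi : (π : ℂ) ≠ 0 := by exact_mod_cast Real.pi_ne_zero
  have h5 : deriv (f ∘ ofComplex) (I * t) * I = ((-2 * π : ℝ) : ℂ) * D f (axis t) := by
    rw [normalizedDerivOfComplex, coe_axis ht]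
    push_cast
    field_simp
    linear_combination (deriv (f ∘ ofComplex) (I * t)) * I_sq
  rw [h5, re_ofReal_mul]

theorem axis_real_of_hasSum {f : ℍ → ℂ} {c : ℕ → ℝ}
    (hf : ∀ τ : ℍ, HasSum (fun m => (c m : ℂ) * (nome τ ^ 2) ^ m) (f τ)) {t : ℝ} (ht : 0 < t) :
    HasSum (fun m => c m * Real.exp (-(2 * π * m) * t)) (f (axis t)).re ∧
      ((f (axis t)).re : ℂ) = f (axis t) := by
  have h := hf (axis t)
  have e : ∀ m : ℕ, (c m : ℂ) * (nome (axis t) ^ 2) ^ m =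
      ((c m * Real.exp (-(2 * π * m) * t) : ℝ) : ℂ) := fun m => by
    rw [nome_axis ht, ← ofReal_pow, ← ofReal_pow, ← Real.exp_nat_mul, ← Real.exp_nat_mul, ofReal_mul]
    congr 3; push_cast; ring
  simp only [e] at h
  have h1 := Complex.hasSum_re h
  simp only [ofReal_re] at h1
  exact ⟨h1, (Complex.hasSum_ofReal.mpr h1).unique h⟩

theorem E2_hasSum (τ : ℍ) : HasSum (fun m : ℕ =>
    (((if m = 0 then 1 else -24 * (σ 1 m : ℝ)) : ℝ) : ℂ) * (nome τ ^ 2) ^ m) (E₂ τ) := by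
  have h := EisensteinSeries.hasSum_qExpansion_E2 (z := τ)
  refine h.congr_fun fun m => ?_
  rw [← qParam_one_eq]
  simp only [Function.Periodic.qParam, ofReal_one, div_one, smul_eq_mul]
  split_ifs <;> simp

theorem E4_hasSum (τ : ℍ) : HasSum (fun m : ℕ =>
    (((if m = 0 then 1 else 240 * (σ 3 m : ℝ)) : ℝ) : ℂ) * (nome τ ^ 2) ^ m) (E₄ τ) := by
  have h := ModularForm.hasSum_qExpansion E₄ one_pos one_mem_strictPeriods_SL τ
  refine h.congr_fun fun m => ?_
  rw [← qParam_one_eq, EisensteinSeries.E_qExpansion_coeff _ ⟨2, rfl⟩]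
  split_ifs
  · simp
  · norm_num [show bernoulli 4 = -1 / 30 by decide +kernel]

theorem E6_hasSum (τ : ℍ) : HasSum (fun m : ℕ =>
    (((if m = 0 then 1 else -504 * (σ 5 m : ℝ)) : ℝ) : ℂ) * (nome τ ^ 2) ^ m) (E₆ τ) := by
  have h := ModularForm.hasSum_qExpansion E₆ one_pos one_mem_strictPeriods_SL τ
  refine h.congr_fun fun m => ?_
  rw [← qParam_one_eq, EisensteinSeries.E_qExpansion_coeff _ ⟨3, rfl⟩]
  split_ifs
  · simp
  · norm_num [show bernoulli 6 = 1 / 42 by decide +kernel]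

/-- The Eisenstein series `E₂` on the imaginary axis. -/
def e2 (t : ℝ) : ℝ := (E₂ (axis t)).re
/-- The Eisenstein series `E₄` on the imaginary axis. -/
def e4 (t : ℝ) : ℝ := (E₄ (axis t)).re
/-- The Eisenstein series `E₆` on the imaginary axis. -/
def e6 (t : ℝ) : ℝ := (E₆ (axis t)).re
/-- The theta function `H₂` on the imaginary axis. -/
def h2 (t : ℝ) : ℝ := (H₂ (axis t)).re
/-- The theta function `H₄` on the imaginary axis. -/
def h4 (t : ℝ) : ℝ := (H₄ (axis t)).re

theorem E2_axis {t : ℝ} (ht : 0 < t) : E₂ (axis t) = e2 t := (axis_real_of_hasSum E2_hasSum ht).2.symm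
theorem E4_axis {t : ℝ} (ht : 0 < t) : E₄ (axis t) = e4 t := (axis_real_of_hasSum E4_hasSum ht).2.symm
theorem E6_axis {t : ℝ} (ht : 0 < t) : E₆ (axis t) = e6 t := (axis_real_of_hasSum E6_hasSum ht).2.symm

/-- All nonconstant coefficients of E₂ are negative and each e^{-2πmt} decreases in t. For
`e4_antitone` the coefficients are positive. -/
theorem e2_monotone : MonotoneOn e2 (Ioi 0) := by
  intro s hs t ht hst
  refine hasSum_le (fun m => ?_) (axis_real_of_hasSum E2_hasSum hs).1
    (axis_real_of_hasSum E2_hasSum ht).1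
  split_ifs with hm
  · simp [hm]
  · have h1 : Real.exp (-(2 * π * m) * t) ≤ Real.exp (-(2 * π * m) * s) := by
      have : 0 ≤ 2 * π * m := by positivity
      exact Real.exp_le_exp.mpr (by nlinarith)
    have h2 : (0 : ℝ) ≤ 24 * (σ 1 m : ℝ) := by positivity
    nlinarith

theorem e4_antitone : AntitoneOn e4 (Ioi 0) := by
  intro s hs t ht hst
  refine hasSum_le (fun m => ?_) (axis_real_of_hasSum E4_hasSum ht).1
    (axis_real_of_hasSum E4_hasSum hs).1
  split_ifs with hm
  · simp [hm]
  · have h1 : Real.exp (-(2 * π * m) * t) ≤ Real.exp (-(2 * π * m) * s) := by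
      have : 0 ≤ 2 * π * m := by positivity
      exact Real.exp_le_exp.mpr (by nlinarith)
    have h2 : (0 : ℝ) ≤ 240 * (σ 3 m : ℝ) := by positivity
    nlinarith

theorem theta10_axis {t : ℝ} (ht : 0 < t) : ∃ x : ℝ, 0 < x ∧ theta10 (axis t) = x := by
  have e : ∀ n : ℤ, cexp (π * I * ((n : ℂ) + 1 / 2) ^ 2 * axis t) =
      ((Real.exp (-π * (n + 1 / 2) ^ 2 * t) : ℝ) : ℂ) := fun n => by
    rw [coe_axis ht, ofReal_exp]
    congr 1; push_cast
    linear_combination (π * ((n : ℂ) + 1 / 2) ^ 2 * t : ℂ) * I_sq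
  have hs : Summable fun n : ℤ => cexp (π * I * ((n : ℂ) + 1 / 2) ^ 2 * axis t) := by
    have h := ((summable_jacobiTheta₂_term_iff ((axis t : ℂ) / 2) (axis t)).mpr
      (axis t).im_pos).mul_left (cexp (π * I * axis t / 4))
    refine h.congr fun n => ?_
    rw [jacobiTheta₂_term, ← Complex.exp_add]
    congr 1; ring
  simp only [e] at hs
  refine ⟨∑' n : ℤ, Real.exp (-π * (n + 1 / 2) ^ 2 * t),
    (Complex.summable_ofReal.mp hs).tsum_pos (fun n => (Real.exp_pos _).le) 0 (Real.exp_pos _), ?_⟩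
  rw [theta10]
  simp only [e]
  rw [← ofReal_tsum]

theorem axis_inv {t : ℝ} (ht : 0 < t) : axis t⁻¹ = S • axis t := by
  ext
  rw [coe_S_smul, coe_axis (inv_pos.mpr ht), coe_axis ht]
  have : (t : ℂ) ≠ 0 := by exact_mod_cast ht.ne'
  push_cast; field_simp; simp

theorem H2_axis_pos {t : ℝ} (ht : 0 < t) : 0 < h2 t ∧ H₂ (axis t) = h2 t := by
  obtain ⟨x, hx, h⟩ := theta10_axis ht
  have e : H₂ (axis t) = ((x ^ 4 : ℝ) : ℂ) := by rw [H₂, h]; push_cast; rfl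
  rw [h2, e, ofReal_re]
  exact ⟨by positivity, rfl⟩

/-- The series of Θ₀₁ alternates, so positivity is transported from H₂ through t ↦ 1/t. -/
theorem H4_axis_pos {t : ℝ} (ht : 0 < t) : 0 < h4 t ∧ H₄ (axis t) = h4 t := by
  have h1 := H₂_S (axis t)
  obtain ⟨hp, he⟩ := H2_axis_pos (inv_pos.mpr ht)
  have ht0 : (t : ℂ) ≠ 0 := by exact_mod_cast ht.ne'
  rw [← axis_inv ht, he, coe_axis ht] at h1
  have e : H₄ (axis t) = ((h2 t⁻¹ / t ^ 2 : ℝ) : ℂ) := by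
    push_cast
    generalize ((h2 t⁻¹ : ℝ) : ℂ) = y at h1
    field_simp
    linear_combination -h1 + (t : ℂ) ^ 2 * H₄ (axis t) * I_sq
  rw [h4, e, ofReal_re]
  exact ⟨by positivity, rfl⟩

end Leech
end

/-! ### Monotonicity of the ratio of the numerators -/

noncomputable section
namespace Leech

open UpperHalfPlane hiding I
open Complex ModularForm ModularGroup Filter Set Asymptotics Derivative
open scoped Manifold

local notation "E₂" => EisensteinSeries.E2

theorem antitoneOn_of_hasDerivAt_nonpos {f f' : ℝ → ℝ} (hf : ∀ t, 0 < t → HasDerivAt f (f' t) t)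
    (hf' : ∀ t, 0 < t → f' t ≤ 0) : AntitoneOn f (Ioi 0) := by
  refine antitoneOn_of_deriv_nonpos (convex_Ioi 0)
    (fun t ht => (hf t ht).continuousAt.continuousWithinAt) ?_ ?_
  · rw [interior_Ioi]
    exact fun t ht => (hf t ht).differentiableAt.differentiableWithinAt
  · rw [interior_Ioi]
    intro t ht
    rw [(hf t ht).deriv]
    exact hf' t ht

theorem AntitoneOn.nonneg_of_tendsto_zero {f : ℝ → ℝ} (hf : AntitoneOn f (Ioi 0))
    (hl : Tendsto f atTop (𝓝 0)) {t : ℝ} (ht : 0 < t) : 0 ≤ f t := by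
  refine le_of_tendsto hl ?_
  filter_upwards [eventually_ge_atTop t] with s hs
  exact hf ht (ht.trans_le hs) hs

theorem AntitoneOn.hasDerivAt_nonpos {f : ℝ → ℝ} (hf : AntitoneOn f (Ioi 0)) {t f' : ℝ} (ht : 0 < t)
    (h : HasDerivAt f f' t) : f' ≤ 0 := by
  have h1 := hf.derivWithin_nonpos (x := t)
  rwa [derivWithin_of_isOpen isOpen_Ioi ht, h.deriv] at h1

variable {t : ℝ}

theorem e4_eq (ht : 0 < t) : e4 t = h2 t ^ 2 + h2 t * h4 t + h4 t ^ 2 := by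
  have h := E4_eq_theta (axis t)
  rw [E4_axis ht, (H2_axis_pos ht).2, (H4_axis_pos ht).2] at h
  exact_mod_cast h

theorem e4_pos (ht : 0 < t) : 0 < e4 t := by
  have h1 := (H2_axis_pos ht).1
  have h2 := (H4_axis_pos ht).1
  rw [e4_eq ht]; positivity

theorem E4_axis_ne_zero (ht : 0 < t) : E₄ (axis t) ≠ 0 := by
  rw [E4_axis ht]; exact_mod_cast (e4_pos ht).ne'

theorem hasDerivAt_e2 (ht : 0 < t) : HasDerivAt e2 (-2 * π * ((e2 t ^ 2 - e4 t) / 12)) t := by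
  refine (hasDerivAt_axis E2_mdiff ht).congr_deriv ?_
  rw [D_E2, E2_axis ht, E4_axis ht]
  norm_cast

theorem hasDerivAt_e4 (ht : 0 < t) : HasDerivAt e4 (-2 * π * ((e2 t * e4 t - e6 t) / 3)) t := by
  refine (hasDerivAt_axis E4_mdiff ht).congr_deriv ?_
  rw [D_E4, E2_axis ht, E4_axis ht, E6_axis ht]
  norm_cast

theorem hasDerivAt_e6 (ht : 0 < t) : HasDerivAt e6 (-2 * π * ((e2 t * e6 t - e4 t ^ 2) / 2)) t := by
  refine (hasDerivAt_axis E6_mdiff ht).congr_deriv ?_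
  rw [D_E6, E2_axis ht, E4_axis ht, E6_axis ht]
  norm_cast

theorem hasDerivAt_h2 (ht : 0 < t) :
    HasDerivAt h2 (-2 * π * ((e2 t * h2 t + h2 t ^ 2 + 2 * h2 t * h4 t) / 6)) t := by
  refine (hasDerivAt_axis H₂_mdiff ht).congr_deriv ?_
  rw [D_H₂ _ (E4_axis_ne_zero ht), E2_axis ht, (H2_axis_pos ht).2, (H4_axis_pos ht).2]
  norm_cast

theorem hasDerivAt_h4 (ht : 0 < t) :
    HasDerivAt h4 (-2 * π * ((e2 t * h4 t - 2 * h2 t * h4 t - h4 t ^ 2) / 6)) t := by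
  refine (hasDerivAt_axis H₄_mdiff ht).congr_deriv ?_
  rw [D_H₄ _ (E4_axis_ne_zero ht), E2_axis ht, (H2_axis_pos ht).2, (H4_axis_pos ht).2]
  norm_cast

/-- Differentiating the theta expression of E₄ and comparing with Ramanujan's formula solves for E₆.
-/
theorem e6_eq (ht : 0 < t) : e6 t =
    -(2 * h2 t ^ 3 + 3 * h2 t ^ 2 * h4 t - 3 * h2 t * h4 t ^ 2 - 2 * h4 t ^ 3) / 2 := by
  have h1 := (((hasDerivAt_h2 ht).pow 2).add ((hasDerivAt_h2 ht).mul (hasDerivAt_h4 ht))).add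
    ((hasDerivAt_h4 ht).pow 2)
  have h2' : e4 =ᶠ[𝓝 t] h2 ^ 2 + h2 * h4 + h4 ^ 2 := by
    filter_upwards [lt_mem_nhds ht] with s hs
    exact e4_eq hs
  have h3 := (hasDerivAt_e4 ht).unique (h1.congr_of_eventuallyEq h2')
  have h4' := e4_eq ht
  have hpi : 2 * π ≠ 0 := by positivity
  apply mul_left_cancel₀ hpi
  norm_num at h3
  linear_combination 3 * h3 + 2 * π * e2 t * h4'

theorem e4_cube_sub_e6_sq (ht : 0 < t) :
    e4 t ^ 3 - e6 t ^ 2 = 27 / 4 * (h2 t * h4 t * (h2 t + h4 t)) ^ 2 := by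
  rw [e4_eq ht, e6_eq ht]; ring

theorem tendsto_re_axis {f : ℍ → ℂ} {c : ℝ} (h : Tendsto f atImInfty (𝓝 c)) :
    Tendsto (fun t => (f (axis t)).re) atTop (𝓝 c) := by
  exact (Complex.continuous_re.tendsto _).comp (h.comp tendsto_axis)

theorem e2_tendsto : Tendsto e2 atTop (𝓝 1) := tendsto_re_axis (by simpa using E2_tendsto)
theorem e4_tendsto : Tendsto e4 atTop (𝓝 1) := tendsto_re_axis (by simpa using E4_tendsto)
theorem e6_tendsto : Tendsto e6 atTop (𝓝 1) := tendsto_re_axis (by simpa using E6_tendsto)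
theorem h2_tendsto : Tendsto h2 atTop (𝓝 0) := tendsto_re_axis (by simpa using H₂_tendsto)
theorem h4_tendsto : Tendsto h4 atTop (𝓝 1) := tendsto_re_axis (by simpa using H₄_tendsto)

/-- Ramanujan's identity makes E₄ - E₂² a positive multiple of dE₂/dt, which is nonnegative by
monotonicity. The next inequality reads the derivative of E₄ the same way. -/
theorem e2_sq_le_e4 (ht : 0 < t) : e2 t ^ 2 ≤ e4 t := by
  have h1 : AntitoneOn (-e2) (Ioi 0) := e2_monotone.neg
  have h2 := AntitoneOn.hasDerivAt_nonpos h1 ht (hasDerivAt_e2 ht).neg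
  have := Real.pi_pos
  by_contra! h
  nlinarith [mul_pos this (sub_pos.mpr h)]

theorem e6_le_mul (ht : 0 < t) : e6 t ≤ e2 t * e4 t := by
  have h2 := AntitoneOn.hasDerivAt_nonpos e4_antitone ht (hasDerivAt_e4 ht)
  have := Real.pi_pos
  by_contra! h
  nlinarith [mul_pos this (sub_pos.mpr h)]

/-- The quasimodular form that, times `E₄³ - E₆²`, is the inhomogeneous term in the second-order
differential equation of `numA`. -/
def quasi (t : ℝ) : ℝ := 5 * e4 t ^ 2 + 2 * e2 t * e6 t - 7 * e2 t ^ 2 * e4 t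

/-- Its t-derivative is -7π times the product of the two nonnegative quantities E₄ - E₂² and E₂E₄ -
E₆. It thus decreases to its limit 5 + 2 - 7 = 0. -/
theorem quasi_nonneg (ht : 0 < t) : 0 ≤ quasi t := by
  refine AntitoneOn.nonneg_of_tendsto_zero (antitoneOn_of_hasDerivAt_nonpos
    (f' := fun t => -(7 * π) * ((e4 t - e2 t ^ 2) * (e2 t * e4 t - e6 t))) (fun t ht => ?_)
      fun t ht => ?_) ?_ ht
  · exact (((((hasDerivAt_e4 ht).pow 2).const_mul 5).add (((hasDerivAt_e2 ht).const_mul 2).mul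
      (hasDerivAt_e6 ht))).sub ((((hasDerivAt_e2 ht).pow 2).const_mul 7).mul
        (hasDerivAt_e4 ht))).congr_deriv (by simp only [Pi.pow_apply]; ring)
  · have := mul_nonneg (sub_nonneg.mpr (e2_sq_le_e4 ht)) (sub_nonneg.mpr (e6_le_mul ht))
    have := Real.pi_pos
    nlinarith [mul_nonneg this.le ‹0 ≤ (e4 t - e2 t ^ 2) * (e2 t * e4 t - e6 t)›]
  · have := (((e4_tendsto.pow 2).const_mul 5).add ((e2_tendsto.const_mul 2).mul e6_tendsto)).sub
      (((e2_tendsto.pow 2).const_mul 7).mul e4_tendsto)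
    norm_num at this
    exact this

/-- Minus the numerator of `φ` on the imaginary axis. -/
def numA (t : ℝ) : ℝ := -(25 * e4 t ^ 4 - 49 * e6 t ^ 2 * e4 t + 48 * e6 t * e4 t ^ 2 * e2 t +
  (-49 * e4 t ^ 3 + 25 * e6 t ^ 2) * e2 t ^ 2)

/-- The Serre derivative of `numA`. -/
def numA₁ (t : ℝ) : ℝ := -(49 / 3) * e6 t ^ 3 - 35 / 3 * (e4 t ^ 3 * e6 t) +
  133 / 3 * (e2 t * e4 t * e6 t ^ 2) + 35 / 3 * (e2 t * e4 t ^ 4) - 28 * (e2 t ^ 2 * e4 t ^ 2 * e6 t)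

/-- Minus the numerator of `ψ_S` on the imaginary axis. -/
def numB (t : ℝ) : ℝ := h2 t ^ 5 * (7 * h4 t ^ 2 + 7 * (h2 t * h4 t) + 2 * h2 t ^ 2)

/-- The Serre derivative of `numB`. -/
def numB₁ (t : ℝ) : ℝ := h2 t ^ 5 * (28 / 3 * h4 t ^ 3 + 14 * (h2 t * h4 t ^ 2) +
  28 / 3 * (h2 t ^ 2 * h4 t) + 7 / 3 * h2 t ^ 3)

theorem hasDerivAt_numA (ht : 0 < t) :
    HasDerivAt numA (-2 * π * (numA₁ t + 14 / 12 * e2 t * numA t)) t := by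
  have hp := hasDerivAt_e2 ht
  have hq := hasDerivAt_e4 ht
  have hr := hasDerivAt_e6 ht
  exact (((((hq.pow 4).const_mul 25).sub (((hr.pow 2).const_mul 49).mul hq)).add
    (((hr.const_mul 48).mul (hq.pow 2)).mul hp)).add
      ((((hq.pow 3).const_mul (-49)).add ((hr.pow 2).const_mul 25)).mul (hp.pow 2))).neg.congr_deriv
    (by simp only [numA, numA₁, Pi.pow_apply, Pi.mul_apply, Pi.add_apply]; ring)

/-- The second Serre derivative of A in weight 14 is (14/9)E₄A plus a nonnegative term. The number
14/9 = 14·16/144 belongs to the Kaneko–Zagier equation, which B satisfies without the extra term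
(`hasDerivAt_numB₁`). -/
theorem hasDerivAt_numA₁ (ht : 0 < t) : HasDerivAt numA₁ (-2 * π * (14 / 9 * e4 t * numA t +
    35 / 4 * (e4 t ^ 3 - e6 t ^ 2) * quasi t + 16 / 12 * e2 t * numA₁ t)) t := by
  have hp := hasDerivAt_e2 ht
  have hq := hasDerivAt_e4 ht
  have hr := hasDerivAt_e6 ht
  exact (((((hr.pow 3).const_mul (-(49 / 3))).sub (((hq.pow 3).mul hr).const_mul (35 / 3))).add
    (((hp.mul hq).mul (hr.pow 2)).const_mul (133 / 3))).add
      ((hp.mul (hq.pow 4)).const_mul (35 / 3))).sub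
        ((((hp.pow 2).mul (hq.pow 2)).mul hr).const_mul 28) |>.congr_deriv
    (by simp only [numA, numA₁, quasi, Pi.pow_apply, Pi.mul_apply]; ring)

theorem hasDerivAt_numB (ht : 0 < t) :
    HasDerivAt numB (-2 * π * (numB₁ t + 14 / 12 * e2 t * numB t)) t := by
  have hx := hasDerivAt_h2 ht
  have hy := hasDerivAt_h4 ht
  exact ((hx.pow 5).mul ((((hy.pow 2).const_mul 7).add ((hx.mul hy).const_mul 7)).add
    ((hx.pow 2).const_mul 2))).congr_deriv
    (by simp only [numB, numB₁, Pi.pow_apply, Pi.mul_apply, Pi.add_apply]; ring)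

theorem hasDerivAt_numB₁ (ht : 0 < t) :
    HasDerivAt numB₁ (-2 * π * (14 / 9 * e4 t * numB t + 16 / 12 * e2 t * numB₁ t)) t := by
  have hx := hasDerivAt_h2 ht
  have hy := hasDerivAt_h4 ht
  exact ((hx.pow 5).mul (((((hy.pow 3).const_mul (28 / 3)).add
    ((hx.mul (hy.pow 2)).const_mul 14)).add (((hx.pow 2).mul hy).const_mul (28 / 3))).add
    ((hx.pow 3).const_mul (7 / 3)))).congr_deriv
    (by rw [e4_eq ht]; simp only [numB, numB₁, Pi.pow_apply, Pi.mul_apply, Pi.add_apply]; ring)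

theorem numB_pos (ht : 0 < t) : 0 < numB t := by
  have h1 := (H2_axis_pos ht).1
  have h2 := (H4_axis_pos ht).1
  rw [numB]; positivity

/-- The square root of the discriminant, up to a constant. -/
def weber (t : ℝ) : ℝ := h2 t * h4 t * (h2 t + h4 t)

theorem weber_pos (ht : 0 < t) : 0 < weber t := by
  have h1 := (H2_axis_pos ht).1
  have h2 := (H4_axis_pos ht).1
  rw [weber]; positivity

theorem hasDerivAt_weber (ht : 0 < t) : HasDerivAt weber (-2 * π * (e2 t * weber t / 2)) t := by
  have hx := hasDerivAt_h2 ht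
  have hy := hasDerivAt_h4 ht
  exact ((hx.mul hy).mul (hx.add hy)).congr_deriv
    (by simp only [weber, Pi.mul_apply, Pi.add_apply]; ring)

theorem numA_tendsto : Tendsto numA atTop (𝓝 0) := by
  have hp := e2_tendsto
  have hq := e4_tendsto
  have hr := e6_tendsto
  have := (((((hq.pow 4).const_mul 25).sub (((hr.pow 2).const_mul 49).mul hq)).add
    (((hr.const_mul 48).mul (hq.pow 2)).mul hp)).add
      ((((hq.pow 3).const_mul (-49)).add ((hr.pow 2).const_mul 25)).mul (hp.pow 2))).neg
  norm_num at this
  exact this.congr fun t => by rw [numA]; ring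

theorem numA₁_tendsto : Tendsto numA₁ atTop (𝓝 0) := by
  have hp := e2_tendsto
  have hq := e4_tendsto
  have hr := e6_tendsto
  have := (((((hr.pow 3).const_mul (-(49 / 3))).sub (((hq.pow 3).mul hr).const_mul (35 / 3))).add
    (((hp.mul hq).mul (hr.pow 2)).const_mul (133 / 3))).add
      ((hp.mul (hq.pow 4)).const_mul (35 / 3))).sub
        ((((hp.pow 2).mul (hq.pow 2)).mul hr).const_mul 28)
  norm_num at this
  exact this.congr fun t => by rw [numA₁]; ring

theorem numB_div_tendsto : Tendsto (fun t => numB t / weber t ^ 5) atTop (𝓝 7) := by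
  have hx := h2_tendsto
  have hy := h4_tendsto
  have := ((((hy.pow 2).const_mul 7).add ((hx.mul hy).const_mul 7)).add
    ((hx.pow 2).const_mul 2)).div ((hy.mul (hx.add hy)).pow 5) (by norm_num)
  norm_num at this
  refine this.congr' ?_
  filter_upwards [eventually_gt_atTop 0] with t ht
  have h1 := (H2_axis_pos ht).1
  have h2 := (H4_axis_pos ht).1
  simp only [numB, weber, Pi.div_apply]; field_simp

theorem numB₁_div_tendsto : Tendsto (fun t => numB₁ t / weber t ^ 5) atTop (𝓝 (28 / 3)) := by
  have hx := h2_tendsto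
  have hy := h4_tendsto
  have := (((((hy.pow 3).const_mul (28 / 3)).add
    ((hx.mul (hy.pow 2)).const_mul 14)).add (((hx.pow 2).mul hy).const_mul (28 / 3))).add
    ((hx.pow 3).const_mul (7 / 3))).div ((hy.mul (hx.add hy)).pow 5) (by norm_num)
  norm_num at this
  refine this.congr' ?_
  filter_upwards [eventually_gt_atTop 0] with t ht
  have h1 := (H2_axis_pos ht).1
  have h2 := (H4_axis_pos ht).1
  simp only [numB₁, weber, Pi.div_apply]; field_simp

/-- The Wronskian has weight 30, the weight of `weber`⁵, so in the quotient the E₂ terms of the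
derivative cancel. The E₄ terms cancel because A and B share the homogeneous equation. What is left
of the derivative is minus a nonnegative term, so the quotient decreases to its limit. That limit is
0: A and A₁ tend to 0, while `weber`⁵ contains the same factor H₂⁵ as B and B₁. -/
theorem wronskian_nonneg (ht : 0 < t) : 0 ≤ numA₁ t * numB t - numA t * numB₁ t := by
  have key : 0 ≤ (numA₁ t * numB t - numA t * numB₁ t) / weber t ^ 5 := by
    refine AntitoneOn.nonneg_of_tendsto_zero (f := fun t => (numA₁ t * numB t - numA t * numB₁ t) /
      weber t ^ 5) (antitoneOn_of_hasDerivAt_nonpos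
      (f' := fun t => -(2 * π) * (35 / 4 * (e4 t ^ 3 - e6 t ^ 2) * quasi t * numB t / weber t ^ 5))
      (fun t ht => ?_) fun t ht => ?_) ?_ ht
    · have hw := weber_pos ht
      refine ((((hasDerivAt_numA₁ ht).mul (hasDerivAt_numB ht)).sub
        ((hasDerivAt_numA ht).mul (hasDerivAt_numB₁ ht))).div ((hasDerivAt_weber ht).pow 5)
          (pow_pos hw 5).ne').congr_deriv ?_
      simp only [Pi.pow_apply, Pi.mul_apply, Pi.sub_apply]
      field_simp
      ring
    · have hw := weber_pos ht
      have hB := numB_pos ht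
      have hX := quasi_nonneg ht
      have hd : 0 ≤ e4 t ^ 3 - e6 t ^ 2 := by rw [e4_cube_sub_e6_sq ht]; positivity
      rw [neg_mul, neg_nonpos]
      positivity
    · have := (numA₁_tendsto.mul numB_div_tendsto).sub (numA_tendsto.mul numB₁_div_tendsto)
      norm_num at this
      exact this.congr fun t => by ring
  have := weber_pos ht
  have h5 : 0 < weber t ^ 5 := by positivity
  rwa [le_div_iff₀ h5, zero_mul] at key

theorem ratio_antitone : AntitoneOn (fun t => numA t / numB t) (Ioi 0) := by
  refine antitoneOn_of_hasDerivAt_nonpos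
      (f' := fun t => -(2 * π) * ((numA₁ t * numB t - numA t * numB₁ t) / numB t ^ 2))
      (fun t ht => ?_) fun t ht => ?_
  · have hB := numB_pos ht
    refine ((hasDerivAt_numA ht).div (hasDerivAt_numB ht) hB.ne').congr_deriv ?_
    field_simp
    ring
  · have hB := numB_pos ht
    have hL := wronskian_nonneg ht
    rw [neg_mul, neg_nonpos]
    positivity

end Leech
end

/-! ### Signs of the kernels and nonvanishing of the Laplace integrals -/

noncomputable section
namespace Leech

open UpperHalfPlane hiding I
open Complex ModularForm ModularGroup Filter Set Asymptotics MeasureTheory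

local notation "E₂" => EisensteinSeries.E2

theorem tendsto_exp_poly {a : ℝ} (n : ℕ) (ha : 0 < a) :
    Tendsto (fun t : ℝ => ((t : ℂ) ^ n * Real.exp (-a * t) : ℂ)) atTop (𝓝 0) := by
  have h := (Real.tendsto_pow_mul_exp_neg_atTop_nhds_zero n).comp (tendsto_id.const_mul_atTop ha)
  have h2 := (h.const_mul ((a ^ n)⁻¹)).ofReal
  rw [mul_zero, ofReal_zero] at h2
  refine h2.congr fun t => ?_
  have : (a : ℂ) ≠ 0 := by exact_mod_cast ha.ne'
  simp only [Function.comp_apply, id]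
  push_cast
  rw [mul_pow, neg_mul]
  field_simp

section

variable {W : ℂ → ℂ} {K : ℝ → ℂ} {c₄ c₂ d₂ c₀ d₀ : ℂ}

theorem HasPolar.tendsto_rem (h : HasPolar W K c₄ c₂ d₂ c₀ d₀) {a : ℝ} (ha : 0 < a) :
    Tendsto (fun t => (K t - polarPart c₄ c₂ d₂ c₀ d₀ t) * Real.exp (-a * t)) atTop (𝓝 0) := by
  have h1 : Tendsto (fun t : ℝ => Real.exp (-2 * t)) atTop (𝓝 0) := by
    have := Real.tendsto_exp_neg_atTop_nhds_zero.comp (tendsto_id.const_mul_atTop two_pos)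
    exact this.congr fun t => by simp [Function.comp_apply]
  simpa using (h.isBigO.trans_tendsto h1).mul (by simpa using tendsto_exp_poly 0 ha)

theorem HasPolar.tendsto_four (h : HasPolar W K c₄ c₂ d₂ c₀ d₀) :
    Tendsto (fun t => K t * Real.exp (-(4 * π) * t)) atTop (𝓝 c₄) := by
  have hpi := Real.pi_pos
  have h4 := tendsto_exp_poly (a := 4 * π) 0 (by positivity)
  have h4' := tendsto_exp_poly (a := 4 * π) 1 (by positivity)
  have h2 := tendsto_exp_poly (a := 2 * π) 0 (by positivity)
  have h2' := tendsto_exp_poly (a := 2 * π) 1 (by positivity)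
  have := (((((h.tendsto_rem (a := 4 * π) (by positivity)).add_const c₄).add
    (h2.const_mul c₂)).add (h2'.const_mul d₂)).add (h4.const_mul c₀)).add (h4'.const_mul d₀)
  simp only [mul_zero, add_zero, zero_add] at this
  refine this.congr fun t => ?_
  have e1 : (Real.exp (4 * π * t) : ℂ) * Real.exp (-(4 * π) * t) = 1 := by
    rw [← ofReal_mul, ← Real.exp_add]; simp
  have e2 : (Real.exp (2 * π * t) : ℂ) * Real.exp (-(4 * π) * t) = Real.exp (-(2 * π) * t) := by
    rw [← ofReal_mul, ← Real.exp_add]; congr 2; ring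
  rw [polarPart]
  linear_combination -c₄ * e1 - (c₂ + d₂ * t) * e2

/-- Once c₄ = 0 the dominant term of the kernel is d₂te^{2πt}. -/
theorem HasPolar.tendsto_two (h : HasPolar W K 0 c₂ d₂ c₀ d₀) :
    Tendsto (fun t => K t * ((t : ℂ)⁻¹ * Real.exp (-(2 * π) * t))) atTop (𝓝 d₂) := by
  have hpi := Real.pi_pos
  have ht : Tendsto (fun t : ℝ => (t : ℂ)⁻¹) atTop (𝓝 0) := by
    simpa using tendsto_inv_atTop_zero.ofReal
  have h4 := tendsto_exp_poly (a := 2 * π) 0 (by positivity)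
  have := ((((ht.mul (h.tendsto_rem (a := 2 * π) (by positivity))).add_const d₂).add
    (ht.const_mul c₂)).add ((ht.mul h4).const_mul c₀)).add (h4.const_mul d₀)
  simp only [mul_zero, add_zero, zero_add] at this
  refine this.congr' ?_
  filter_upwards [eventually_gt_atTop 0] with t ht
  have e1 : (Real.exp (2 * π * t) : ℂ) * Real.exp (-(2 * π) * t) = 1 := by
    rw [← ofReal_mul, ← Real.exp_add]; simp
  have ht0 : (t : ℂ) * (t : ℂ)⁻¹ = 1 := mul_inv_cancel₀ (by exact_mod_cast ht.ne')
  rw [polarPart]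
  linear_combination -(c₂ + d₂ * t) * (t : ℂ)⁻¹ * e1 - d₂ * ht0 -
    d₀ * (Real.exp (-(2 * π) * t) : ℂ) * ht0

end

theorem phi_num_div_tendsto : Tendsto (fun z => ((25 * E₄ z ^ 4 - 49 * E₆ z ^ 2 * E₄ z) +
    48 * E₆ z * E₄ z ^ 2 * E₂ z + (-49 * E₄ z ^ 3 + 25 * E₆ z ^ 2) * E₂ z ^ 2) / H₂ z ^ 5)
    atImInfty (𝓝 0) := by
  obtain ⟨g, hg, h⟩ := H₂_expansion
  have h1 := (phi_num_isBigO.mul (isBigO_refl (fun z => (nome z ^ 5)⁻¹) atImInfty))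
  have h2 := (h1.congr_right (g₂ := nome) fun z => by
    have := nome_ne_zero z
    field_simp).trans_tendsto nome_tendsto
  have h3 := ((((tendsto_const_nhds (x := (1 : ℂ))).add
    (nome_tendsto.pow 2)).add
      (IsBoundedAtImInfty.tendsto_nome_pow_mul hg (n := 4) (by simp))).pow 20).const_mul (16 ^ 5)
  have h4 := h2.div h3 (by norm_num)
  rw [zero_div] at h4
  refine h4.congr fun z => ?_
  rw [h]
  simp only [Pi.div_apply]
  rw [mul_pow, mul_pow, ← pow_mul, ← div_eq_mul_inv, div_div]
  ring

theorem phi_num_axis {t : ℝ} (ht : 0 < t) : (25 * E₄ (axis t) ^ 4 - 49 * E₆ (axis t) ^ 2 * E₄ (axis t))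
    + 48 * E₆ (axis t) * E₄ (axis t) ^ 2 * E₂ (axis t)
    + (-49 * E₄ (axis t) ^ 3 + 25 * E₆ (axis t) ^ 2) * E₂ (axis t) ^ 2 = -(numA t : ℝ) := by
  rw [E2_axis ht, E4_axis ht, E6_axis ht, numA]
  push_cast; ring

/-- As t → ∞ the numerator of φ has order six in the nome, whereas B has order exactly five. -/
theorem ratio_tendsto : Tendsto (fun t => numA t / numB t) atTop (𝓝 0) := by
  have h1 := ((Complex.continuous_re.tendsto _).comp (phi_num_div_tendsto.comp tendsto_axis)).neg
  have hx := h2_tendsto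
  have hy := h4_tendsto
  have h2' := h1.div ((((hy.pow 2).const_mul 7).add ((hx.mul hy).const_mul 7)).add
    ((hx.pow 2).const_mul 2)) (by norm_num)
  rw [zero_re, neg_zero, zero_div] at h2'
  refine h2'.congr' ?_
  filter_upwards [eventually_gt_atTop 0] with t ht
  have h1 := (H2_axis_pos ht).1
  have h2 := (H4_axis_pos ht).1
  simp only [Pi.div_apply, Function.comp_apply]
  rw [phi_num_axis ht, (H2_axis_pos ht).2, ← ofReal_neg, ← ofReal_pow, ← ofReal_div, ofReal_re, numB]
  field_simp

theorem numA_nonneg {t : ℝ} (ht : 0 < t) : 0 ≤ numA t := by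
  have h := AntitoneOn.nonneg_of_tendsto_zero ratio_antitone ratio_tendsto ht
  have hB := numB_pos ht
  rwa [le_div_iff₀ hB, zero_mul] at h

/-- The positive factor `t¹⁰ / Δ(i/t)²` common to both kernels on the imaginary axis. -/
def factor (t : ℝ) : ℝ := t ^ 10 / ((e4 t⁻¹ ^ 3 - e6 t⁻¹ ^ 2) / 1728) ^ 2

theorem discriminant_axis {t : ℝ} (ht : 0 < t) :
    discriminant (axis t) = ((e4 t ^ 3 - e6 t ^ 2) / 1728 : ℝ) := by
  rw [discriminant_eq_E₄_cube_sub_E₆_sq, E4_axis ht, E6_axis ht]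
  push_cast; ring

theorem factor_pos {t : ℝ} (ht : 0 < t) : 0 < factor t := by
  have hs := inv_pos.mpr ht
  have h := weber_pos hs
  rw [weber] at h
  rw [factor, e4_cube_sub_e6_sq hs]
  positivity

/-- The sign (it)^{10} = -t^{10} is the reason for the minus sign in `numA` and in `numB`. -/
theorem kernelA_axis {t : ℝ} (ht : 0 < t) :
    kernelA (I * t) = (factor t * numA t⁻¹ : ℝ) := by
  have hs := inv_pos.mpr ht
  rw [kernelA, ← coe_axis ht, ofComplex_neg_one_div, ← axis_inv ht, phi, phi_num_axis hs,
    discriminant_axis hs, coe_axis ht, factor, mul_pow,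
    show (I : ℂ) ^ 10 = -1 by rw [show (10 : ℕ) = 2 * 5 from rfl, pow_mul, I_sq]; norm_num]
  push_cast; ring

theorem kernelB_axis {t : ℝ} (ht : 0 < t) :
    kernelB (I * t) = (factor t * numB t⁻¹ : ℝ) := by
  have hs := inv_pos.mpr ht
  have h := psiI_S (axis t⁻¹)
  rw [← axis_inv hs, inv_inv, coe_axis hs, psiS, (H2_axis_pos hs).2, (H4_axis_pos hs).2,
    discriminant_axis hs, mul_pow,
    show (I : ℂ) ^ 10 = -1 by rw [show (10 : ℕ) = 2 * 5 from rfl, pow_mul, I_sq]; norm_num] at h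
  have ht0 : (t : ℂ) ≠ 0 := by exact_mod_cast ht.ne'
  have ht1 : (t : ℂ) ^ 10 * ((t⁻¹ : ℝ) : ℂ) ^ 10 = 1 := by
    push_cast; rw [← mul_pow, mul_inv_cancel₀ ht0, one_pow]
  rw [kernelB, ← coe_axis ht, ofComplex_apply, factor, numB]
  push_cast at h ht1 ⊢
  linear_combination -(t : ℂ) ^ 10 * h - psiI (axis t) * ht1

/-- The common positive factor cancels, so A(1/t)/B(1/t) is the ratio of the kernels, which tends to
the ratio of their e^{4πt} coefficients, (864/π²)/2. -/
theorem kernel_ratio_tendsto :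
    Tendsto (fun t => numA t⁻¹ / numB t⁻¹) atTop (𝓝 (432 / π ^ 2)) := by
  have h := (Complex.continuous_re.tendsto _).comp
    (hasPolar_A.tendsto_four.div hasPolar_B.tendsto_four (by norm_num))
  have e : (864 / π ^ 2 / 2 : ℂ).re = 432 / π ^ 2 := by
    rw [show (864 / π ^ 2 / 2 : ℂ) = ((432 / π ^ 2 : ℝ) : ℂ) by push_cast; ring, ofReal_re]
  rw [e] at h
  refine h.congr' ?_
  filter_upwards [eventually_gt_atTop 0] with t ht
  have h1 := factor_pos ht
  have h2 := numB_pos (inv_pos.mpr ht)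
  simp only [Pi.div_apply, Function.comp_apply]
  rw [kernelA_axis ht, kernelB_axis ht, ← ofReal_mul, ← ofReal_mul, ← ofReal_div, ofReal_re]
  field_simp

/-- A/B decreases in its argument, hence lies below its limit as the argument tends to 0. -/
theorem numA_le {t : ℝ} (ht : 0 < t) : numA t⁻¹ ≤ 432 / π ^ 2 * numB t⁻¹ := by
  have h2 := numB_pos (inv_pos.mpr ht)
  rw [← div_le_iff₀ h2]
  refine ge_of_tendsto kernel_ratio_tendsto ?_
  filter_upwards [eventually_ge_atTop t] with s hs
  exact ratio_antitone (inv_pos.mpr (ht.trans_le hs)) (inv_pos.mpr ht) (inv_anti₀ ht hs)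

/-- `magicKernel` is real. -/
def realKernel (δ t : ℝ) : ℝ :=
  factor t * (-(π / 28304640 * numA t⁻¹) - δ / (65520 * π) * numB t⁻¹)

theorem magicKernel_eq (δ : ℝ) {t : ℝ} (ht : 0 < t) : magicKernel δ t = realKernel δ t := by
  have hpi : (π : ℂ) ≠ 0 := by exact_mod_cast Real.pi_ne_zero
  rw [magicKernel, kernelA_axis ht, kernelB_axis ht, realKernel]
  push_cast
  generalize (factor t : ℂ) = F, (numA t⁻¹ : ℂ) = A, (numB t⁻¹ : ℂ) = B
  field_simp
  linear_combination (1944130419818496000 * F * A * π ^ 2 + 839864341361590272000 * F * B * δ : ℂ)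
    * I_sq

theorem realKernel_one_neg {t : ℝ} (ht : 0 < t) : realKernel 1 t < 0 := by
  have h1 := factor_pos ht
  have h2 := numB_pos (inv_pos.mpr ht)
  have h3 := numA_nonneg (inv_pos.mpr ht)
  have hpi := Real.pi_pos
  refine mul_neg_of_pos_of_neg h1 ?_
  have h4 : 0 ≤ π / 28304640 * numA t⁻¹ := by positivity
  have h5 : 0 < 1 / (65520 * π) * numB t⁻¹ := by positivity
  linarith

/-- The condition is A/B ≤ 28304640/(65520π²) = 432/π². The sharp bound matches because the
normalization of f cancels the e^{4πt} terms for δ = -1. -/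
theorem realKernel_neg_one_nonneg {t : ℝ} (ht : 0 < t) : 0 ≤ realKernel (-1) t := by
  have hpi := Real.pi_pos
  refine mul_nonneg (factor_pos ht).le ?_
  have h := mul_le_mul_of_nonneg_left (numA_le ht) (show 0 ≤ π / 28304640 by positivity)
  have e : π / 28304640 * (432 / π ^ 2 * numB t⁻¹) = -(-1 / (65520 * π) * numB t⁻¹) := by
    field_simp; ring
  linarith

/-- With c₄ = 0 the kernel behaves like te^{2πt}/39 for large t, so it is not identically zero. -/
theorem exists_realKernel_neg_one_pos : ∃ t, 0 < t ∧ 0 < realKernel (-1) t := by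
  have h := magic_hasPolar (-1)
  rw [show -(1 + -1 : ℂ) / (32760 * π) = 0 by simp] at h
  have h1 := (Complex.continuous_re.tendsto _).comp h.tendsto_two
  have h2 := h1.eventually (lt_mem_nhds (show (0 : ℝ) < (1 / 39 : ℂ).re by norm_num))
  obtain ⟨t, h3, ht⟩ := (h2.and (eventually_gt_atTop 0)).exists
  refine ⟨t, ht, ?_⟩
  have e := magicKernel_eq (-1) ht
  rw [ofReal_neg, ofReal_one] at e
  rw [Function.comp_apply, e, ← ofReal_inv, ← ofReal_mul, ← ofReal_mul, ofReal_re] at h3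
  exact pos_of_mul_pos_left h3 (by positivity)

theorem continuousOn_magicKernel (δ : ℂ) : ContinuousOn (magicKernel δ) (Ioi 0) :=
  (isKernel_A.continuousOn_axis.const_mul _).add (isKernel_B.continuousOn_axis.const_mul _)

theorem integral_pos_of_nonneg {K : ℝ → ℂ} {k : ℝ → ℝ} (hK : ∀ t, 0 < t → K t = k t)
    (hc : ContinuousOn K (Ioi 0)) {a : ℝ}
    (hi : IntegrableOn (fun t => K t * Real.exp (-a * t)) (Ioi 0))
    (h0 : ∀ t, 0 < t → 0 ≤ k t) {t : ℝ} (ht : 0 < t) (hpos : 0 < k t) :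
    ∫ t in Ioi (0 : ℝ), K t * Real.exp (-a * t) ≠ 0 := by
  have e : ∀ t ∈ Ioi (0 : ℝ), K t * Real.exp (-a * t) = ((k t * Real.exp (-a * t) : ℝ) : ℂ) :=
    fun t ht => by rw [hK t ht]; push_cast; rfl
  rw [setIntegral_congr_fun measurableSet_Ioi e, integral_complex_ofReal]
  have hi' : IntegrableOn (fun t => k t * Real.exp (-a * t)) (Ioi 0) :=
    IntegrableOn.congr_fun hi.re (fun t ht => by
      have := e t ht
      simp only [RCLike.re_eq_complex_re] at *
      rw [this, ofReal_re]) measurableSet_Ioi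
  have hpos' : 0 < ∫ t in Ioi (0 : ℝ), k t * Real.exp (-a * t) := by
    rw [setIntegral_pos_iff_support_of_nonneg_ae ?_ hi']
    -- By continuity a single point of positivity gives a nonempty open set, hence one of positive
    -- measure.
    · have hopen : IsOpen (Ioi 0 ∩ (fun t => (K t).re) ⁻¹' Ioi 0) :=
        (Complex.continuous_re.comp_continuousOn hc).isOpen_inter_preimage isOpen_Ioi isOpen_Ioi
      refine (hopen.measure_pos volume ⟨t, ht, ?_⟩).trans_le (measure_mono fun s hs => ⟨?_, hs.1⟩)
      · rw [mem_preimage, hK t ht, ofReal_re]; exact hpos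
      · have h1 := hs.2
        rw [mem_preimage, hK s hs.1, ofReal_re] at h1
        exact (mul_pos h1 (Real.exp_pos _)).ne'
    · exact (ae_restrict_iff' measurableSet_Ioi).mpr (Eventually.of_forall fun t ht =>
        mul_nonneg (h0 t ht) (Real.exp_pos _).le)
  exact_mod_cast hpos'.ne'

theorem integral_magicKernel_neg_one_ne_zero {n : ℕ} (hn : 2 ≤ n) :
    ∫ t in Ioi (0 : ℝ), magicKernel (-1) t * Real.exp (-(π * (2 * n)) * t) ≠ 0 := by
  have hn' : (2 : ℝ) ≤ n := by exact_mod_cast hn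
  obtain ⟨t, ht, hpos⟩ := exists_realKernel_neg_one_pos
  refine integral_pos_of_nonneg (k := realKernel (-1))
    (fun t ht => by simpa using magicKernel_eq (-1) ht) (continuousOn_magicKernel _)
    -- At n = 2 the exponent is s = 4, so convergence relies on the vanishing of c₄.
    ((magic_hasPolar (-1)).laplace_eq (by linarith) (.inl (by simp))).1
    (fun t ht => realKernel_neg_one_nonneg ht) ht hpos

theorem integral_magicKernel_one_ne_zero {n : ℕ} (hn : 3 ≤ n) :
    ∫ t in Ioi (0 : ℝ), magicKernel 1 t * Real.exp (-(π * (2 * n)) * t) ≠ 0 := by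
  have hn' : (3 : ℝ) ≤ n := by exact_mod_cast hn
  have h := integral_pos_of_nonneg (K := fun t => -magicKernel 1 t) (k := fun t => -realKernel 1 t)
    (a := π * (2 * n)) (fun t ht => by simpa using magicKernel_eq 1 ht)
    (continuousOn_magicKernel _).neg 
    (((magic_hasPolar 1).laplace_eq (s := 2 * n) (by linarith) (.inr (by linarith))).1.neg.congr_fun
      (fun t _ => by simp) measurableSet_Ioi)
    (fun t ht => by linarith [realKernel_one_neg ht]) one_pos
    (by linarith [realKernel_one_neg one_pos])
  intro h0
  apply h
  simp only [neg_mul] at h0 ⊢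
  rw [integral_neg, h0, neg_zero]

end Leech
end

/-! ### Special values, derivatives and orders -/

noncomputable section
namespace Leech

open Complex Filter

theorem ofReal_sqrt_two_sq : ((Real.sqrt 2 : ℝ) : ℂ) ^ 2 = 2 := by
  rw [← ofReal_pow, Real.sq_sqrt two_pos.le, ofReal_ofNat]

theorem magic_comp_sq_zero (δ : ℂ) : magic δ (((0 : ℝ) : ℂ) ^ 2) = 1 ∧
    AnalyticAt ℝ (fun r : ℝ => magic δ ((r : ℂ) ^ 2)) 0 ∧
    iteratedDeriv 2 (fun r : ℝ => magic δ ((r : ℂ) ^ 2)) 0 / (Nat.factorial 2 : ℂ) =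
      (-10761 - 3586 * δ) / 5460 := by
  have h := magic_hasPolar δ
  have hpi : (π : ℂ) ≠ 0 := by exact_mod_cast Real.pi_ne_zero
  refine ⟨?_, analyticAt_comp_sq h.analytic 0, ?_⟩
  · rw [ofReal_zero, zero_pow two_ne_zero, h.at_zero.1]; norm_num
  · rw [iteratedDeriv_two_comp_sq h.analytic h.at_zero.2, Nat.factorial_two]
    push_cast
    field_simp
    ring

theorem magic_comp_sq_sqrt_two (δ : ℂ) : magic δ ((Real.sqrt 2 : ℂ) ^ 2) = 1 / 156 ∧
    HasDerivAt (fun r : ℝ => magic δ ((r : ℂ) ^ 2))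
      ((-321 + 29 * δ) / 8190 * Real.sqrt 2) (Real.sqrt 2) := by
  have h := magic_hasPolar δ
  have hpi : (π : ℂ) ≠ 0 := by exact_mod_cast Real.pi_ne_zero
  constructor
  · rw [ofReal_sqrt_two_sq, h.at_two.1]; norm_num
  · have h2 := h.at_two.2
    rw [← ofReal_sqrt_two_sq] at h2
    refine (hasDerivAt_comp_sq h2).congr_deriv ?_
    field_simp
    ring

theorem magic_one_comp_sq_two : analyticOrderAt (fun r : ℝ => magic 1 ((r : ℂ) ^ 2)) 2 = 1 ∧
    HasDerivAt (fun r : ℝ => magic 1 ((r : ℂ) ^ 2)) (-1 / 16380) 2 := by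
  have h := magic_hasPolar 1
  have hpi : (π : ℂ) ≠ 0 := by exact_mod_cast Real.pi_ne_zero
  have e : (((2 : ℝ) : ℂ)) ^ 2 = 4 := by push_cast; norm_num
  have hd : HasDerivAt (fun r : ℝ => magic 1 ((r : ℂ) ^ 2)) (-1 / 16380) 2 := by
    have h4 := h.at_four.2
    rw [← e] at h4
    refine (hasDerivAt_comp_sq h4).congr_deriv ?_
    push_cast
    field_simp
    norm_num
  refine ⟨?_, hd⟩
  -- A nonzero derivative gives order one for the function minus its value, and the value here is 0
  -- by `HasPolar.at_four`.
  have h1 := (analyticAt_comp_sq h.analytic 2).analyticOrderAt_sub_eq_one_of_deriv_ne_zero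
    (by rw [hd.deriv]; norm_num)
  simpa only [e, h.at_four.1, sub_zero] using h1

theorem magic_comp_sq_order {δ : ℂ} {n : ℕ} (hn : 2 ≤ n) (hδ : δ = -1 ∨ 3 ≤ n)
    (h0 : ∫ t in Set.Ioi (0 : ℝ), magicKernel δ t * Real.exp (-(π * (2 * n)) * t) ≠ 0) :
    analyticOrderAt (fun r : ℝ => magic δ ((r : ℂ) ^ 2)) (Real.sqrt (2 * n)) = 2 := by
  have h := magic_hasPolar δ
  have hpi : (π : ℂ) ≠ 0 := by exact_mod_cast Real.pi_ne_zero
  obtain ⟨g, hg, hg0, hW⟩ := h.double_zero hn (hδ.imp_left fun e => by simp [e])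
  refine order_two_comp_sq h.analytic (by omega) hg ?_ hW
  rw [hg0]
  exact mul_ne_zero (by simp [hpi]) h0

end Leech
end

theorem mainTheorem7 :
    -- the two eigenfunctions are well defined
    (∃! a : ℝ → ℂ, Leech.IsAnalyticContinuation Leech.aIntegral a) ∧
    (∃! b : ℝ → ℂ, Leech.IsAnalyticContinuation Leech.bIntegral b) ∧
    ∀ a b f fhat : ℝ → ℂ,
      Leech.IsAnalyticContinuation Leech.aIntegral a →
      Leech.IsAnalyticContinuation Leech.bIntegral b →
      f = Leech.auxFunction a b →
      fhat = Leech.radialFourier f →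
      -- values and quadratic Taylor coefficients at `0`
      f 0 = 1 ∧ fhat 0 = 1 ∧
      (AnalyticAt ℝ f 0 ∧ iteratedDeriv 2 f 0 / (Nat.factorial 2 : ℂ) = -14347 / 5460) ∧
      (AnalyticAt ℝ fhat 0 ∧ iteratedDeriv 2 fhat 0 / (Nat.factorial 2 : ℂ) = -205 / 156) ∧
      -- roots, with exact multiplicities
      (∀ k : ℕ, 3 ≤ k → analyticOrderAt f (Real.sqrt (2 * k)) = 2) ∧
      (∀ k : ℕ, 2 ≤ k → analyticOrderAt fhat (Real.sqrt (2 * k)) = 2) ∧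
      (analyticOrderAt f 2 = 1 ∧ HasDerivAt f (-1 / 16380) 2) ∧
      -- values and derivatives at `√2`
      (f (Real.sqrt 2) = 1 / 156 ∧
        HasDerivAt f (-146 * (Real.sqrt 2 : ℂ) / 4095) (Real.sqrt 2)) ∧
      (fhat (Real.sqrt 2) = 1 / 156 ∧
        HasDerivAt fhat (-5 * (Real.sqrt 2 : ℂ) / 117) (Real.sqrt 2)) := by
  refine ⟨⟨_, Leech.aIntegral_continuation, fun _ h =>
      Leech.isAnalyticContinuation_unique h Leech.aIntegral_continuation⟩,
    ⟨_, Leech.bIntegral_continuation, fun _ h =>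
      Leech.isAnalyticContinuation_unique h Leech.bIntegral_continuation⟩, ?_⟩
  rintro a b f fhat ha hb rfl rfl
  rw [Leech.auxFunction_eq ha hb, Leech.radialFourier_magic]
  obtain ⟨f0, fa, fc⟩ := Leech.magic_comp_sq_zero 1
  obtain ⟨g0, ga, gc⟩ := Leech.magic_comp_sq_zero (-1)
  obtain ⟨f2, fd⟩ := Leech.magic_comp_sq_sqrt_two 1
  obtain ⟨g2, gd⟩ := Leech.magic_comp_sq_sqrt_two (-1)
  exact ⟨f0, g0, ⟨fa, fc.trans (by norm_num)⟩, ⟨ga, gc.trans (by norm_num)⟩,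
    fun k hk => Leech.magic_comp_sq_order (by omega) (.inr hk)
      (Leech.integral_magicKernel_one_ne_zero hk),
    fun k hk => Leech.magic_comp_sq_order hk (.inl rfl)
      (Leech.integral_magicKernel_neg_one_ne_zero hk),
    Leech.magic_one_comp_sq_two, ⟨f2, fd.congr_deriv (by ring)⟩, ⟨g2, gd.congr_deriv (by ring)⟩⟩
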